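/- Let $\hbar\neq 0$ be a real or complex number, let ${\bf t}=(t_1,t_2,\ldots)$, and let $h_k$ be defined by $\exp\bigl(\sum_{k\ge1}t_kz^k\bigr)=\sum_{k\ge0}h_k({\bf t})z^k$, $h_k=0$ for $k<0$; for a Young diagram $\lambda$ with $\ell(\lambda)$ nonzero rows put $s_\lambda({\bf t})=\det_{1\le i,j\le\ell(\lambda)}h_{\lambda_i-i+j}({\bf t})$. A formal series $\tau({\bf t})$ is called a tau-function of the $\hbar$-KP hierarchy if $$(z_1-z_2)\tau^{[z_1,z_2]}\tau^{[z_3]}+(z_2-z_3)\tau^{[z_2,z_3]}\tau^{[z_1]}+(z_3-z_1)\tau^{[z_3,z_1]}\tau^{[z_2]}=0$$ identically in ${\bf t}$ and $z_1^{-1},z_2^{-1},z_3^{-1}$, where $\tau^{[z_1,\ldots,z_m]}({\bf t})=\tau\bigl(t_1+\hbar\sum_i z_i^{-1},\,t_2+\tfrac{\hbar}{2}\sum_i z_i^{-2},\,\ldots\bigr)$. Let $\partial_k^\hbar=\frac{k}{\hbar}h_k(\hbar\partial_{t_1},\frac{\hbar}{2}\partial_{t_2},\frac{\hbar}{3}\partial_{t_3},\ldots)$.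 All functions of $x$ are real- or complex-valued functions on an open set $U\subseteq\mathbb R$. **Theorem 1.** (a) Let $\tau(x;{\bf t})=f(x)\hat\tau(x+t_1,t_2,\ldots)$ be, for every $x$, a tau-function of the $\hbar$-KP hierarchy with respect to ${\bf t}$, where $\hat\tau(y,t_2,t_3,\ldots)$ is a formal series in $t_2,t_3,\ldots$ with coefficients infinitely differentiable in $y$ (its dependence on $x+t_1$ being Taylor-expanded in $t_1$), and where $\tau(x;{\bf 0})$ is infinitely differentiable. Then the coefficients of the (unique) expansion $$\tau(x;{\bf t})=\sum_\lambda c_\lambda(x)s_\lambda({\bf t}/\hbar)\qquad(1)$$ satisfy, with $c_0=c_\emptyset$, $c_k=c_{(k)}$ and $c_k=0$ for $k<0$, at every $x$ with $c_0(x)\ne0$, $$c_\lambda(x)=c_0(x)^{1-\ell(\lambda)}\det_{1\le i,j\le\ell(\lambda)}\Bigl[\sum_{k=0}^{j-1}(-\hbar)^k\binom{j-1}{k}\partial_x^kc_{\lambda_i-i+j-k}(x)\Bigr],\qquad(2)$$ all $c_\lambda$ being infinitely differentiable and $f$ being nonzero and differentiable at such $x$. Moreover $c_1=\hbar\,(\partial_xc_0-c_0\,\partial_xf/f)$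 at every $x$ where $f$ is nonzero and differentiable. (b) Conversely, let $c_0,c_1,c_2,\ldots$ be arbitrary infinitely differentiable functions of $x$ with $c_0\not\equiv0$, and define $c_\lambda$ by (2) on the open set $V$ where $c_0\neq0$. Then for every $x\in V$ the series (1) is a tau-function of the $\hbar$-KP hierarchy; it has the form $f(x)\hat\tau(x+t_1,t_2,\ldots)$ on $V$, with $f$ infinitely differentiable and nowhere zero on $V$ and $\hat\tau$ a formal series as in (a) with coefficients infinitely differentiable on $V$; and its Cauchy-like data are $$\tau(x;{\bf 0})=c_0(x),\qquad\partial_k^\hbar\tau(x;{\bf t})\big|_{{\bf t}=0}=\frac{k}{\hbar}\,c_k(x),\quad k\ge1.$$ -/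

import Mathlib

open scoped ContDiff Nat

namespace HbarKP

noncomputable section

/-- The elementary Schur polynomial `h_k(a_1, a_2, …)` evaluated at elements `a_1, a_2, …` of a
`𝕜`-algebra `A` (for instance formal variables, or commuting differential operators): the
coefficient of `z ^ k` in `exp (∑_{i ≥ 1} a_i z ^ i) = ∑_l (∑_{i ≥ 1} a_i z ^ i) ^ l / l!`, where
only the terms with `l ≤ k` contribute to `z ^ k`. It is `0` for negative `k`. -/
def elemSchur (𝕜 : Type*) [Field 𝕜] {A : Type*} [Ring A] [Algebra 𝕜 A] (a : ℕ+ → A) : ℤ → A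
  | Int.ofNat k =>
      ∑ l ∈ Finset.range (k + 1), ((l ! : 𝕜)⁻¹) •
        PowerSeries.coeff k
          ((PowerSeries.mk fun n : ℕ => if hn : 0 < n then a ⟨n, hn⟩ else 0) ^ l)
  | Int.negSucc _ => 0

/-- The number `ℓ(lam)` of nonzero rows of a Young diagram. -/
def numRows (lam : YoungDiagram) : ℕ := lam.colLen 0

/-- The one-row Young diagram `(k)`; for `k = 0` it is the empty diagram. -/
def rowDiagram (k : ℕ) : YoungDiagram where
  cells := {0} ×ˢ Finset.range k
  isLowerSet := by
    rintro ⟨i, j⟩ ⟨i', j'⟩ ⟨hi : i' ≤ i, hj : j' ≤ j⟩ h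
    simp only [Finset.coe_product, Finset.coe_singleton, Finset.coe_range, Set.mem_prod,
      Set.mem_singleton_iff, Set.mem_Iio] at h ⊢
    omega

/-- The Schur function `s_lam(a_1, a_2, …) = det (h_{lam_i - i + j})_{1 ≤ i, j ≤ ℓ(lam)}`
(the indices below start from `0`, which does not change `j - i`). -/
def schur (𝕜 : Type*) [Field 𝕜] {A : Type*} [CommRing A] [Algebra 𝕜 A] (a : ℕ+ → A)
    (lam : YoungDiagram) : A :=
  Matrix.det (Matrix.of fun i j : Fin (numRows lam) =>
    elemSchur 𝕜 a ((lam.rowLen i : ℤ) - (i : ℕ) + (j : ℕ)))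

section Formal

variable {𝕜 : Type*} [Field 𝕜]

/-- `s_lam(t / ħ)` as a formal series in the times `t_1, t_2, …`. -/
def schurTimes (ħ : 𝕜) (lam : YoungDiagram) : MvPowerSeries ℕ+ 𝕜 :=
  schur 𝕜 (fun k : ℕ+ => ħ⁻¹ • (MvPowerSeries.X k : MvPowerSeries ℕ+ 𝕜)) lam

/-- `T = ∑_lam b_lam s_lam(t / ħ)` as an identity of formal series: every monomial in the times
occurs in finitely many summands only, and its coefficients on the two sides agree. -/
def IsSchurExpansion (ħ : 𝕜) (b : YoungDiagram → 𝕜) (T : MvPowerSeries ℕ+ 𝕜) : Prop :=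
  ∀ d : ℕ+ →₀ ℕ,
    (Function.support fun lam => b lam * MvPowerSeries.coeff d (schurTimes ħ lam)).Finite ∧
    MvPowerSeries.coeff d T = ∑ᶠ lam, b lam * MvPowerSeries.coeff d (schurTimes ħ lam)

/-- The formal variable `w_i = 1 / z_i`, `i = 0, 1, 2`. -/
def invZ (𝕜 : Type*) [Field 𝕜] (i : Fin 3) : MvPowerSeries (ℕ+ ⊕ Fin 3) 𝕜 :=
  MvPowerSeries.X (Sum.inr i)

/-- The `k`-th entry `t_k + ∑_{i ∈ S} (ħ / k) z_i ^ (-k)` of `t + ħ ∑_{i ∈ S} [z_i⁻¹]`. -/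
def shiftedTime (ħ : 𝕜) (S : Finset (Fin 3)) (k : ℕ+) : MvPowerSeries (ℕ+ ⊕ Fin 3) 𝕜 :=
  MvPowerSeries.X (Sum.inl k) + ∑ i ∈ S, (ħ / ((k : ℕ) : 𝕜)) • invZ 𝕜 i ^ (k : ℕ)

/-- The shifted series `T(t + ħ ∑_{i ∈ S} [z_i⁻¹])`, a formal series in `t` and the `z_i⁻¹`. -/
def miwa (ħ : 𝕜) (S : Finset (Fin 3)) (T : MvPowerSeries ℕ+ 𝕜) :
    MvPowerSeries (ℕ+ ⊕ Fin 3) 𝕜 :=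
  MvPowerSeries.subst (shiftedTime ħ S) T

/-- The Hirota equation of the `ħ`-KP hierarchy for a formal series `T` in the times,
`(z_0 - z_1) T^{[z_0, z_1]} T^{[z_2]} + (z_1 - z_2) T^{[z_1, z_2]} T^{[z_0]}`
`+ (z_2 - z_0) T^{[z_2, z_0]} T^{[z_1]} = 0`,
as an identity of formal series in `t` and `w_i = z_i⁻¹`, after multiplication by `w_0 w_1 w_2`:
`w_0 w_1 w_2 (z_0 - z_1) = (w_1 - w_0) w_2`, and so on. -/
def IsTauFunction (ħ : 𝕜) (T : MvPowerSeries ℕ+ 𝕜) : Prop :=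
  (invZ 𝕜 1 - invZ 𝕜 0) * invZ 𝕜 2 * miwa ħ {0, 1} T * miwa ħ {2} T +
  (invZ 𝕜 2 - invZ 𝕜 1) * invZ 𝕜 0 * miwa ħ {1, 2} T * miwa ħ {0} T +
  (invZ 𝕜 0 - invZ 𝕜 2) * invZ 𝕜 1 * miwa ħ {2, 0} T * miwa ħ {1} T = 0

/-- The `ħ`-deformed partial derivative
`∂_k^ħ = (k / ħ) h_k(ħ ∂_1, (ħ / 2) ∂_2, (ħ / 3) ∂_3, …)`,
an operator on formal series in the times. -/
def hbarDeriv (ħ : 𝕜) (k : ℕ) : Module.End 𝕜 (MvPowerSeries ℕ+ 𝕜) :=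
  ((k : 𝕜) / ħ) • elemSchur 𝕜
    (fun i : ℕ+ => ((ħ / ((i : ℕ) : 𝕜)) • (MvPowerSeries.pderiv 𝕜 i).toLinearMap :
      Module.End 𝕜 (MvPowerSeries ℕ+ 𝕜))) (k : ℤ)

/-- The substitution in `miwa` is a legitimate one. -/
theorem hasSubst_shiftedTime (ħ : 𝕜) (S : Finset (Fin 3)) :
    MvPowerSeries.HasSubst (shiftedTime ħ S) := by
  classical
  constructor
  · intro k
    have : MvPowerSeries.constantCoeff (shiftedTime ħ S k) = 0 := by
      simp [shiftedTime, invZ, map_sum, MvPowerSeries.constantCoeff_smul]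
    rw [this]
    exact IsNilpotent.zero
  · intro d
    refine Set.Finite.subset (s := (d.support.image fun v => Sum.elim id (fun i =>
      if h : 0 < d (Sum.inr i) then ⟨d (Sum.inr i), h⟩ else 1) v : Finset ℕ+)) ?_ ?_
    · exact Finset.finite_toSet _
    · intro k hk
      by_contra hcon
      apply hk
      simp only [shiftedTime, invZ, map_add, map_sum, MvPowerSeries.coeff_smul]
      have h1 : MvPowerSeries.coeff d
          (MvPowerSeries.X (Sum.inl k) : MvPowerSeries (ℕ+ ⊕ Fin 3) 𝕜) = 0 := by
        rw [MvPowerSeries.coeff_X, if_neg]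
        rintro rfl
        apply hcon
        simp
      rw [h1, zero_add]
      refine Finset.sum_eq_zero fun i _ => ?_
      rw [MvPowerSeries.coeff_X_pow, if_neg, mul_zero]
      rintro rfl
      apply hcon
      simp only [Finset.coe_image, Set.mem_image, Finset.mem_coe]
      refine ⟨Sum.inr i, by simp, ?_⟩
      simp
      rfl

end Formal

section Functions

variable {𝕜 : Type*} [RCLike 𝕜]

/-- For `τhat(y; t_2, t_3, …)`, a formal series in `t_2, t_3, …` with coefficients depending on
`y`, the formal series `τhat(x + t_1; t_2, t_3, …)` in all times, obtained by Taylor expansion of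
every coefficient in powers of `t_1` at the point `x`. -/
def taylorShift (τhat : ℝ → MvPowerSeries {k : ℕ+ // k ≠ 1} 𝕜) (x : ℝ) : MvPowerSeries ℕ+ 𝕜 :=
  fun d => iteratedDeriv (d 1)
    (fun y => MvPowerSeries.coeff (d.subtypeDomain fun k : ℕ+ => k ≠ 1) (τhat y)) x / ((d 1)! : 𝕜)

/-- A function-valued formal series is smooth on `U` if all its coefficients are. -/
def SmoothCoeffsOn {σ : Type*} (τ : ℝ → MvPowerSeries σ 𝕜) (U : Set ℝ) : Prop :=
  ∀ d : σ →₀ ℕ, ContDiffOn ℝ ∞ (fun x => MvPowerSeries.coeff d (τ x)) U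

/-- A sequence `c_0, c_1, …` of functions extended by `c_k = 0` for `k < 0`. -/
def extendZero (c : ℕ → ℝ → 𝕜) : ℤ → ℝ → 𝕜
  | Int.ofNat k => c k
  | Int.negSucc _ => 0

/-- The expression
`c_0 ^ (1 - ℓ) det [∑_{k=0}^{j-1} (-ħ) ^ k binom(j - 1, k) ∂_x ^ k c_{lam_i - i + j - k}]`,
`1 ≤ i, j ≤ ℓ = ℓ(lam)`, at the point `x`. The indices below are `i - 1` and `j - 1`. -/
def detCoeff (ħ : 𝕜) (c : ℕ → ℝ → 𝕜) (lam : YoungDiagram) (x : ℝ) : 𝕜 :=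
  c 0 x ^ (1 - (numRows lam : ℤ)) *
    Matrix.det (Matrix.of fun i j : Fin (numRows lam) =>
      ∑ k ∈ Finset.range ((j : ℕ) + 1), (-ħ) ^ k * (Nat.choose j k : 𝕜) *
        iteratedDeriv k (extendZero c ((lam.rowLen i : ℤ) - (i : ℕ) + (j : ℕ) - (k : ℕ))) x)

end Functions

end

end HbarKP

open HbarKP

/-!
Write `h_n(∂)` for `opSchur`, the elementary Schur polynomial of the operators `ħ ∂_k / k`, and
pair a polynomial in them with a formal series by evaluating at `t = 0` (`pairing`). The
restriction of a series `T` to the Miwa points `t_k = (ħ / k) ∑ w_i ^ k`, with `m` parameters,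
becomes after multiplication by the Vandermonde determinant a series whose coefficients are the
Plücker coordinates `det (h_{p_i + j}(∂)) T` at `t = 0` (`coeff_vandet_mul_miwaPoint`). With the
bialternant formula for Schur functions this makes `s_λ(t / ħ)` and `s_λ(∂)` dual to each other
(`pairing_schurTimes_schurOp`). Hence every series has a unique Schur expansion, with coefficients
`pairing T (schurOp ħ lam)` (`isSchurExpansion_iff`), and all questions about these coefficients
are questions about restrictions to Miwa points.

From tau-functions to determinants. The limit `z_3 → ∞` of the Hirota equation is a two-point
formula (`IsTauFunction.fay`), which expresses the double shift of `τ` by a `2 × 2` determinant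
with entries `w_i ^ (1 - j) (1 - ħ w_i ∂_1) ^ j τ^{[z_i]}`, where `w_i = 1 / z_i`. Iterating it as
a chain of Darboux transformations gives the `m × m` determinant for `m` shifts
(`prod_mul_iterShift`). At `t = 0` the coefficients of this formula are the Plücker coordinates in
terms of the one-row coefficients of the `∂_1 ^ k τ` (`IsTauFunction.pairing_det`). If `τ / f`
depends on `x + t_1`, then `∂_1` is `∂_x` on it, and the determinants only get multiplied by a
power of `f` when all functions are multiplied by `f` (`det_leibniz`). This is
`eq_detCoeff_of_isTauFunction`; the formula for `c_1` is `coeff_row_one_eq`.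

From determinants to tau-functions. If the Plücker coordinates of `T` have the form `γ_m det
(M_j(p_i))`, its restrictions to Miwa points are determinants in the generating series `∑_n M_j(n)
w ^ n`. The Hirota equation, restricted to Miwa points in `t` as well, is then a three-term
Plücker relation between determinants that differ in two rows (`twoRows_mul_twoRows`,
`isTauFunction_of_pairing_det`), and a series is determined by these restrictions. For the
dependence on `x`, the Pieri rule computes the Schur coefficients of `∂_1 T`, and the derivative
of a determinant those of `∂_x T`; they show that `∂_1 T = ∂_x T - g T` with `g = (c_0' - c_1 / ħ)
/ c_0` (`coeff_pderiv_eq_of_isSchurExpansion`). If `f' = g f` with `f` nowhere zero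
(`exists_deriv_eq_mul`), then `∂_1` and `∂_x` agree on `T / f`, which therefore depends on `x +
t_1` only (`exists_eq_taylorShift`). This proves `exists_formal_solution`.
-/


namespace HbarKP

noncomputable section

/-! ### Substitution into formal power series -/

section Subst

open MvPowerSeries

variable {R : Type*} [CommRing R] {σ τ : Type*}

/-- Only finitely many monomials contribute to a given coefficient of a substituted series. -/
theorem finite_coeff_prod_ne_zero {a : σ → MvPowerSeries τ R} (ha : HasSubst a) (d : τ →₀ ℕ) :
    {e : σ →₀ ℕ | coeff d (e.prod fun s n => a s ^ n) ≠ 0}.Finite := by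
  have h := coeff_subst_finite (R := R) ha (fun _ => (1 : R)) d
  refine h.subset ?_
  intro e he
  have h1 : coeff e (fun _ => (1 : R)) = 1 := rfl
  simpa [Function.mem_support, h1] using he

theorem coeff_subst_eq_sum {a : σ → MvPowerSeries τ R} (ha : HasSubst a) (d : τ →₀ ℕ)
    (T : MvPowerSeries σ R) :
    coeff d (subst a T) = ∑ e ∈ (finite_coeff_prod_ne_zero ha d).toFinset,
      coeff e T * coeff d (e.prod fun s n => a s ^ n) := by
  rw [coeff_subst ha, finsum_eq_sum_of_support_subset]
  · rfl
  · intro e he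
    simp only [Set.Finite.coe_toFinset, Set.mem_ofPred_eq]
    intro h0
    simp [h0] at he

/-- Substitution is a finite-type operation on coefficients. -/
theorem coeff_subst_eq_zero {a : σ → MvPowerSeries τ R} (ha : HasSubst a) (d : τ →₀ ℕ)
    (T : MvPowerSeries σ R)
    (h : ∀ e : σ →₀ ℕ, coeff d (e.prod fun s n => a s ^ n) ≠ 0 → coeff e T = 0) :
    coeff d (subst a T) = 0 := by
  rw [coeff_subst_eq_sum ha]
  refine Finset.sum_eq_zero fun e he => ?_
  rw [h e (by simpa using he), zero_mul]

theorem coeff_pderiv_subst_coe {a : σ → MvPowerSeries τ R} (ha : HasSubst a) (i : τ)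
    (d : τ →₀ ℕ) (K : Finset σ)
    (hK : ∀ k ∉ K, ∀ d' ≤ d, coeff d' (pderiv R i (a k)) = 0) (p : MvPolynomial σ R) :
    ∀ d' ≤ d, coeff d' (pderiv R i (subst a (p : MvPowerSeries σ R))) =
      coeff d' (∑ k ∈ K, pderiv R i (a k) * subst a (pderiv R k (p : MvPowerSeries σ R))) := by
  classical
  induction p using MvPolynomial.induction_on with
  | C r =>
    intro d' _
    have h1 : (algebraMap R (MvPowerSeries τ R)) r = C r := rfl
    rw [MvPolynomial.coe_C, ← MvPolynomial.coe_C, subst_coe, MvPolynomial.aeval_C, h1, pderiv_C]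
    have h0 : ∀ k, subst a (pderiv R k ((MvPolynomial.C r : MvPolynomial σ R) :
        MvPowerSeries σ R)) = 0 := by
      intro k
      rw [MvPolynomial.coe_C, pderiv_C, ← coe_substAlgHom ha, map_zero]
    simp only [h0, mul_zero, Finset.sum_const_zero]
  | add p q hp hq =>
    intro d' hd
    have h := congrArg₂ (· + ·) (hp d' hd) (hq d' hd)
    simp only [← map_add, ← Finset.sum_add_distrib, ← mul_add] at h
    simpa only [MvPolynomial.coe_add, subst_add ha, map_add] using h
  | mul_X p l hp =>
    intro d' hd
    have hdl : ∀ k, pderiv R k (MvPowerSeries.X l : MvPowerSeries σ R) =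
        if k = l then 1 else 0 := by
      intro k
      rw [pderiv_X, Pi.single_apply]
      simp only [eq_comm]
    have h1 : coeff d' (pderiv R i (subst a (p : MvPowerSeries σ R)) * a l) =
        coeff d' ((∑ k ∈ K, pderiv R i (a k) * subst a (pderiv R k (p : MvPowerSeries σ R))) *
          a l) := by
      rw [coeff_mul, coeff_mul]
      refine Finset.sum_congr rfl fun x hx => ?_
      rw [hp x.1 (le_trans (Finset.HasAntidiagonal.mem_antidiagonal.mp hx ▸ le_self_add) hd)]
    have h2 : coeff d' (subst a (p : MvPowerSeries σ R) * pderiv R i (a l)) =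
        coeff d' (∑ k ∈ K, pderiv R i (a k) *
          (subst a (p : MvPowerSeries σ R) * if k = l then 1 else 0)) := by
      by_cases hl : l ∈ K
      · simp [hl, mul_comm]
      · rw [coeff_mul]
        rw [Finset.sum_eq_zero, Finset.sum_eq_zero, map_zero]
        · intro k hk
          rw [if_neg (by rintro rfl; exact hl hk)]; simp
        · intro x hx
          rw [hK l hl x.2
            (le_trans (Finset.HasAntidiagonal.mem_antidiagonal.mp hx ▸ le_add_self) hd), mul_zero]
    have h3 : ∀ k, subst a (if k = l then (1 : MvPowerSeries σ R) else 0) =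
        if k = l then (1 : MvPowerSeries τ R) else 0 := by
      intro k
      split_ifs
      · rw [← coe_substAlgHom ha, map_one]
      · rw [← coe_substAlgHom ha, map_zero]
    simp only [MvPolynomial.coe_mul, MvPolynomial.coe_X, Derivation.leibniz, smul_eq_mul, hdl,
      subst_add ha, subst_mul ha, h3, subst_X ha, mul_add, Finset.sum_add_distrib, map_add, h2]
    congr 1
    rw [mul_comm, h1, Finset.sum_mul]
    congr 1
    exact Finset.sum_congr rfl fun k _ => by ring

/-- The chain rule for formal substitution, one coefficient at a time: only the substituted
series whose derivative has a coefficient below `d` contribute to the coefficient at `d`. -/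
theorem coeff_pderiv_subst {a : σ → MvPowerSeries τ R} (ha : HasSubst a) (i : τ)
    (d : τ →₀ ℕ) (K : Finset σ)
    (hK : ∀ k ∉ K, ∀ d' ≤ d, coeff d' (pderiv R i (a k)) = 0) (T : MvPowerSeries σ R) :
    coeff d (pderiv R i (subst a T)) =
      coeff d (∑ k ∈ K, pderiv R i (a k) * subst a (pderiv R k T)) := by
  classical
  -- both sides see finitely many coefficients of `T`, so `T` may be replaced by a polynomial
  let S : (τ →₀ ℕ) → Finset (σ →₀ ℕ) := fun d => (finite_coeff_prod_ne_zero ha d).toFinset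
  let E : Finset (σ →₀ ℕ) := S (d + Finsupp.single i 1) ∪
    K.biUnion fun k => (Finset.HasAntidiagonal.antidiagonal d).biUnion fun x =>
      (S x.2).image fun e => e + Finsupp.single k 1
  let p : MvPolynomial σ R := ∑ e ∈ E, MvPolynomial.monomial e (coeff e T)
  have hp : ∀ e ∈ E, coeff e (T - (p : MvPowerSeries σ R)) = 0 := by
    intro e he
    simp [p, MvPolynomial.coeff_coe, MvPolynomial.coeff_sum, MvPolynomial.coeff_monomial, he]
  have hT : T = (T - (p : MvPowerSeries σ R)) + p := by abel
  have h1 : coeff d (pderiv R i (subst a (T - (p : MvPowerSeries σ R)))) = 0 := by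
    rw [coeff_pderiv, coeff_subst_eq_zero ha, zero_mul]
    intro e he
    exact hp e (Finset.mem_union_left _ (by simpa [S] using he))
  have h2 : coeff d (∑ k ∈ K, pderiv R i (a k) *
      subst a (pderiv R k (T - (p : MvPowerSeries σ R)))) = 0 := by
    rw [map_sum]
    refine Finset.sum_eq_zero fun k hk => ?_
    rw [coeff_mul]
    refine Finset.sum_eq_zero fun x hx => ?_
    rw [coeff_subst_eq_zero ha x.2, mul_zero]
    intro e he
    rw [coeff_pderiv, hp, zero_mul]
    refine Finset.mem_union_right _ ?_
    simp only [Finset.mem_biUnion, Finset.mem_image]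
    exact ⟨k, hk, x, hx, e, by simpa [S] using he, rfl⟩
  rw [hT, subst_add ha, map_add, map_add, h1, coeff_pderiv_subst_coe ha i d K hK p d le_rfl]
  simp only [map_add, subst_add ha, mul_add, Finset.sum_add_distrib]
  rw [h2]

/-- If `∂_i` hits only the substituted series `a k₀`, with derivative `1`, then it commutes with the
substitution. -/
theorem pderiv_subst_of_single {a : σ → MvPowerSeries τ R} (ha : HasSubst a) (i : τ) (k₀ : σ)
    (h1 : pderiv R i (a k₀) = 1) (h0 : ∀ k ≠ k₀, pderiv R i (a k) = 0) (T : MvPowerSeries σ R) :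
    pderiv R i (subst a T) = subst a (pderiv R k₀ T) := by
  ext d
  rw [coeff_pderiv_subst ha i d {k₀}]
  · simp [h1]
  · intro k hk d' _
    rw [h0 k (by simpa using hk), map_zero]

end Subst

/-! ### Elementary Schur polynomials -/

section ElemSchur

variable {𝕜 : Type*} [Field 𝕜]

theorem elemSchur_of_neg {A : Type*} [Ring A] [Algebra 𝕜 A] (a : ℕ+ → A) {k : ℤ} (hk : k < 0) :
    elemSchur 𝕜 a k = 0 := by
  obtain ⟨n, rfl⟩ := Int.eq_negSucc_of_lt_zero hk
  rfl

theorem elemSchur_natCast {A : Type*} [Ring A] [Algebra 𝕜 A] (a : ℕ+ → A) (k : ℕ) :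
    elemSchur 𝕜 a (k : ℤ) = ∑ l ∈ Finset.range (k + 1), ((l ! : 𝕜)⁻¹) •
        PowerSeries.coeff k
          ((PowerSeries.mk fun n : ℕ => if hn : 0 < n then a ⟨n, hn⟩ else 0) ^ l) := rfl

theorem elemSchur_zero {A : Type*} [Ring A] [Algebra 𝕜 A] (a : ℕ+ → A) :
    elemSchur 𝕜 a 0 = 1 := by
  have := elemSchur_natCast (𝕜 := 𝕜) a 0
  simpa using this

theorem map_elemSchur {A B : Type*} [Ring A] [Algebra 𝕜 A] [Ring B] [Algebra 𝕜 B]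
    (g : A →ₐ[𝕜] B) (a : ℕ+ → A) (k : ℤ) :
    g (elemSchur 𝕜 a k) = elemSchur 𝕜 (fun i => g (a i)) k := by
  cases k with
  | negSucc n => exact map_zero g
  | ofNat n =>
    change g (elemSchur 𝕜 a (n : ℤ)) = elemSchur 𝕜 (fun i => g (a i)) (n : ℤ)
    have h : PowerSeries.map (g : A →+* B)
        (PowerSeries.mk fun n : ℕ => if hn : 0 < n then a ⟨n, hn⟩ else 0) =
        PowerSeries.mk fun n : ℕ => if hn : 0 < n then g (a ⟨n, hn⟩) else 0 := by
      ext n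
      simp only [PowerSeries.coeff_map, PowerSeries.coeff_mk]
      split_ifs <;> simp
    rw [elemSchur_natCast, elemSchur_natCast, map_sum]
    refine Finset.sum_congr rfl fun l _ => ?_
    rw [map_smul, ← h, ← map_pow, PowerSeries.coeff_map]
    rfl

/-- Newton's recursion `n h_n = ∑_{k ≥ 1} k a_k h_{n-k}`, obtained by differentiating
`exp (∑ a_k z ^ k)`. -/
theorem natCast_mul_elemSchur [CharZero 𝕜] {A : Type*} [CommRing A] [Algebra 𝕜 A] (a : ℕ+ → A)
    (n : ℕ) :
    (n : 𝕜) • elemSchur 𝕜 a n =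
      ∑ k ∈ Finset.range n, ((k + 1 : ℕ) : 𝕜) •
        (a k.succPNat * elemSchur 𝕜 a ((n : ℤ) - (k + 1 : ℕ))) := by
  cases n with
  | zero => simp
  | succ n =>
    set G : PowerSeries A := PowerSeries.mk fun n : ℕ => if hn : 0 < n then a ⟨n, hn⟩ else 0
      with hG
    let E : ℕ → PowerSeries A := fun N => ∑ l ∈ Finset.range (N + 1), ((l ! : 𝕜)⁻¹) • G ^ l
    have hX : PowerSeries.X ∣ G := by
      rw [PowerSeries.X_dvd_iff]
      simp [hG]
    have hlow : ∀ k l : ℕ, k < l → PowerSeries.coeff k (G ^ l) = 0 := fun k l hkl =>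
      (PowerSeries.X_pow_dvd_iff.mp (pow_dvd_pow_of_dvd hX l)) k hkl
    have hE : ∀ N k : ℕ, k ≤ N → PowerSeries.coeff k (E N) = elemSchur 𝕜 a (k : ℤ) := by
      intro N k hk
      rw [elemSchur_natCast]
      simp only [E, map_sum]
      symm
      refine (Finset.sum_subset (Finset.range_mono (Nat.succ_le_succ hk)) ?_).trans ?_
      · intro l _ hl
        rw [← hG, hlow k l (by simpa using hl), smul_zero]
      · refine Finset.sum_congr rfl fun l _ => ?_
        rw [← hG]; rfl
    have hder : PowerSeries.derivative A (E (n + 1)) = PowerSeries.derivative A G * E n := by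
      simp only [E, map_sum]
      rw [Finset.sum_range_succ']
      simp only [pow_zero, Nat.factorial_zero, Nat.cast_one, inv_one, one_smul]
      have h1 : PowerSeries.derivative A (1 : PowerSeries A) = 0 := by
        simp
      rw [h1, add_zero, Finset.mul_sum]
      refine Finset.sum_congr rfl fun l _ => ?_
      have hs : ∀ (c : 𝕜) (F : PowerSeries A), c • F = (algebraMap 𝕜 A c) • F := by
        intro c F
        rw [algebraMap_smul]
      rw [hs, hs, Derivation.map_smul, Derivation.leibniz_pow]
      simp only [smul_eq_mul, Nat.add_sub_cancel]
      rw [mul_comm (PowerSeries.derivative A G), smul_mul_assoc, ← Nat.cast_smul_eq_nsmul A, smul_smul,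
        ← map_natCast (algebraMap 𝕜 A), ← map_mul, Nat.factorial_succ]
      congr 2
      push_cast
      field_simp
    have hc := congrArg (PowerSeries.coeff n) hder
    rw [PowerSeries.coeff_derivative, hE _ _ le_rfl, PowerSeries.coeff_mul,
      Finset.Nat.sum_antidiagonal_eq_sum_range_succ_mk] at hc
    have h2 : ((n + 1 : ℕ) : 𝕜) • elemSchur 𝕜 a ((n + 1 : ℕ) : ℤ) =
        elemSchur 𝕜 a ((n + 1 : ℕ) : ℤ) * ((n : A) + 1) := by
      rw [Nat.cast_smul_eq_nsmul, nsmul_eq_mul]; push_cast; ring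
    rw [h2, hc]
    refine Finset.sum_congr rfl fun k hk => ?_
    have hk' : k ≤ n := by simpa [Nat.lt_succ_iff] using hk
    rw [hE _ _ (Nat.sub_le _ _), PowerSeries.coeff_derivative, Nat.cast_smul_eq_nsmul, nsmul_eq_mul,
      PowerSeries.coeff_mk, dif_pos (Nat.succ_pos k)]
    have h3 : ((n + 1 : ℕ) : ℤ) - (k + 1 : ℕ) = ((n - k : ℕ) : ℤ) := by omega
    rw [h3]
    push_cast
    have h4 : (⟨k + 1, Nat.succ_pos k⟩ : ℕ+) = k.succPNat := rfl
    rw [h4]; ring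

end ElemSchur

/-! ### Pairing differential operators with formal series -/

section Pairing

open MvPowerSeries

variable {𝕜 : Type*} [Field 𝕜]

/-- The value at `t = 0` of `q(∂_1, ∂_2, …) T`, for a polynomial `q` in countably many variables. -/
def pairing (T : MvPowerSeries ℕ+ 𝕜) : MvPolynomial ℕ+ 𝕜 →ₗ[𝕜] 𝕜 :=
  (MvPolynomial.basisMonomials ℕ+ 𝕜).constr 𝕜
    fun e => (e.prod fun _ n => (n ! : 𝕜)) * coeff e T

theorem pairing_monomial (T : MvPowerSeries ℕ+ 𝕜) (e : ℕ+ →₀ ℕ) (r : 𝕜) :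
    pairing T (MvPolynomial.monomial e r) =
      r * ((e.prod fun _ n => (n ! : 𝕜)) * coeff e T) := by
  have h : MvPolynomial.monomial e r = r • (MvPolynomial.basisMonomials ℕ+ 𝕜) e := by
    simp [MvPolynomial.smul_monomial]
  rw [h, map_smul, pairing, Module.Basis.constr_basis, smul_eq_mul]

theorem pairing_eq_sum (T : MvPowerSeries ℕ+ 𝕜) (q : MvPolynomial ℕ+ 𝕜) :
    pairing T q = ∑ e ∈ q.support,
      (q.coeff e * (e.prod fun _ n => (n ! : 𝕜))) * coeff e T := by
  conv_lhs => rw [q.as_sum]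
  rw [map_sum]
  exact Finset.sum_congr rfl fun e _ => by rw [pairing_monomial, mul_assoc]

theorem pairing_sub (T T' : MvPowerSeries ℕ+ 𝕜) (q : MvPolynomial ℕ+ 𝕜) :
    pairing (T - T') q = pairing T q - pairing T' q := by
  simp only [pairing_eq_sum, map_sub, mul_sub, Finset.sum_sub_distrib]

theorem pairing_smul (r : 𝕜) (T : MvPowerSeries ℕ+ 𝕜) (q : MvPolynomial ℕ+ 𝕜) :
    pairing (r • T) q = r * pairing T q := by
  simp only [pairing_eq_sum, map_smul, smul_eq_mul, Finset.mul_sum]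
  exact Finset.sum_congr rfl fun e _ => by ring

theorem pairing_one (T : MvPowerSeries ℕ+ 𝕜) : pairing T 1 = constantCoeff T := by
  rw [← MvPolynomial.C_1, ← MvPolynomial.monomial_zero', pairing_monomial]
  simp

theorem pairing_X_mul (T : MvPowerSeries ℕ+ 𝕜) (k : ℕ+) (q : MvPolynomial ℕ+ 𝕜) :
    pairing T (MvPolynomial.X k * q) = pairing (pderiv 𝕜 k T) q := by
  induction q using MvPolynomial.induction_on' with
  | add p q hp hq => rw [mul_add, map_add, hp, hq, map_add]
  | monomial e r =>
    have h : MvPolynomial.X k * MvPolynomial.monomial e r =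
        MvPolynomial.monomial (e + Finsupp.single k 1) r := by
      rw [MvPolynomial.X, MvPolynomial.monomial_mul, one_mul, add_comm]
    rw [h, pairing_monomial, pairing_monomial, coeff_pderiv]
    have h2 : ((e + Finsupp.single k 1).prod fun _ n => (n ! : 𝕜)) =
        (e.prod fun _ n => (n ! : 𝕜)) * ((e k : 𝕜) + 1) := by
      classical
      have h0 : ∀ f : ℕ+ →₀ ℕ, ∀ s : Finset ℕ+, f.support ⊆ s →
          (f.prod fun _ n => (n ! : 𝕜)) = ∏ i ∈ s, ((f i)! : 𝕜) := fun f s hs =>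
        Finsupp.prod_of_support_subset f hs _ (by simp)
      rw [h0 _ (insert k e.support), h0 e (insert k e.support) (Finset.subset_insert _ _),
        ← Finset.mul_prod_erase _ _ (Finset.mem_insert_self k e.support),
        ← Finset.mul_prod_erase _ (fun i => ((e i)! : 𝕜)) (Finset.mem_insert_self k e.support)]
      · have h3 : ∏ x ∈ (insert k e.support).erase k,
            (Nat.factorial ((e + Finsupp.single k 1 : ℕ+ →₀ ℕ) x) : 𝕜) =
            ∏ x ∈ (insert k e.support).erase k, ((e x)! : 𝕜) := by
          refine Finset.prod_congr rfl fun x hx => ?_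
          rw [Finsupp.add_apply, Finsupp.single_eq_of_ne (Finset.ne_of_mem_erase hx), add_zero]
        rw [h3, Finsupp.add_apply, Finsupp.single_eq_same, Nat.factorial_succ]
        push_cast
        ring
      · intro i hi
        simp only [Finsupp.mem_support_iff, Finsupp.add_apply, Finset.mem_insert] at hi ⊢
        by_cases hik : i = k
        · exact Or.inl hik
        · right
          rwa [Finsupp.single_eq_of_ne hik, add_zero] at hi
    rw [h2]; ring

/-- The pairing is nondegenerate in characteristic zero. -/
theorem eq_zero_of_pairing_eq_zero [CharZero 𝕜] (T : MvPowerSeries ℕ+ 𝕜)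
    (h : ∀ q, pairing T q = 0) : T = 0 := by
  ext e
  have := h (MvPolynomial.monomial e 1)
  rw [pairing_monomial, one_mul, mul_eq_zero] at this
  refine this.resolve_left ?_
  refine Finset.prod_ne_zero_iff.mpr fun i _ => ?_
  exact Nat.cast_ne_zero.mpr (Nat.factorial_ne_zero _)

/-- The polynomial `h_n(ħ ∂_1, (ħ / 2) ∂_2, …)`, with the variable `X k` standing for `∂_k`. -/
def opSchur (ħ : 𝕜) (n : ℤ) : MvPolynomial ℕ+ 𝕜 :=
  elemSchur 𝕜 (fun k : ℕ+ => (ħ / ((k : ℕ) : 𝕜)) • (MvPolynomial.X k : MvPolynomial ℕ+ 𝕜)) n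

theorem opSchur_of_neg (ħ : 𝕜) {n : ℤ} (hn : n < 0) : opSchur ħ n = 0 := elemSchur_of_neg _ hn

theorem opSchur_zero (ħ : 𝕜) : opSchur ħ 0 = 1 := elemSchur_zero _

theorem natCast_mul_opSchur [CharZero 𝕜] (ħ : 𝕜) (n : ℕ) :
    (n : 𝕜) • opSchur ħ n = ∑ k ∈ Finset.range n,
      ħ • (MvPolynomial.X k.succPNat * opSchur ħ ((n : ℤ) - (k + 1 : ℕ))) := by
  rw [opSchur, natCast_mul_elemSchur]
  refine Finset.sum_congr rfl fun k _ => ?_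
  rw [smul_mul_assoc, smul_smul, Nat.succPNat_coe, Nat.succ_eq_add_one, mul_div_cancel₀]
  · rfl
  · exact_mod_cast Nat.succ_ne_zero k

/-- `h_n` of the operators `(ħ / k) ∂_k`, evaluated at `t = 0`, is the pairing with `opSchur`. -/
theorem constantCoeff_elemSchur_pderiv (ħ : 𝕜) (n : ℤ) (T : MvPowerSeries ℕ+ 𝕜) :
    constantCoeff (elemSchur 𝕜 (fun i : ℕ+ => ((ħ / ((i : ℕ) : 𝕜)) •
      (MvPowerSeries.pderiv 𝕜 i).toLinearMap : Module.End 𝕜 (MvPowerSeries ℕ+ 𝕜))) n T) =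
      pairing T (opSchur ħ n) := by
  cases n with
  | negSucc n =>
    rw [opSchur_of_neg ħ (Int.negSucc_lt_zero n), elemSchur_of_neg _ (Int.negSucc_lt_zero n)]
    simp
  | ofNat n =>
    rw [Int.ofNat_eq_natCast, opSchur, elemSchur_natCast, elemSchur_natCast, LinearMap.sum_apply, map_sum,
      map_sum]
    refine Finset.sum_congr rfl fun l hl => ?_
    clear hl
    rw [LinearMap.smul_apply, MvPowerSeries.constantCoeff_smul, map_smul]
    congr 1
    induction l generalizing n T with
    | zero =>
      simp only [pow_zero, PowerSeries.coeff_one]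
      split_ifs
      · rw [pairing_one]; rfl
      · simp
    | succ l ih =>
      rw [pow_succ, pow_succ, PowerSeries.coeff_mul, PowerSeries.coeff_mul, LinearMap.sum_apply,
        map_sum, map_sum]
      refine Finset.sum_congr rfl fun x _ => ?_
      rw [Module.End.mul_apply, ih]
      simp only [PowerSeries.coeff_mk]
      split_ifs with hx
      · rw [mul_smul_comm, map_smul, mul_comm, LinearMap.smul_apply, pairing_smul, smul_eq_mul]
        exact congrArg _ (pairing_X_mul T ⟨x.2, hx⟩ _).symm
      · rw [mul_zero, map_zero, LinearMap.zero_apply]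
        simp [pairing_eq_sum]

end Pairing

/-! ### Restriction to Miwa points -/

section Miwa

open MvPowerSeries

variable {𝕜 : Type*} [Field 𝕜]

/-- The times `ħ ∑_i [u_i]`, that is `t_k = (ħ / k) ∑_i u_i ^ k`. -/
def powerSumTimes (ħ : 𝕜) {κ τ : Type*} [Fintype κ] (u : κ → MvPowerSeries τ 𝕜) (k : ℕ+) :
    MvPowerSeries τ 𝕜 :=
  (ħ / ((k : ℕ) : 𝕜)) • ∑ i, u i ^ (k : ℕ)

theorem coeff_pow_eq_zero_of_degree_lt {τ : Type*} {u : MvPowerSeries τ 𝕜}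
    (hu : constantCoeff u = 0) {d : τ →₀ ℕ} {k : ℕ} (h : d.degree < k) : coeff d (u ^ k) = 0 := by
  refine coeff_of_lt_order (lt_of_lt_of_le ?_ (le_order_pow_of_constantCoeff_eq_zero k hu))
  exact_mod_cast h

theorem hasSubst_powerSumTimes (ħ : 𝕜) {κ τ : Type*} [Fintype κ] {u : κ → MvPowerSeries τ 𝕜}
    (hu : ∀ i, constantCoeff (u i) = 0) : HasSubst (powerSumTimes ħ u) := by
  constructor
  · intro k
    have : constantCoeff (powerSumTimes ħ u k) = 0 := by
      simp [powerSumTimes, MvPowerSeries.constantCoeff_smul, hu]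
    rw [this]
    exact IsNilpotent.zero
  · intro d
    refine Set.Finite.subset (s := Nat.succPNat '' (Set.Iio d.degree)) ((Set.finite_Iio _).image _) ?_
    intro k hk
    refine ⟨k.natPred, ?_, PNat.succPNat_natPred k⟩
    by_contra hcon
    apply hk
    have hlt : d.degree < (k : ℕ) := by
      have := PNat.natPred_add_one k
      simp only [Set.mem_Iio, not_lt] at hcon
      omega
    rw [powerSumTimes, coeff_smul, map_sum, Finset.sum_eq_zero, mul_zero]
    intro i _
    exact coeff_pow_eq_zero_of_degree_lt (hu i) hlt

theorem subst_powerSumTimes (ħ : 𝕜) {κ τ ρ : Type*} [Fintype κ] (u : κ → MvPowerSeries τ 𝕜)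
    {v : τ → MvPowerSeries ρ 𝕜} (hv : HasSubst v) (k : ℕ+) :
    subst v (powerSumTimes ħ u k) = powerSumTimes ħ (fun i => subst v (u i)) k := by
  rw [powerSumTimes, powerSumTimes, ← coe_substAlgHom hv, map_smul, map_sum]
  simp only [map_pow]

/-- The restriction of a formal series to the Miwa point `t = ħ ∑_{i < m} [w_i]`. -/
def miwaPoint (ħ : 𝕜) (m : ℕ) (T : MvPowerSeries ℕ+ 𝕜) : MvPowerSeries (Fin m) 𝕜 :=
  subst (powerSumTimes ħ (X : Fin m → MvPowerSeries (Fin m) 𝕜)) T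

theorem hasSubst_powerSumTimes_X (ħ : 𝕜) {τ : Type*} [Fintype τ] :
    HasSubst (powerSumTimes ħ (X : τ → MvPowerSeries τ 𝕜)) :=
  hasSubst_powerSumTimes ħ fun i => constantCoeff_X i

theorem coeff_X_pow_mul_eq {τ : Type*} (i : τ) (k : ℕ) (F : MvPowerSeries τ 𝕜) (d : τ →₀ ℕ) :
    coeff (Finsupp.single i k + d) ((X i : MvPowerSeries τ 𝕜) ^ k * F) = coeff d F := by
  rw [X_pow_eq, coeff_add_monomial_mul, one_mul]

theorem pderiv_powerSumTimes_X [CharZero 𝕜] (ħ : 𝕜) {τ : Type*} [Fintype τ] (i : τ) (k : ℕ) :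
    pderiv 𝕜 i (powerSumTimes ħ (X : τ → MvPowerSeries τ 𝕜) k.succPNat) = ħ • X i ^ k := by
  classical
  rw [powerSumTimes, Derivation.map_smul, map_sum]
  have h : ∀ j : τ, pderiv 𝕜 i ((X j : MvPowerSeries τ 𝕜) ^ (k.succPNat : ℕ)) =
      if j = i then ((k + 1 : ℕ) : 𝕜) • X i ^ k else 0 := by
    intro j
    rw [Derivation.leibniz_pow]
    split_ifs with h
    · subst h
      rw [pderiv_X_self, Nat.cast_smul_eq_nsmul]
      simp
    · rw [pderiv_X_of_ne h]; simp
  rw [Finset.sum_congr rfl fun j _ => h j, Finset.sum_ite_eq' Finset.univ i, if_pos (Finset.mem_univ i),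
    smul_smul, Nat.succPNat_coe, Nat.succ_eq_add_one, div_mul_cancel₀]
  exact_mod_cast Nat.succ_ne_zero k

/-- The coefficients of the restriction of `T` to Miwa points are the values at `t = 0` of products
of the operators `h_n(ħ ∂_1, (ħ / 2) ∂_2, …)` applied to `T`. -/
theorem coeff_subst_powerSumTimes [CharZero 𝕜] (ħ : 𝕜) {τ : Type*} [Fintype τ] (n : τ →₀ ℕ)
    (T : MvPowerSeries ℕ+ 𝕜) :
    coeff n (subst (powerSumTimes ħ (X : τ → MvPowerSeries τ 𝕜)) T) =
      pairing T (∏ i, opSchur ħ (n i)) := by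
  classical
  induction hN : n.degree using Nat.strong_induction_on generalizing n T with
  | _ N ih =>
  by_cases hn : n = 0
  · subst hn
    simp only [Finsupp.coe_zero, Pi.zero_apply, Nat.cast_zero, opSchur_zero, Finset.prod_const_one,
      pairing_one]
    have hs := hasSubst_powerSumTimes_X (τ := τ) ħ
    have hz : HasSubst (0 : τ → MvPowerSeries τ 𝕜) := by simp [hasSubst_def]
    have h1 := constantCoeff_subst_eq_zero hs (f := T - C (constantCoeff T)) (by
      intro k
      simp [powerSumTimes, MvPowerSeries.constantCoeff_smul]) (by simp)
    rw [subst_sub hs, map_sub, sub_eq_zero] at h1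
    rw [coeff_zero_eq_constantCoeff_apply, h1]
    have h2 : (C (constantCoeff T) : MvPowerSeries ℕ+ 𝕜) =
      algebraMap 𝕜 (MvPowerSeries ℕ+ 𝕜) (constantCoeff T) := rfl
    rw [h2, ← coe_substAlgHom hs, AlgHom.commutes]
    exact constantCoeff_C _
  · obtain ⟨i, hi⟩ := Finsupp.ne_iff.mp hn
    rw [Finsupp.zero_apply] at hi
    obtain ⟨a, ha⟩ := Nat.exists_eq_succ_of_ne_zero hi
    obtain ⟨d, hd⟩ : ∃ d : τ →₀ ℕ, n = d + Finsupp.single i 1 := by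
      refine ⟨n - Finsupp.single i 1, (tsub_add_cancel_of_le ?_).symm⟩
      rw [Finsupp.single_le_iff]; omega
    have hdi : d i = a := by
      have := DFunLike.congr_fun hd i
      simp at this; omega
    have hs := hasSubst_powerSumTimes_X (τ := τ) ħ
    have key := coeff_pderiv_subst hs i d ((Finset.range (a + 1)).image Nat.succPNat) (by
      intro k hk d' hd'
      rw [← PNat.succPNat_natPred k, pderiv_powerSumTimes_X, coeff_smul, X_pow_eq, coeff_monomial,
        if_neg, mul_zero]
      rintro rfl
      apply hk
      simp only [Finset.mem_image, Finset.mem_range]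
      refine ⟨k.natPred, ?_, PNat.succPNat_natPred k⟩
      have := hd' i
      simp at this; omega) T
    rw [coeff_pderiv, ← hd, Finset.sum_image (fun _ _ _ _ h => Nat.succPNat_injective h),
      map_sum, hdi] at key
    have hne : ((a : 𝕜) + 1) ≠ 0 := by exact_mod_cast Nat.succ_ne_zero a
    refine mul_right_cancel₀ hne ?_
    rw [key]
    have hR : pairing T (∏ j, opSchur ħ (n j)) * ((a : 𝕜) + 1) =
        pairing T ((((a + 1 : ℕ) : 𝕜) • opSchur ħ ((a + 1 : ℕ) : ℤ)) *
          ∏ j ∈ Finset.univ.erase i, opSchur ħ (n j)) := by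
      rw [← Finset.mul_prod_erase Finset.univ _ (Finset.mem_univ i), ha, smul_mul_assoc, map_smul,
        smul_eq_mul]
      push_cast; ring
    rw [hR, natCast_mul_opSchur, Finset.sum_mul, map_sum]
    refine Finset.sum_congr rfl fun k hk => ?_
    have hk' : k ≤ a := by simpa [Nat.lt_succ_iff] using hk
    obtain ⟨d', hd'⟩ : ∃ d' : τ →₀ ℕ, d = Finsupp.single i k + d' := by
      refine ⟨d - Finsupp.single i k, (add_tsub_cancel_of_le ?_).symm⟩
      rw [Finsupp.single_le_iff]; omega
    have hL : coeff d (pderiv 𝕜 i (powerSumTimes ħ (X : τ → MvPowerSeries τ 𝕜) k.succPNat) *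
        subst (powerSumTimes ħ (X : τ → MvPowerSeries τ 𝕜)) (pderiv 𝕜 k.succPNat T)) =
        ħ * coeff d' (subst (powerSumTimes ħ (X : τ → MvPowerSeries τ 𝕜))
          (pderiv 𝕜 k.succPNat T)) := by
      rw [pderiv_powerSumTimes_X, hd', smul_mul_assoc, coeff_smul, coeff_X_pow_mul_eq]
    rw [hL, ih d'.degree ?_ d' _ rfl, smul_mul_assoc, map_smul, mul_assoc, pairing_X_mul,
      smul_eq_mul, ← Finset.mul_prod_erase Finset.univ _ (Finset.mem_univ i)]
    · have h1 : ((d' i : ℕ) : ℤ) = ((a + 1 : ℕ) : ℤ) - ((k + 1 : ℕ) : ℤ) := by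
        have := DFunLike.congr_fun hd' i
        simp at this; omega
      have h2 : ∏ j ∈ Finset.univ.erase i, opSchur ħ (d' j) =
          ∏ j ∈ Finset.univ.erase i, opSchur ħ (n j) := by
        refine Finset.prod_congr rfl fun j hj => ?_
        have hj' : j ≠ i := Finset.ne_of_mem_erase hj
        rw [hd, hd']
        simp [Finsupp.single_eq_of_ne hj']
      rw [h1, h2]
    · rw [← hN, hd, hd']
      simp

theorem coeff_miwaPoint [CharZero 𝕜] (ħ : 𝕜) {m : ℕ} (n : Fin m →₀ ℕ) (T : MvPowerSeries ℕ+ 𝕜) :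
    coeff n (miwaPoint ħ m T) = pairing T (∏ i, opSchur ħ (n i)) :=
  coeff_subst_powerSumTimes ħ n T

/-- The operators `h_n(ħ ∂_1, (ħ / 2) ∂_2, …)` generate all constant-coefficient operators. -/
theorem adjoin_range_opSchur [CharZero 𝕜] {ħ : 𝕜} (hħ : ħ ≠ 0) :
    Algebra.adjoin 𝕜 (Set.range fun n : ℕ => opSchur ħ (n : ℤ)) = ⊤ := by
  set B := Algebra.adjoin 𝕜 (Set.range fun n : ℕ => opSchur ħ (n : ℤ))
  have hη : ∀ n : ℤ, opSchur ħ n ∈ B := by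
    intro n
    rcases lt_or_ge n 0 with h | h
    · rw [opSchur_of_neg ħ h]; exact B.zero_mem
    · lift n to ℕ using h
      exact Algebra.subset_adjoin ⟨n, rfl⟩
  have hX : ∀ n : ℕ, (MvPolynomial.X n.succPNat : MvPolynomial ℕ+ 𝕜) ∈ B := by
    intro n
    induction n using Nat.strong_induction_on with
    | _ n ih =>
      have h := natCast_mul_opSchur ħ (n + 1)
      rw [Finset.sum_range_succ, sub_self, opSchur_zero, mul_one] at h
      have h2 : (MvPolynomial.X n.succPNat : MvPolynomial ℕ+ 𝕜) =
          ħ⁻¹ • (((n + 1 : ℕ) : 𝕜) • opSchur ħ ((n + 1 : ℕ) : ℤ) - ∑ k ∈ Finset.range n,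
            ħ • (MvPolynomial.X k.succPNat * opSchur ħ (((n + 1 : ℕ) : ℤ) - (k + 1 : ℕ)))) := by
        rw [h, add_sub_cancel_left, smul_smul, inv_mul_cancel₀ hħ, one_smul]
      rw [h2]
      refine B.smul_mem (B.sub_mem (B.smul_mem (hη _) _) (B.sum_mem fun k hk => ?_)) _
      exact B.smul_mem (B.mul_mem (ih k (by simpa using hk)) (hη _)) _
  rw [← top_le_iff, ← MvPolynomial.adjoin_range_X]
  refine Algebra.adjoin_le ?_
  rintro _ ⟨k, rfl⟩
  rw [← PNat.succPNat_natPred k]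
  exact hX _

/-- A formal series in the times is determined by its restrictions to all Miwa points. -/
theorem eq_zero_of_miwaPoint_eq_zero [CharZero 𝕜] {ħ : 𝕜} (hħ : ħ ≠ 0) (T : MvPowerSeries ℕ+ 𝕜)
    (h : ∀ m, miwaPoint ħ m T = 0) : T = 0 := by
  refine eq_zero_of_pairing_eq_zero T fun q => ?_
  have hq : q ∈ Algebra.adjoin 𝕜 (Set.range fun n : ℕ => opSchur ħ (n : ℤ)) := by
    rw [adjoin_range_opSchur hħ]; trivial
  rw [← Subalgebra.mem_toSubmodule, Algebra.adjoin_eq_span] at hq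
  induction hq using Submodule.span_induction with
  | mem x hx =>
    obtain ⟨l, hl, rfl⟩ := Submonoid.exists_list_of_mem_closure hx
    have hl' : ∀ i : Fin l.length, ∃ n : ℕ, opSchur ħ (n : ℤ) = l.get i := fun i =>
      hl _ (List.get_mem l i)
    choose n hn using hl'
    have h1 := coeff_miwaPoint ħ (Finsupp.equivFunOnFinite.symm n) T
    rw [h, map_zero] at h1
    rw [h1]
    congr 1
    simp only [Finsupp.equivFunOnFinite_symm_apply_apply, hn]
    simp
  | zero => simp
  | add x y _ _ hx hy => rw [map_add, hx, hy, add_zero]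
  | smul a x _ hx => rw [map_smul, hx, smul_zero]

/-- The Vandermonde determinant `det (w_i ^ (m - 1 - j))`. -/
def vandet (𝕜 : Type*) [Field 𝕜] (m : ℕ) : MvPowerSeries (Fin m) 𝕜 :=
  Matrix.det (Matrix.of fun i j : Fin m => (X i : MvPowerSeries (Fin m) 𝕜) ^ (m - 1 - (j : ℕ)))

theorem coeff_prod_X_pow_mul_miwaPoint [CharZero 𝕜] (ħ : 𝕜) {m : ℕ} (d : Fin m → ℕ)
    (n : Fin m →₀ ℕ) (T : MvPowerSeries ℕ+ 𝕜) :
    coeff n ((∏ i, (X i : MvPowerSeries (Fin m) 𝕜) ^ d i) * miwaPoint ħ m T) =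
      pairing T (∏ i, opSchur ħ ((n i : ℤ) - d i)) := by
  have h1 : (∏ i, (X i : MvPowerSeries (Fin m) 𝕜) ^ d i) =
      monomial (Finsupp.equivFunOnFinite.symm d) 1 := by
    rw [monomial_one_eq, Finsupp.prod_fintype _ _ (by simp)]
    rfl
  rw [h1, coeff_monomial_mul]
  split_ifs with h
  · rw [one_mul, coeff_miwaPoint]
    congr 1
    refine Finset.prod_congr rfl fun i _ => ?_
    have hi : d i ≤ n i := h i
    congr 1
    simp only [Finsupp.coe_tsub, Pi.sub_apply, Finsupp.equivFunOnFinite_symm_apply_apply]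
    omega
  · obtain ⟨i, hi⟩ : ∃ i, n i < d i := by
      by_contra hcon
      push Not at hcon
      exact h hcon
    rw [Finset.prod_eq_zero (Finset.mem_univ i), map_zero]
    exact opSchur_of_neg ħ (by omega)

/-- After multiplication by the Vandermonde determinant, the coefficients of the restriction to
Miwa points are the Plücker coordinates `det (h_{p_i + j}(ħ ∂_1, …)) T` at `t = 0`. -/
theorem coeff_vandet_mul_miwaPoint [CharZero 𝕜] (ħ : 𝕜) {m : ℕ} (n : Fin m →₀ ℕ)
    (T : MvPowerSeries ℕ+ 𝕜) :
    coeff n (vandet 𝕜 m * miwaPoint ħ m T) =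
      pairing T (Matrix.det (Matrix.of fun i j : Fin m =>
        opSchur ħ ((n i : ℤ) - ((m : ℤ) - 1) + (j : ℕ)))) := by
  rw [vandet, Matrix.det_apply, Matrix.det_apply, Finset.sum_mul, map_sum, map_sum]
  refine Finset.sum_congr rfl fun s _ => ?_
  rw [smul_mul_assoc]
  simp only [Matrix.of_apply]
  have h0 : (∏ i, (X (s i) : MvPowerSeries (Fin m) 𝕜) ^ (m - 1 - (i : ℕ))) =
      ∏ i, X i ^ (m - 1 - ((s.symm i : Fin m) : ℕ)) := by
    rw [← Equiv.prod_comp s fun i =>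
      (X i : MvPowerSeries (Fin m) 𝕜) ^ (m - 1 - ((s.symm i : Fin m) : ℕ))]
    simp
  have h1 : (∏ i, opSchur ħ ((n (s i) : ℤ) - ((m : ℤ) - 1) + ((i : Fin m) : ℕ))) =
      ∏ i, opSchur ħ ((n i : ℤ) - ((m - 1 - ((s.symm i : Fin m) : ℕ) : ℕ) : ℤ)) := by
    rw [← Equiv.prod_comp s fun i =>
      opSchur ħ ((n i : ℤ) - ((m - 1 - ((s.symm i : Fin m) : ℕ) : ℕ) : ℤ))]
    refine Finset.prod_congr rfl fun i _ => ?_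
    rw [Equiv.symm_apply_apply]
    congr 1
    have := i.2
    omega
  rw [h0, h1]
  rcases Int.units_eq_one_or (Equiv.Perm.sign s) with h | h <;>
    simp only [h, one_smul, Units.neg_smul, map_neg, coeff_prod_X_pow_mul_miwaPoint]

theorem vandet_ne_zero (m : ℕ) : vandet 𝕜 m ≠ 0 := by
  have h : (Matrix.of fun i j : Fin m => (X i : MvPowerSeries (Fin m) 𝕜) ^ (m - 1 - (j : ℕ))) =
      (Matrix.vandermonde (X : Fin m → MvPowerSeries (Fin m) 𝕜)).submatrix id Fin.revPerm := by
    ext1 i j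
    have : m - 1 - (j : ℕ) = m - (j + 1) := by omega
    simp [Matrix.vandermonde_apply, Fin.val_rev, this]
  have : IsDomain (MvPowerSeries (Fin m) 𝕜) := NoZeroDivisors.to_isDomain _
  rw [vandet, h, Matrix.det_permute']
  refine mul_ne_zero ?_ (Matrix.det_vandermonde_ne_zero_iff.mpr fun i j h => X_inj.mp h)
  rcases Int.units_eq_one_or (Equiv.Perm.sign (Fin.revPerm : Equiv.Perm (Fin m))) with h | h <;>
    simp [h]

end Miwa

/-! ### Young diagrams and determinants -/

section Young

theorem rowLen_eq_zero_iff (lam : YoungDiagram) (i : ℕ) : lam.rowLen i = 0 ↔ numRows lam ≤ i := by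
  rw [numRows, ← not_lt, ← YoungDiagram.mem_iff_lt_colLen, YoungDiagram.mem_iff_lt_rowLen]
  omega

theorem ext_rowLen {lam mu : YoungDiagram} (h : ∀ i, lam.rowLen i = mu.rowLen i) : lam = mu := by
  apply YoungDiagram.ext
  ext ⟨i, j⟩
  rw [YoungDiagram.mem_cells, YoungDiagram.mem_cells, YoungDiagram.mem_iff_lt_rowLen,
    YoungDiagram.mem_iff_lt_rowLen, h]

/-- The Young diagram with row lengths `r 0 ≥ r 1 ≥ …`, at most `m` of which are nonzero. -/
def diagramOfRows (m : ℕ) (r : ℕ → ℕ) (hr : Antitone r) : YoungDiagram where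
  cells := (Finset.range m ×ˢ Finset.range (r 0)).filter fun c => c.2 < r c.1
  isLowerSet := by
    rintro ⟨i, j⟩ ⟨i', j'⟩ ⟨hi : i' ≤ i, hj : j' ≤ j⟩ h
    simp only [Finset.coe_filter, Finset.mem_product, Finset.mem_range, Set.mem_ofPred_eq] at h ⊢
    have := hr hi
    omega

theorem rowLen_diagramOfRows (m : ℕ) (r : ℕ → ℕ) (hr : Antitone r) (hm : ∀ i, m ≤ i → r i = 0)
    (i : ℕ) : (diagramOfRows m r hr).rowLen i = r i := by
  have h : ∀ j, j < (diagramOfRows m r hr).rowLen i ↔ j < r i := by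
    intro j
    rw [← YoungDiagram.mem_iff_lt_rowLen, ← YoungDiagram.mem_cells]
    simp only [diagramOfRows, Finset.mem_filter, Finset.mem_product, Finset.mem_range]
    have h0 := hr (Nat.zero_le i)
    have h1 := hm i
    omega
  have h1 := h (r i)
  have h2 := h ((diagramOfRows m r hr).rowLen i)
  omega

/-- A strictly decreasing sequence of `m` integers `≥ 1 - m` has the form `lam_i - i`. -/
theorem exists_diagram_of_strictAnti {m : ℕ} (p : Fin m → ℤ) (hp : StrictAnti p)
    (h0 : ∀ i, 0 ≤ p i + ((m : ℤ) - 1)) :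
    ∃ lam : YoungDiagram, numRows lam ≤ m ∧ ∀ i : Fin m, p i = (lam.rowLen i : ℤ) - (i : ℕ) := by
  have hstep : ∀ k i : ℕ, ∀ h : i + k < m, p ⟨i + k, h⟩ + k ≤ p ⟨i, by omega⟩ := by
    intro k
    induction k with
    | zero => intro i h; simp
    | succ k ih =>
      intro i h
      have h1 := ih i (by omega)
      have h2 : p ⟨i + (k + 1), h⟩ < p ⟨i + k, by omega⟩ := hp (by
        rw [Fin.mk_lt_mk]; omega)
      push_cast
      omega
  have hanti : ∀ i j : ℕ, ∀ (hij : i ≤ j) (h : j < m), p ⟨j, h⟩ + j ≤ p ⟨i, by omega⟩ + i := by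
    intro i j hij h
    obtain ⟨k, rfl⟩ := Nat.exists_eq_add_of_le hij
    have := hstep k i h
    push_cast
    omega
  have hnn : ∀ i : ℕ, ∀ h : i < m, 0 ≤ p ⟨i, h⟩ + i := by
    intro i h
    have h1 := hanti i (m - 1) (by omega) (by omega)
    have h2 := h0 ⟨m - 1, by omega⟩
    omega
  let r : ℕ → ℕ := fun i => if h : i < m then (p ⟨i, h⟩ + i).toNat else 0
  have hr : Antitone r := by
    intro i j hij
    by_cases hj : j < m
    · have hi : i < m := by omega
      simp only [r, hi, hj, dif_pos]
      exact Int.toNat_le_toNat (hanti i j hij hj)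
    · simp only [r, hj, dif_neg, not_false_iff, Nat.zero_le]
  have hm : ∀ i, m ≤ i → r i = 0 := fun i hi => by
    simp only [r, not_lt.mpr hi, dif_neg, not_false_iff]
  refine ⟨diagramOfRows m r hr, ?_, fun i => ?_⟩
  · rw [← rowLen_eq_zero_iff, rowLen_diagramOfRows m r hr hm, hm m le_rfl]
  · rw [rowLen_diagramOfRows m r hr hm]
    simp only [r, i.2, dif_pos]
    rw [Int.toNat_of_nonneg (hnn i i.2)]
    simp

/-- A sequence of `m` integers with distinct entries `≥ 1 - m` is a rearrangement of `lam_i - i`. -/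
theorem exists_perm_diagram {m : ℕ} (p : Fin m → ℤ) (hp : Function.Injective p)
    (h0 : ∀ i, 0 ≤ p i + ((m : ℤ) - 1)) :
    ∃ (s : Equiv.Perm (Fin m)) (lam : YoungDiagram), numRows lam ≤ m ∧
      ∀ i : Fin m, p (s i) = (lam.rowLen i : ℤ) - (i : ℕ) := by
  have hmono : StrictMono (p ∘ Tuple.sort p) :=
    (Tuple.monotone_sort p).strictMono_of_injective (hp.comp (Tuple.sort p).injective)
  let s : Equiv.Perm (Fin m) := Fin.revPerm.trans (Tuple.sort p)
  have hs : StrictAnti (p ∘ s) := by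
    intro i j hij
    exact hmono (Fin.rev_lt_rev.mpr hij)
  obtain ⟨lam, h1, h2⟩ := exists_diagram_of_strictAnti (p ∘ s) hs fun i => h0 _
  exact ⟨s, lam, h1, h2⟩

theorem strictAnti_rowLen_sub (lam : YoungDiagram) :
    StrictAnti fun i : ℕ => (lam.rowLen i : ℤ) - (i : ℤ) := by
  intro i j hij
  have := lam.rowLen_anti i j hij.le
  change (lam.rowLen j : ℤ) - j < (lam.rowLen i : ℤ) - i
  omega

variable {A : Type*} [CommRing A]

theorem det_of_last_row {m : ℕ} (M : Matrix (Fin (m + 1)) (Fin (m + 1)) A)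
    (h : ∀ j : Fin m, M (Fin.last m) j.castSucc = 0) :
    M.det = M (Fin.last m) (Fin.last m) * (M.submatrix Fin.castSucc Fin.castSucc).det := by
  rw [Matrix.det_succ_row M (Fin.last m), Fin.sum_univ_castSucc]
  rw [Finset.sum_eq_zero fun j _ => by rw [h j, mul_zero, zero_mul], zero_add]
  have h1 : (-1 : A) ^ ((Fin.last m : ℕ) + (Fin.last m : ℕ)) = 1 := by
    rw [← two_mul, pow_mul]; simp
  rw [h1, one_mul, Fin.succAbove_last]

/-- Determinants attached to a Young diagram do not change, up to powers of `a`, when zero rows are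
added to the diagram. -/
theorem det_rows_eq (M : ℕ → ℤ → A) (a : A) (h0 : ∀ (j : ℕ) (p : ℤ), p + (j : ℤ) < 0 → M j p = 0)
    (h1 : ∀ j : ℕ, M j (-(j : ℤ)) = a) (lam : YoungDiagram) (m : ℕ) (hm : numRows lam ≤ m) :
    Matrix.det (Matrix.of fun i j : Fin m => M j ((lam.rowLen i : ℤ) - (i : ℕ))) =
      a ^ (m - numRows lam) * Matrix.det (Matrix.of fun i j : Fin (numRows lam) =>
        M j ((lam.rowLen i : ℤ) - (i : ℕ))) := by
  induction m, hm using Nat.le_induction with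
  | base => simp
  | succ m hm ih =>
    have hr : lam.rowLen m = 0 := (rowLen_eq_zero_iff lam m).mpr hm
    rw [det_of_last_row]
    · have h2 : (Matrix.of fun i j : Fin (m + 1) => M j ((lam.rowLen i : ℤ) - (i : ℕ))).submatrix
          Fin.castSucc Fin.castSucc =
          Matrix.of fun i j : Fin m => M j ((lam.rowLen i : ℤ) - (i : ℕ)) := by
        ext1 i j; simp
      rw [h2, ih, Nat.succ_sub hm, pow_succ']
      simp [hr, h1, mul_assoc]
    · intro j
      simp only [Matrix.of_apply, Fin.val_last, hr, Fin.val_castSucc]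
      refine h0 _ _ ?_
      have := j.2
      push_cast
      omega

/-- Two families of determinants `det (M_j(p_i))` and `c_m det (N_j(p_i))` that agree on the index
sequences coming from Young diagrams agree everywhere. -/
theorem eq_of_forall_diagram {B : Type*} [CommRing B] (L : A →+ B) (M : ℕ → ℤ → A) (N : ℕ → ℤ → B)
    (hM : ∀ (j : ℕ) (p : ℤ), p + (j : ℤ) < 0 → M j p = 0)
    (hN : ∀ (j : ℕ) (p : ℤ), p + (j : ℤ) < 0 → N j p = 0)
    {m : ℕ} (c : B)
    (h : ∀ lam : YoungDiagram, numRows lam ≤ m →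
      L (Matrix.det (Matrix.of fun i j : Fin m => M j ((lam.rowLen i : ℤ) - (i : ℕ)))) =
      c * Matrix.det (Matrix.of fun i j : Fin m => N j ((lam.rowLen i : ℤ) - (i : ℕ))))
    (p : Fin m → ℤ) :
    L (Matrix.det (Matrix.of fun i j : Fin m => M j (p i))) =
      c * Matrix.det (Matrix.of fun i j : Fin m => N j (p i)) := by
  by_cases hp : Function.Injective p
  · by_cases h0 : ∀ i, 0 ≤ p i + ((m : ℤ) - 1)
    · obtain ⟨s, lam, hl, hs⟩ := exists_perm_diagram p hp h0
      have h1 := h lam hl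
      have h2 : ∀ {R : Type _} [CommRing R] (Q : ℕ → ℤ → R),
          Matrix.det (Matrix.of fun i j : Fin m => Q j ((lam.rowLen i : ℤ) - (i : ℕ))) =
          Equiv.Perm.sign s * Matrix.det (Matrix.of fun i j : Fin m => Q j (p i)) := by
        intro R _ Q
        rw [← Matrix.det_permute]
        congr 1
        ext1 i j
        simp [hs]
      have h3 : ∀ {R : Type _} [CommRing R] (Q : ℕ → ℤ → R),
          Matrix.det (Matrix.of fun i j : Fin m => Q j ((lam.rowLen i : ℤ) - (i : ℕ))) =
          Equiv.Perm.sign s * Matrix.det (Matrix.of fun i j : Fin m => Q j (p i)) := by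
        intro R _ Q
        rw [← Matrix.det_permute]
        congr 1
        ext1 i j
        simp [hs]
      rw [h2 M, h3 N] at h1
      rcases Int.units_eq_one_or (Equiv.Perm.sign s) with hsg | hsg
      · simpa [hsg] using h1
      · simpa [hsg] using h1
    · push Not at h0
      obtain ⟨i, hi⟩ := h0
      rw [Matrix.det_eq_zero_of_row_eq_zero i, Matrix.det_eq_zero_of_row_eq_zero i, map_zero,
        mul_zero]
      · intro j
        exact hN _ _ (by have := j.2; omega)
      · intro j
        exact hM _ _ (by have := j.2; omega)
  · simp only [Function.Injective, not_forall] at hp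
    obtain ⟨i, i', h1, h2⟩ := hp
    rw [Matrix.det_zero_of_row_eq h2, Matrix.det_zero_of_row_eq h2, map_zero, mul_zero]
    · ext j; simp [h1]
    · ext j; simp [h1]

end Young

/-! ### Schur functions at Miwa points -/

section Bialternant

variable {𝕜 : Type*} [Field 𝕜] [CharZero 𝕜]

section Alg

variable {A : Type*} [CommRing A] [Algebra 𝕜 A]

/-- Multiplying the generating series of the `h_n` by `1 / (1 - u z)` adds `u ^ k / k` to the
`k`-th time. -/
theorem elemSchur_sub_mul (a b : ℕ+ → A) (u : A)
    (hab : ∀ k : ℕ+, ((k : ℕ) : 𝕜) • a k = ((k : ℕ) : 𝕜) • b k + u ^ (k : ℕ)) (n : ℤ) :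
    elemSchur 𝕜 a n - u * elemSchur 𝕜 a (n - 1) = elemSchur 𝕜 b n := by
  rcases lt_or_ge n 0 with hn | hn
  · rw [elemSchur_of_neg _ hn, elemSchur_of_neg _ hn, elemSchur_of_neg _ (by omega)]
    simp
  lift n to ℕ using hn
  induction n using Nat.strong_induction_on with
  | _ n ih =>
  cases n with
  | zero =>
    rw [Nat.cast_zero, elemSchur_zero, elemSchur_zero, elemSchur_of_neg _ (by omega)]
    simp
  | succ n =>
    have hne : ((n + 1 : ℕ) : 𝕜) ≠ 0 := Nat.cast_ne_zero.mpr (Nat.succ_ne_zero n)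
    refine smul_right_injective A hne ?_
    have e1 : ∀ k : ℕ, ((k + 1 : ℕ) : 𝕜) • (a k.succPNat) =
        ((k + 1 : ℕ) : 𝕜) • b k.succPNat + u ^ (k + 1) := fun k => hab k.succPNat
    have hA := natCast_mul_elemSchur (𝕜 := 𝕜) a (n + 1)
    have hB := natCast_mul_elemSchur (𝕜 := 𝕜) b (n + 1)
    have hA' := natCast_mul_elemSchur (𝕜 := 𝕜) a n
    have hext : ∑ k ∈ Finset.range n, ((k + 1 : ℕ) : 𝕜) •
        (a k.succPNat * elemSchur 𝕜 a ((n : ℤ) - (k + 1 : ℕ))) =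
        ∑ k ∈ Finset.range (n + 1), ((k + 1 : ℕ) : 𝕜) •
        (a k.succPNat * elemSchur 𝕜 a ((n : ℤ) - (k + 1 : ℕ))) := by
      rw [Finset.sum_range_succ, elemSchur_of_neg a (k := (n : ℤ) - (n + 1 : ℕ)) (by omega)]
      simp
    -- the sum `∑_k u ^ k (h_{n-k} - u h_{n-k-1})` telescopes
    have htel : ∀ N : ℕ, N ≤ n + 1 → ∑ k ∈ Finset.range N, u ^ (k + 1) *
        (elemSchur 𝕜 a (((n + 1 : ℕ) : ℤ) - (k + 1 : ℕ)) -
          u * elemSchur 𝕜 a ((n : ℤ) - (k + 1 : ℕ))) =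
        u * elemSchur 𝕜 a (n : ℤ) - u ^ (N + 1) * elemSchur 𝕜 a ((n : ℤ) - N) := by
      intro N
      induction N with
      | zero => intro _; simp
      | succ N ihN =>
        intro hN
        rw [Finset.sum_range_succ, ihN (by omega)]
        have : ((n + 1 : ℕ) : ℤ) - (N + 1 : ℕ) = (n : ℤ) - N := by push_cast; ring
        rw [this]
        ring
    have hlast : elemSchur 𝕜 a ((n : ℤ) - (n + 1 : ℕ)) = 0 := elemSchur_of_neg a (by omega)
    have htel' := htel (n + 1) le_rfl
    rw [hlast, mul_zero, sub_zero] at htel'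
    have hcast : ((n + 1 : ℕ) : ℤ) - 1 = (n : ℤ) := by push_cast; ring
    simp only [hcast]
    rw [smul_sub, hB, hA]
    have hsplit : ((n + 1 : ℕ) : 𝕜) • (u * elemSchur 𝕜 a (n : ℤ)) =
        u * ((n : 𝕜) • elemSchur 𝕜 a (n : ℤ)) + u * elemSchur 𝕜 a (n : ℤ) := by
      push_cast
      rw [add_smul, one_smul, mul_smul_comm]
    rw [hsplit, hA', hext, ← htel', Finset.mul_sum, ← Finset.sum_add_distrib,
      ← Finset.sum_sub_distrib]
    refine Finset.sum_congr rfl fun k hk => ?_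
    have hk' : k ≤ n := by simpa [Nat.lt_succ_iff] using hk
    have hi := ih (n - k) (by omega)
    have c1 : (((n - k : ℕ) : ℤ)) = ((n + 1 : ℕ) : ℤ) - (k + 1 : ℕ) := by omega
    have c2 : ((n + 1 : ℕ) : ℤ) - (k + 1 : ℕ) - 1 = (n : ℤ) - (k + 1 : ℕ) := by push_cast; ring
    rw [c1, c2] at hi
    rw [← smul_mul_assoc, ← smul_mul_assoc, ← smul_mul_assoc, e1, ← hi]
    ring

theorem elemSchur_zero_times (n : ℤ) (hn : 0 < n) : elemSchur 𝕜 (fun _ => (0 : A)) n = 0 := by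
  lift n to ℕ using hn.le
  have hne : (n : 𝕜) ≠ 0 := Nat.cast_ne_zero.mpr (by omega)
  refine smul_right_injective A hne ?_
  simp only [natCast_mul_elemSchur, zero_mul, smul_zero, Finset.sum_const_zero]

/-- The one-variable case `∑ h_n z ^ n = 1 / (1 - u z)`. -/
theorem elemSchur_single (b : ℕ+ → A) (u : A) (hb : ∀ k : ℕ+, ((k : ℕ) : 𝕜) • b k = u ^ (k : ℕ))
    (n : ℕ) : elemSchur 𝕜 b (n : ℤ) = u ^ n := by
  have h := elemSchur_sub_mul (𝕜 := 𝕜) b (fun _ => (0 : A)) u (fun k => by simp [hb k])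
  induction n with
  | zero => rw [Nat.cast_zero, elemSchur_zero, pow_zero]
  | succ n ih =>
    have h1 := h ((n + 1 : ℕ) : ℤ)
    rw [elemSchur_zero_times _ (by omega), sub_eq_zero] at h1
    have c : ((n + 1 : ℕ) : ℤ) - 1 = (n : ℤ) := by push_cast; ring
    rw [h1, c, ih, pow_succ']

/-- Removing finitely many variables `u_i` from the generating series of the `h_n` multiplies it by
a polynomial, namely `∏ (1 - u_i z)`. -/
theorem exists_coeffs_elemSchur {κ : Type*} [DecidableEq κ] (u : κ → A) (b : ℕ+ → A)
    (s : Finset κ) : ∀ a : ℕ+ → A,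
    (∀ k : ℕ+, ((k : ℕ) : 𝕜) • a k = ((k : ℕ) : 𝕜) • b k + ∑ i ∈ s, u i ^ (k : ℕ)) →
    ∃ ε : ℕ → A, (∀ n : ℤ, elemSchur 𝕜 b n =
      ∑ r ∈ Finset.range (s.card + 1), ε r * elemSchur 𝕜 a (n - r)) := by
  induction s using Finset.induction_on with
  | empty =>
    intro a ha
    refine ⟨fun _ => 1, fun n => ?_⟩
    have hab : a = b := by
      funext k
      refine smul_right_injective A (r := ((k : ℕ) : 𝕜)) (Nat.cast_ne_zero.mpr k.ne_zero) ?_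
      simpa using ha k
    simp [hab]
  | insert i s hi ih =>
    intro a ha
    let a' : ℕ+ → A := fun k => a k - ((k : ℕ) : 𝕜)⁻¹ • u i ^ (k : ℕ)
    have hk : ∀ k : ℕ+, (((k : ℕ) : 𝕜)) ≠ 0 := fun k => Nat.cast_ne_zero.mpr k.ne_zero
    have ha' : ∀ k : ℕ+, ((k : ℕ) : 𝕜) • a' k = ((k : ℕ) : 𝕜) • a k - u i ^ (k : ℕ) := by
      intro k
      simp only [a', smul_sub, smul_smul, mul_inv_cancel₀ (hk k), one_smul]
    obtain ⟨ε, hε⟩ := ih a' (fun k => by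
      rw [ha', ha, Finset.sum_insert hi]; ring)
    have hstep := elemSchur_sub_mul (𝕜 := 𝕜) a a' (u i) (fun k => by rw [ha']; ring)
    refine ⟨fun r => (if r ≤ s.card then ε r else 0) -
      (if r = 0 then 0 else u i * ε (r - 1)), fun n => ?_⟩
    rw [hε, Finset.card_insert_of_notMem hi]
    simp only [sub_mul, Finset.sum_sub_distrib, ← hstep, mul_sub]
    congr 1
    · rw [Finset.sum_range_succ _ (s.card + 1), if_neg (by omega), zero_mul, add_zero]
      refine Finset.sum_congr rfl fun r hr => ?_
      rw [if_pos (by simpa [Nat.lt_succ_iff] using hr)]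
    · rw [Finset.sum_range_succ' _ (s.card + 1), if_pos rfl, zero_mul, add_zero]
      refine Finset.sum_congr rfl fun r _ => ?_
      rw [if_neg (Nat.succ_ne_zero r), Nat.add_sub_cancel]
      have : n - ((r + 1 : ℕ) : ℤ) = n - r - 1 := by push_cast; ring
      rw [this]
      ring

end Alg

open MvPowerSeries

/-- The bialternant formula: for complete homogeneous `h_n` in the variables `w_0, …, w_{m-1}`,
`det (w_i ^ (m-1-j)) det (h_{lam_i - i + j}) = det (w_l ^ (lam_i + m - 1 - i))`. -/
theorem vandet_mul_det_elemSchur {m : ℕ} (lam : YoungDiagram) (hm : numRows lam ≤ m) :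
    vandet 𝕜 m * Matrix.det (Matrix.of fun i j : Fin m =>
      elemSchur 𝕜 (powerSumTimes 1 (X : Fin m → MvPowerSeries (Fin m) 𝕜))
        ((lam.rowLen i : ℤ) - (i : ℕ) + (j : ℕ))) =
      Matrix.det (Matrix.of fun i l : Fin m =>
        (X l : MvPowerSeries (Fin m) 𝕜) ^ (lam.rowLen i + (m - 1 - (i : ℕ)))) := by
  classical
  set a := powerSumTimes (1 : 𝕜) (X : Fin m → MvPowerSeries (Fin m) 𝕜) with ha
  have hk : ∀ k : ℕ+, (((k : ℕ) : 𝕜)) ≠ 0 := fun k => Nat.cast_ne_zero.mpr k.ne_zero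
  have hE : ∀ l : Fin m, ∃ ε : ℕ → MvPowerSeries (Fin m) 𝕜, ∀ n : ℕ,
      (X l : MvPowerSeries (Fin m) 𝕜) ^ n =
        ∑ r ∈ Finset.range m, ε r * elemSchur 𝕜 a ((n : ℤ) - r) := by
    intro l
    let b : ℕ+ → MvPowerSeries (Fin m) 𝕜 := fun k => ((k : ℕ) : 𝕜)⁻¹ • X l ^ (k : ℕ)
    have hb : ∀ k : ℕ+, ((k : ℕ) : 𝕜) • b k = X l ^ (k : ℕ) := fun k => by
      simp only [b, smul_smul, mul_inv_cancel₀ (hk k), one_smul]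
    obtain ⟨ε, hε⟩ := exists_coeffs_elemSchur (𝕜 := 𝕜)
      (X : Fin m → MvPowerSeries (Fin m) 𝕜) b (Finset.univ.erase l) a (fun k => by
        rw [hb, Finset.add_sum_erase _ (fun i => (X i : MvPowerSeries (Fin m) 𝕜) ^ (k : ℕ))
          (Finset.mem_univ l), ha, powerSumTimes, smul_smul, mul_div_cancel₀ _ (hk k), one_smul])
    refine ⟨ε, fun n => ?_⟩
    rw [← elemSchur_single (𝕜 := 𝕜) b (X l) hb n, hε]
    have hc : (Finset.univ.erase l).card + 1 = m := by
      rw [Finset.card_erase_add_one (Finset.mem_univ l), Finset.card_univ, Fintype.card_fin]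
    rw [hc]
  choose ε hε using hE
  let E : Matrix (Fin m) (Fin m) (MvPowerSeries (Fin m) 𝕜) :=
    Matrix.of fun j l => ε l (m - 1 - (j : ℕ))
  have hprod : ∀ mu : YoungDiagram, (Matrix.of fun i j : Fin m =>
      elemSchur 𝕜 a ((mu.rowLen i : ℤ) - (i : ℕ) + (j : ℕ))) * E =
      Matrix.of fun i l : Fin m =>
        (X l : MvPowerSeries (Fin m) 𝕜) ^ (mu.rowLen i + (m - 1 - (i : ℕ))) := by
    intro mu
    ext1 i l
    rw [Matrix.mul_apply, Matrix.of_apply, hε l, ← Finset.sum_range_reflect, Finset.sum_range]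
    refine Finset.sum_congr rfl fun j _ => ?_
    simp only [E, Matrix.of_apply]
    rw [mul_comm]
    congr 2
    have := i.2
    have := j.2
    push_cast
    omega
  have hrow : ∀ mu : YoungDiagram, numRows mu = 0 → Matrix.det (Matrix.of fun i j : Fin m =>
      elemSchur 𝕜 a ((mu.rowLen i : ℤ) - (i : ℕ) + (j : ℕ))) = 1 := by
    intro mu hmu
    have h := det_rows_eq (fun j p => elemSchur 𝕜 a (p + (j : ℕ))) 1
      (fun j p h => elemSchur_of_neg _ h) (fun j => by
        rw [neg_add_cancel, elemSchur_zero]) mu m (by omega)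
    rw [h, one_pow, one_mul]
    have : IsEmpty (Fin (numRows mu)) := by rw [hmu]; infer_instance
    exact Matrix.det_isEmpty
  have hbot : numRows (⊥ : YoungDiagram) = 0 := by
    rw [← Nat.le_zero, ← rowLen_eq_zero_iff]
    by_contra hcon
    exact YoungDiagram.notMem_bot (0, 0)
      (YoungDiagram.mem_iff_lt_rowLen.mpr (Nat.pos_of_ne_zero hcon))
  have hdetE : E.det = vandet 𝕜 m := by
    have h1 := congrArg Matrix.det (hprod ⊥)
    rw [Matrix.det_mul, hrow ⊥ hbot, one_mul] at h1
    rw [h1, vandet, ← Matrix.det_transpose]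
    congr 1
    ext1 i j
    have h0 : ∀ k, (⊥ : YoungDiagram).rowLen k = 0 := fun k =>
      (rowLen_eq_zero_iff _ _).mpr (by omega)
    simp [h0]
  rw [← hprod lam, Matrix.det_mul, hdetE, mul_comm]

end Bialternant

/-! ### Expansion in Schur functions -/

section Expansion

open MvPowerSeries

variable {𝕜 : Type*} [Field 𝕜]

/-- The Schur function `s_lam(ħ ∂_1, (ħ / 2) ∂_2, …)` of the times derivatives. -/
def schurOp (ħ : 𝕜) (lam : YoungDiagram) : MvPolynomial ℕ+ 𝕜 :=
  schur 𝕜 (fun k : ℕ+ => (ħ / ((k : ℕ) : 𝕜)) • (MvPolynomial.X k : MvPolynomial ℕ+ 𝕜)) lam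

theorem schurOp_eq_det (ħ : 𝕜) (lam : YoungDiagram) :
    schurOp ħ lam = Matrix.det (Matrix.of fun i j : Fin (numRows lam) =>
      opSchur ħ ((lam.rowLen i : ℤ) - (i : ℕ) + (j : ℕ))) := rfl

theorem det_opSchur_eq_schurOp (ħ : 𝕜) (lam : YoungDiagram) {m : ℕ} (hm : numRows lam ≤ m) :
    Matrix.det (Matrix.of fun i j : Fin m =>
      opSchur ħ ((lam.rowLen i : ℤ) - (i : ℕ) + (j : ℕ))) = schurOp ħ lam := by
  have h := det_rows_eq (fun (j : ℕ) p => opSchur ħ (p + (j : ℤ))) 1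
    (fun j p h => opSchur_of_neg ħ h) (fun j => by rw [neg_add_cancel, opSchur_zero]) lam m hm
  rw [h, one_pow, one_mul, schurOp_eq_det]

/-- The exponent `lam + (m - 1, m - 2, …, 0)`. -/
def shiftedRows (m : ℕ) (lam : YoungDiagram) : Fin m →₀ ℕ :=
  Finsupp.equivFunOnFinite.symm fun i => lam.rowLen i + (m - 1 - (i : ℕ))

theorem coeff_shiftedRows [CharZero 𝕜] (ħ : 𝕜) {m : ℕ} (lam : YoungDiagram) (hm : numRows lam ≤ m)
    (T : MvPowerSeries ℕ+ 𝕜) :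
    coeff (shiftedRows m lam) (vandet 𝕜 m * miwaPoint ħ m T) = pairing T (schurOp ħ lam) := by
  rw [coeff_vandet_mul_miwaPoint, ← det_opSchur_eq_schurOp ħ lam hm]
  congr 2
  ext1 i j
  simp only [Matrix.of_apply, shiftedRows, Finsupp.equivFunOnFinite_symm_apply_apply]
  congr 1
  have := i.2
  push_cast
  omega

/-- The bialternant formula: at a Miwa point the Jacobi-Trudi determinant is a quotient of
alternants in the parameters. -/
theorem miwaPoint_schurTimes [CharZero 𝕜] {ħ : 𝕜} (hħ : ħ ≠ 0) {m : ℕ} (lam : YoungDiagram)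
    (hm : numRows lam ≤ m) :
    vandet 𝕜 m * miwaPoint ħ m (schurTimes ħ lam) =
      Matrix.det (Matrix.of fun i l : Fin m =>
        (X l : MvPowerSeries (Fin m) 𝕜) ^ (lam.rowLen i + (m - 1 - (i : ℕ)))) := by
  rw [← vandet_mul_det_elemSchur lam hm]
  congr 1
  have hs := hasSubst_powerSumTimes_X (τ := Fin m) ħ
  rw [det_rows_eq (fun (j : ℕ) p =>
    elemSchur 𝕜 (powerSumTimes 1 (X : Fin m → MvPowerSeries (Fin m) 𝕜)) (p + (j : ℤ))) 1
    (fun j p h => elemSchur_of_neg _ h) (fun j => by rw [neg_add_cancel, elemSchur_zero]) lam m hm,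
    one_pow, one_mul, miwaPoint, schurTimes, schur, ← coe_substAlgHom hs, AlgHom.map_det]
  congr 1
  ext1 i j
  simp only [AlgHom.mapMatrix_apply, Matrix.map_apply, Matrix.of_apply]
  rw [map_elemSchur]
  congr 1
  funext k
  rw [map_smul, substAlgHom_X, powerSumTimes, powerSumTimes, smul_smul]
  congr 1
  field_simp

theorem coeff_det_pow {m : ℕ} (e : Fin m → ℕ) (n : Fin m →₀ ℕ) :
    coeff n (Matrix.det (Matrix.of fun i l : Fin m => (X l : MvPowerSeries (Fin m) 𝕜) ^ e i)) =
      ∑ s : Equiv.Perm (Fin m), if ∀ i, n i = e (s i) then ((Equiv.Perm.sign s : ℤ) : 𝕜) else 0 := by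
  classical
  rw [Matrix.det_apply, map_sum]
  refine Finset.sum_congr rfl fun s _ => ?_
  have h1 : (∏ i, (Matrix.of fun i l : Fin m => (X l : MvPowerSeries (Fin m) 𝕜) ^ e i) (s i) i) =
      monomial (Finsupp.equivFunOnFinite.symm fun i => e (s i)) 1 := by
    rw [monomial_one_eq, Finsupp.prod_fintype _ _ (by simp)]
    rfl
  have h2 : coeff n (monomial (Finsupp.equivFunOnFinite.symm fun i => e (s i)) (1 : 𝕜)) =
      if ∀ i, n i = e (s i) then (1 : 𝕜) else 0 := by
    rw [coeff_monomial]
    simp only [DFunLike.ext_iff, Finsupp.equivFunOnFinite_symm_apply_apply]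
  rw [h1]
  rcases Int.units_eq_one_or (Equiv.Perm.sign s) with h | h <;>
    simp only [h, one_smul, Units.neg_smul, map_neg, h2] <;> split_ifs <;> simp

open Classical in
/-- Schur functions of the times and Schur functions of the derivatives are dual bases. -/
theorem pairing_schurTimes_schurOp [CharZero 𝕜] {ħ : 𝕜} (hħ : ħ ≠ 0) (lam mu : YoungDiagram) :
    pairing (schurTimes ħ mu) (schurOp ħ lam) = if lam = mu then 1 else 0 := by
  classical
  set m := max (numRows lam) (numRows mu) with hm
  have hl : numRows lam ≤ m := le_max_left _ _
  have hmu : numRows mu ≤ m := le_max_right _ _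
  rw [← coeff_shiftedRows ħ lam hl, miwaPoint_schurTimes hħ mu hmu, coeff_det_pow]
  -- a permutation matching two strictly decreasing sequences is the identity
  have hid : ∀ s : Equiv.Perm (Fin m), (∀ i, shiftedRows m lam i =
      mu.rowLen (s i) + (m - 1 - ((s i : Fin m) : ℕ))) → s = 1 ∧ lam = mu := by
    intro s hs
    have hz : ∀ i : Fin m, (lam.rowLen i : ℤ) - (i : ℕ) =
        (mu.rowLen (s i) : ℤ) - ((s i : Fin m) : ℕ) := by
      intro i
      have h1 := hs i
      simp only [shiftedRows, Finsupp.equivFunOnFinite_symm_apply_apply] at h1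
      have := i.2
      have := (s i).2
      omega
    have hmono : StrictMono s := by
      intro i j hij
      have h1 := strictAnti_rowLen_sub lam (show (i : ℕ) < j from hij)
      simp only [hz] at h1
      exact (strictAnti_rowLen_sub mu).lt_iff_gt.mp h1
    have hs1 : s = 1 := by
      have := (hmono.range_inj (strictMono_id (α := Fin m))).mp (by
        rw [s.surjective.range_eq, Set.range_id])
      ext i
      exact congrArg Fin.val (congrFun this i)
    refine ⟨hs1, ext_rowLen fun i => ?_⟩
    by_cases hi : i < m
    · have := hz ⟨i, hi⟩
      rw [hs1] at this
      simp only [Equiv.Perm.coe_one, id_eq] at this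
      omega
    · rw [(rowLen_eq_zero_iff lam i).mpr (by omega), (rowLen_eq_zero_iff mu i).mpr (by omega)]
  by_cases h : lam = mu
  · rw [if_pos h, Finset.sum_eq_single 1]
    · rw [if_pos]
      · simp
      · intro i
        simp [shiftedRows, h]
    · intro s _ hs
      rw [if_neg fun hcon => hs (hid s hcon).1]
    · simp
  · rw [if_neg h]
    refine Finset.sum_eq_zero fun s _ => ?_
    rw [if_neg fun hcon => h (hid s hcon).2]

/-- A formal series is determined by its pairings with the Schur operators. -/
theorem eq_zero_of_pairing_schurOp_eq_zero [CharZero 𝕜] {ħ : 𝕜} (hħ : ħ ≠ 0) (T : MvPowerSeries ℕ+ 𝕜)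
    (h : ∀ lam, pairing T (schurOp ħ lam) = 0) : T = 0 := by
  refine eq_zero_of_miwaPoint_eq_zero hħ T fun m => ?_
  have h1 : vandet 𝕜 m * miwaPoint ħ m T = 0 := by
    ext n
    rw [coeff_vandet_mul_miwaPoint, map_zero]
    have h2 := eq_of_forall_diagram (pairing T).toAddMonoidHom
      (fun (j : ℕ) p => opSchur ħ (p + (j : ℤ))) (fun _ _ => (0 : 𝕜))
      (fun j p h => opSchur_of_neg ħ h) (fun _ _ _ => rfl) (m := m) 0
      (fun lam hl => by
        rw [det_opSchur_eq_schurOp ħ lam hl, zero_mul]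
        exact h lam) (fun i => (n i : ℤ) - ((m : ℤ) - 1))
    rw [zero_mul] at h2
    exact h2
  exact (mul_eq_zero.mp h1).resolve_left (vandet_ne_zero m)

/-- `F` is isobaric of weight `N` if `t_k` has weight `k`. -/
def IsIsobaric (F : MvPowerSeries ℕ+ 𝕜) (N : ℤ) : Prop :=
  ∀ d, coeff d F ≠ 0 → (Finsupp.weight (fun k : ℕ+ => (k : ℕ)) d : ℤ) = N

theorem IsIsobaric.zero (N : ℤ) : IsIsobaric (0 : MvPowerSeries ℕ+ 𝕜) N := fun d hd => by
  simp at hd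

theorem IsIsobaric.one : IsIsobaric (1 : MvPowerSeries ℕ+ 𝕜) 0 := by
  classical
  intro d hd
  rw [coeff_one] at hd
  have : d = 0 := by
    by_contra h
    simp [h] at hd
  simp [this]

theorem IsIsobaric.smul {F : MvPowerSeries ℕ+ 𝕜} {N : ℤ} (hF : IsIsobaric F N) (r : 𝕜) :
    IsIsobaric (r • F) N := fun d hd => hF d (by
  rw [coeff_smul] at hd
  exact right_ne_zero_of_mul hd)

theorem IsIsobaric.sum {ι : Type*} {s : Finset ι} {F : ι → MvPowerSeries ℕ+ 𝕜} {N : ℤ}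
    (hF : ∀ i ∈ s, IsIsobaric (F i) N) : IsIsobaric (∑ i ∈ s, F i) N := by
  intro d hd
  rw [map_sum] at hd
  obtain ⟨i, hi, hne⟩ := Finset.exists_ne_zero_of_sum_ne_zero hd
  exact hF i hi d hne

theorem IsIsobaric.mul {F G : MvPowerSeries ℕ+ 𝕜} {N M : ℤ} (hF : IsIsobaric F N)
    (hG : IsIsobaric G M) : IsIsobaric (F * G) (N + M) := by
  classical
  intro d hd
  rw [coeff_mul] at hd
  obtain ⟨x, hx, hne⟩ := Finset.exists_ne_zero_of_sum_ne_zero hd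
  rw [← Finset.HasAntidiagonal.mem_antidiagonal.mp hx, map_add, Nat.cast_add,
    hF _ (left_ne_zero_of_mul hne), hG _ (right_ne_zero_of_mul hne)]

theorem IsIsobaric.prod {ι : Type*} (s : Finset ι) {F : ι → MvPowerSeries ℕ+ 𝕜} {N : ι → ℤ}
    (hF : ∀ i ∈ s, IsIsobaric (F i) (N i)) : IsIsobaric (∏ i ∈ s, F i) (∑ i ∈ s, N i) := by
  classical
  induction s using Finset.induction_on with
  | empty => simpa using IsIsobaric.one
  | insert i s hi ih =>
    rw [Finset.prod_insert hi, Finset.sum_insert hi]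
    exact (hF i (Finset.mem_insert_self _ _)).mul
      (ih fun j hj => hF j (Finset.mem_insert_of_mem hj))

theorem isIsobaric_elemSchur [CharZero 𝕜] (a : 𝕜) (n : ℤ) :
    IsIsobaric (elemSchur 𝕜 (fun k : ℕ+ => a • (X k : MvPowerSeries ℕ+ 𝕜)) n) n := by
  classical
  rcases lt_or_ge n 0 with hn | hn
  · rw [elemSchur_of_neg _ hn]
    exact IsIsobaric.zero n
  lift n to ℕ using hn
  induction n using Nat.strong_induction_on with
  | _ n ih =>
  cases n with
  | zero => simpa [elemSchur_zero] using IsIsobaric.one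
  | succ n =>
    have hne : ((n + 1 : ℕ) : 𝕜) ≠ 0 := Nat.cast_ne_zero.mpr (Nat.succ_ne_zero n)
    have h := natCast_mul_elemSchur (𝕜 := 𝕜) (fun k : ℕ+ => a • (X k : MvPowerSeries ℕ+ 𝕜)) (n + 1)
    rw [← inv_smul_smul₀ hne (elemSchur 𝕜 _ _), h]
    refine (IsIsobaric.sum fun k hk => ?_).smul _
    have hk' : k ≤ n := by simpa [Nat.lt_succ_iff] using hk
    have c : ((n + 1 : ℕ) : ℤ) - (k + 1 : ℕ) = ((n - k : ℕ) : ℤ) := by omega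
    have c2 : ((n + 1 : ℕ) : ℤ) = (k + 1 : ℕ) + ((n - k : ℕ) : ℤ) := by omega
    rw [c]
    rw [c2]
    refine (IsIsobaric.mul (IsIsobaric.smul ?_ a) (ih (n - k) (by omega))).smul _
    intro d hd
    rw [coeff_X] at hd
    have : d = Finsupp.single k.succPNat 1 := by
      by_contra hcon
      simp [hcon] at hd
    rw [this, Finsupp.weight_single]
    simp

theorem isIsobaric_schurTimes [CharZero 𝕜] (ħ : 𝕜) (lam : YoungDiagram) :
    IsIsobaric (schurTimes ħ lam) (∑ i : Fin (numRows lam), (lam.rowLen i : ℤ)) := by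
  rw [schurTimes, schur, Matrix.det_apply]
  refine IsIsobaric.sum fun s _ => ?_
  have h : IsIsobaric (∏ i : Fin (numRows lam), elemSchur 𝕜
      (fun k : ℕ+ => ħ⁻¹ • (X k : MvPowerSeries ℕ+ 𝕜))
        ((lam.rowLen (s i) : ℤ) - ((s i : Fin _) : ℕ) + (i : ℕ)))
      (∑ i : Fin (numRows lam), (lam.rowLen i : ℤ)) := by
    have h1 := IsIsobaric.prod Finset.univ (fun (i : Fin (numRows lam)) _ =>
      isIsobaric_elemSchur ħ⁻¹ ((lam.rowLen (s i) : ℤ) - ((s i : Fin _) : ℕ) + (i : ℕ)))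
    convert h1 using 1
    rw [Finset.sum_add_distrib, Finset.sum_sub_distrib,
      Equiv.sum_comp s fun i : Fin (numRows lam) => (lam.rowLen i : ℤ),
      Equiv.sum_comp s fun i : Fin (numRows lam) => ((i : ℕ) : ℤ)]
    ring
  rcases Int.units_eq_one_or (Equiv.Perm.sign s) with hs | hs
  · rw [hs, one_smul]; exact h
  · rw [hs, Units.neg_smul, one_smul, ← neg_one_smul 𝕜]
    exact h.smul _

theorem finite_diagrams (N : ℕ) :
    {lam : YoungDiagram | ∑ i : Fin (numRows lam), lam.rowLen i = N}.Finite := by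
  have hinj : Function.Injective YoungDiagram.cells := fun a b h => YoungDiagram.ext h
  refine Set.Finite.of_finite_image (f := YoungDiagram.cells) ?_ hinj.injOn
  refine (Finset.finite_toSet (Finset.powerset (Finset.range N ×ˢ Finset.range N))).subset ?_
  rintro _ ⟨lam, hlam, rfl⟩
  rw [Set.mem_ofPred_eq] at hlam
  rw [Finset.mem_coe, Finset.mem_powerset]
  have hpos : ∀ i : Fin (numRows lam), 1 ≤ lam.rowLen i := by
    intro i
    have := (rowLen_eq_zero_iff lam i).not.mpr (not_le.mpr i.2)
    omega
  have hrows : numRows lam ≤ N := by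
    rw [← hlam]
    calc numRows lam = ∑ i : Fin (numRows lam), 1 := by simp
      _ ≤ _ := Finset.sum_le_sum fun i _ => hpos i
  rintro ⟨i, j⟩ hij
  rw [YoungDiagram.mem_cells, YoungDiagram.mem_iff_lt_rowLen] at hij
  have hi : i < numRows lam := by
    by_contra hcon
    rw [(rowLen_eq_zero_iff lam i).mpr (not_lt.mp hcon)] at hij
    omega
  have hj : lam.rowLen i ≤ N := by
    rw [← hlam]
    exact Finset.single_le_sum (f := fun i : Fin (numRows lam) => lam.rowLen i)
      (fun _ _ => Nat.zero_le _) (Finset.mem_univ ⟨i, hi⟩)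
  simp only [Finset.mem_product, Finset.mem_range]
  omega

theorem finite_coeff_schurTimes_ne_zero [CharZero 𝕜] (ħ : 𝕜) (d : ℕ+ →₀ ℕ) :
    {lam : YoungDiagram | coeff d (schurTimes ħ lam) ≠ 0}.Finite := by
  refine (finite_diagrams (Finsupp.weight (fun k : ℕ+ => (k : ℕ)) d)).subset fun lam h => ?_
  have := isIsobaric_schurTimes ħ lam d h
  rw [Set.mem_ofPred_eq]
  exact_mod_cast this.symm

/-- The coefficients of a Schur expansion are recovered by the dual operators. -/
theorem IsSchurExpansion.pairing_eq [CharZero 𝕜] {ħ : 𝕜} (hħ : ħ ≠ 0) {b : YoungDiagram → 𝕜}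
    {T : MvPowerSeries ℕ+ 𝕜} (h : IsSchurExpansion ħ b T) (lam : YoungDiagram) :
    pairing T (schurOp ħ lam) = b lam := by
  classical
  set q := schurOp ħ lam
  let S : Finset YoungDiagram :=
    q.support.biUnion (fun d => (h d).1.toFinset) ∪ {lam}
  have hT : ∀ d ∈ q.support, coeff d T = ∑ mu ∈ S, b mu * coeff d (schurTimes ħ mu) := by
    intro d hd
    rw [(h d).2]
    refine finsum_eq_sum_of_support_subset _ fun mu hmu => ?_
    rw [Finset.mem_coe]
    refine Finset.mem_union_left _ (Finset.mem_biUnion.mpr ⟨d, hd, ?_⟩)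
    rwa [Set.Finite.mem_toFinset]
  have h1 : pairing T q = ∑ mu ∈ S, b mu * pairing (schurTimes ħ mu) q := by
    simp only [pairing_eq_sum, Finset.mul_sum]
    rw [Finset.sum_comm]
    refine Finset.sum_congr rfl fun d hd => ?_
    rw [hT d hd, Finset.mul_sum]
    exact Finset.sum_congr rfl fun mu _ => by ring
  rw [h1, Finset.sum_eq_single lam]
  · rw [pairing_schurTimes_schurOp hħ, if_pos rfl, mul_one]
  · intro mu _ hne
    rw [pairing_schurTimes_schurOp hħ, if_neg hne.symm, mul_zero]
  · intro hcon
    exact absurd (Finset.mem_union_right _ (Finset.mem_singleton_self lam)) hcon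

/-- Every family of coefficients is the Schur expansion of some formal series. -/
theorem exists_isSchurExpansion [CharZero 𝕜] (ħ : 𝕜) (b : YoungDiagram → 𝕜) :
    ∃ T : MvPowerSeries ℕ+ 𝕜, IsSchurExpansion ħ b T := by
  refine ⟨fun d => ∑ᶠ lam, b lam * coeff d (schurTimes ħ lam), fun d => ⟨?_, rfl⟩⟩
  refine (finite_coeff_schurTimes_ne_zero ħ d).subset fun lam h => ?_
  exact right_ne_zero_of_mul h

/-- The Schur coefficients of `T` are the values at `t = 0` of the Schur functions of the operators
`ħ ∂_k / k` applied to `T`. Existence and uniqueness of the expansion are immediate from this. -/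
theorem isSchurExpansion_iff [CharZero 𝕜] {ħ : 𝕜} (hħ : ħ ≠ 0) (b : YoungDiagram → 𝕜)
    (T : MvPowerSeries ℕ+ 𝕜) :
    IsSchurExpansion ħ b T ↔ ∀ lam, pairing T (schurOp ħ lam) = b lam := by
  refine ⟨fun h => h.pairing_eq hħ, fun h => ?_⟩
  obtain ⟨T', hT'⟩ := exists_isSchurExpansion ħ b
  have : T - T' = 0 := eq_zero_of_pairing_schurOp_eq_zero hħ _ fun lam => by
    rw [pairing_sub, h, hT'.pairing_eq hħ, sub_self]
  rwa [sub_eq_zero.mp this]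

theorem rowLen_rowDiagram_zero (k : ℕ) : (rowDiagram k).rowLen 0 = k := by
  have h : ∀ j, j < (rowDiagram k).rowLen 0 ↔ j < k := by
    intro j
    rw [← YoungDiagram.mem_iff_lt_rowLen, ← YoungDiagram.mem_cells]
    simp [rowDiagram]
  have h1 := h k
  have h2 := h ((rowDiagram k).rowLen 0)
  omega

theorem rowDiagram_zero : rowDiagram 0 = ⊥ := by
  apply YoungDiagram.ext
  simp [rowDiagram]

theorem numRows_rowDiagram_le (k : ℕ) : numRows (rowDiagram k) ≤ 1 := by
  rw [← rowLen_eq_zero_iff]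
  by_contra hcon
  have h := YoungDiagram.mem_iff_lt_rowLen.mpr (Nat.pos_of_ne_zero hcon)
  rw [← YoungDiagram.mem_cells] at h
  simp [rowDiagram] at h

theorem schurOp_rowDiagram (ħ : 𝕜) (k : ℕ) : schurOp ħ (rowDiagram k) = opSchur ħ k := by
  rw [← det_opSchur_eq_schurOp ħ _ (numRows_rowDiagram_le k)]
  simp [rowLen_rowDiagram_zero]

end Expansion

/-! ### Wronskian form of the addition formulas -/

section Wronskian

variable {𝕜 S : Type*} [CommRing 𝕜] [CommRing S] [Algebra 𝕜 S]

/-- The operator `1 - ħ w ∂`, that is `z - ħ ∂` up to the factor `w = 1 / z`. -/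
def waveOp (δ : Derivation 𝕜 S S) (ħ : 𝕜) (w F : S) : S := F - ħ • (w * δ F)

theorem waveOp_sub (δ : Derivation 𝕜 S S) (ħ : 𝕜) (w F G : S) :
    waveOp δ ħ w (F - G) = waveOp δ ħ w F - waveOp δ ħ w G := by
  simp only [waveOp, map_sub, mul_sub, smul_sub]; ring

theorem waveOp_sum (δ : Derivation 𝕜 S S) (ħ : 𝕜) (w : S) {ι : Type*} (s : Finset ι) (F : ι → S) :
    waveOp δ ħ w (∑ i ∈ s, F i) = ∑ i ∈ s, waveOp δ ħ w (F i) := by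
  simp only [waveOp, map_sum, Finset.mul_sum, Finset.smul_sum, Finset.sum_sub_distrib]

theorem waveOp_mul (δ : Derivation 𝕜 S S) (ħ : 𝕜) (w g F : S) :
    waveOp δ ħ w (g * F) = g * waveOp δ ħ w F - (ħ • δ g) * w * F := by
  simp only [waveOp, Derivation.leibniz, smul_eq_mul, mul_add, smul_add, mul_sub, smul_mul_assoc,
    mul_smul_comm]
  rw [mul_left_comm w g, show δ g * w * F = w * (F * δ g) by ring]
  abel

theorem iterate_waveOp_const_mul (δ : Derivation 𝕜 S S) (ħ : 𝕜) (w c : S) (hc : δ c = 0) (F : S)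
    (j : ℕ) : (waveOp δ ħ w)^[j] (c * F) = c * (waveOp δ ħ w)^[j] F := by
  induction j with
  | zero => rfl
  | succ j ih =>
    rw [Function.iterate_succ_apply', ih, waveOp_mul, hc, smul_zero, zero_mul, zero_mul, sub_zero,
      Function.iterate_succ_apply']

theorem iterate_waveOp_sub (δ : Derivation 𝕜 S S) (ħ : 𝕜) (w F G : S) (j : ℕ) :
    (waveOp δ ħ w)^[j] (F - G) = (waveOp δ ħ w)^[j] F - (waveOp δ ħ w)^[j] G := by
  induction j with
  | zero => rfl
  | succ j ih => simp only [Function.iterate_succ_apply', ih, waveOp_sub]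

/-- The coefficients of `(z - ħ ∂)^j ∘ g` as a differential operator. -/
def gaugeCoeff (δ : Derivation 𝕜 S S) (ħ : 𝕜) (g : S) : ℕ → ℕ → S
  | 0, l => if l = 0 then g else 0
  | j + 1, 0 => - (ħ • δ (gaugeCoeff δ ħ g j 0))
  | j + 1, l + 1 => gaugeCoeff δ ħ g j l - ħ • δ (gaugeCoeff δ ħ g j (l + 1))

theorem gaugeCoeff_of_lt (δ : Derivation 𝕜 S S) (ħ : 𝕜) (g : S) (j l : ℕ) (h : j < l) :
    gaugeCoeff δ ħ g j l = 0 := by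
  induction j generalizing l with
  | zero => simp [gaugeCoeff, Nat.pos_iff_ne_zero.mp h]
  | succ j ih =>
    cases l with
    | zero => omega
    | succ l => rw [gaugeCoeff, ih l (by omega), ih (l + 1) (by omega)]; simp

theorem gaugeCoeff_self (δ : Derivation 𝕜 S S) (ħ : 𝕜) (g : S) (j : ℕ) :
    gaugeCoeff δ ħ g j j = g := by
  induction j with
  | zero => simp [gaugeCoeff]
  | succ j ih => rw [gaugeCoeff, ih, gaugeCoeff_of_lt _ _ _ _ _ (Nat.lt_succ_self j)]; simp

theorem iterate_waveOp_mul (δ : Derivation 𝕜 S S) (ħ : 𝕜) (w : S) (hw : δ w = 0) (g F : S) (j : ℕ) :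
    (waveOp δ ħ w)^[j] (g * F) = ∑ l ∈ Finset.range (j + 1),
      gaugeCoeff δ ħ g j l * (w ^ (j - l) * (waveOp δ ħ w)^[l] F) := by
  induction j with
  | zero => simp [gaugeCoeff]
  | succ j ih =>
    have hpow : ∀ n : ℕ, δ (w ^ n) = 0 := fun n => by rw [Derivation.leibniz_pow, hw]; simp
    have h1 : ∀ l ∈ Finset.range (j + 1), waveOp δ ħ w
        (gaugeCoeff δ ħ g j l * (w ^ (j - l) * (waveOp δ ħ w)^[l] F)) =
        gaugeCoeff δ ħ g j l * (w ^ (j - l) * (waveOp δ ħ w)^[l + 1] F) +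
        (-(ħ • δ (gaugeCoeff δ ħ g j l))) * (w ^ (j + 1 - l) * (waveOp δ ħ w)^[l] F) := by
      intro l hl
      have hl' : l ≤ j := by simpa [Nat.lt_succ_iff] using hl
      rw [waveOp_mul, waveOp_mul, hpow, smul_zero, zero_mul, zero_mul, sub_zero,
        ← Function.iterate_succ_apply' (waveOp δ ħ w) l F, Nat.succ_sub hl', pow_succ]
      ring
    rw [Function.iterate_succ_apply', ih, waveOp_sum, Finset.sum_congr rfl h1,
      Finset.sum_add_distrib, Finset.sum_range_succ' (fun l => gaugeCoeff δ ħ g (j + 1) l * _)]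
    have h2 : ∑ l ∈ Finset.range (j + 1), (-(ħ • δ (gaugeCoeff δ ħ g j l))) *
        (w ^ (j + 1 - l) * (waveOp δ ħ w)^[l] F) =
        ∑ l ∈ Finset.range (j + 1), (-(ħ • δ (gaugeCoeff δ ħ g j (l + 1)))) *
          (w ^ (j - l) * (waveOp δ ħ w)^[l + 1] F) +
        (-(ħ • δ (gaugeCoeff δ ħ g j 0))) * (w ^ (j + 1) * F) := by
      rw [Finset.sum_range_succ', Finset.sum_range_succ _ j,
        gaugeCoeff_of_lt _ _ _ _ _ (Nat.lt_succ_self j)]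
      simp
    rw [h2, ← add_assoc, ← Finset.sum_add_distrib]
    congr 1
    refine Finset.sum_congr rfl fun l _ => ?_
    rw [gaugeCoeff, Nat.add_sub_add_right]
    ring

/-- The matrix with entries `w_i ^ (m - 1 - j) (1 - ħ w_i ∂) ^ j B_i`. -/
def waveMatrix (δ : Derivation 𝕜 S S) (ħ : 𝕜) (w B : ℕ → S) (m : ℕ) : Matrix (Fin m) (Fin m) S :=
  Matrix.of fun i j => w i ^ (m - 1 - (j : ℕ)) * (waveOp δ ħ (w i))^[j] (B i)

/-- A common factor `g` of all rows only scales the determinant: by the Leibniz rule it acts as a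
triangular change of columns with `g` on the diagonal. -/
theorem det_waveMatrix_mul (δ : Derivation 𝕜 S S) (ħ : 𝕜) (w B : ℕ → S) (hw : ∀ i, δ (w i) = 0)
    (g : S) (m : ℕ) :
    (waveMatrix δ ħ w (fun i => g * B i) m).det = g ^ m * (waveMatrix δ ħ w B m).det := by
  let K : Matrix (Fin m) (Fin m) S := Matrix.of fun l j => gaugeCoeff δ ħ g j l
  have hK : K.det = g ^ m := by
    rw [Matrix.det_of_isUpperTriangular]
    · simp [K, gaugeCoeff_self]
    · intro i j hij
      exact gaugeCoeff_of_lt _ _ _ _ _ hij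
  have h : waveMatrix δ ħ w (fun i => g * B i) m = waveMatrix δ ħ w B m * K := by
    ext1 i j
    rw [Matrix.mul_apply]
    simp only [waveMatrix, Matrix.of_apply, K]
    have hj := j.2
    have h1 : ∑ x : Fin m, w i ^ (m - 1 - (x : ℕ)) * (waveOp δ ħ (w i))^[x] (B i) *
        gaugeCoeff δ ħ g j x = ∑ l ∈ Finset.range m, w i ^ (m - 1 - l) *
          (waveOp δ ħ (w i))^[l] (B i) * gaugeCoeff δ ħ g j l := by
      rw [Finset.sum_range]
    rw [h1, iterate_waveOp_mul _ _ _ (hw i), Finset.mul_sum,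
      ← Finset.sum_subset (Finset.range_mono (Nat.succ_le_of_lt hj)) (fun l _ hl => by
        rw [gaugeCoeff_of_lt _ _ _ _ _ (by simpa using hl), mul_zero])]
    refine Finset.sum_congr rfl fun l hl => ?_
    have hl' : l ≤ j := by simpa [Nat.lt_succ_iff] using hl
    have : m - 1 - l = (m - 1 - j) + (j - l) := by omega
    rw [this, pow_add]
    ring
  rw [h, Matrix.det_mul, hK, mul_comm]

theorem det_waveMatrix_const_mul (δ : Derivation 𝕜 S S) (ħ : 𝕜) (w B : ℕ → S) (c : ℕ → S)
    (hc : ∀ i, δ (c i) = 0) (m : ℕ) :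
    (waveMatrix δ ħ w (fun i => c i * B i) m).det =
      (∏ i ∈ Finset.range m, c i) * (waveMatrix δ ħ w B m).det := by
  rw [Finset.prod_range, ← Matrix.det_mul_column]
  congr 1
  ext1 i j
  simp only [waveMatrix, Matrix.of_apply, iterate_waveOp_const_mul _ _ _ _ (hc i)]
  ring

/-- The Darboux step: eliminating the last point lowers the size of the determinant by one. -/
theorem waveMatrix_darboux [IsDomain S] (δ : Derivation 𝕜 S S) (ħ : 𝕜) (w B : ℕ → S)
    (hw : ∀ i, δ (w i) = 0) (m : ℕ) (hm : w m ≠ 0) (v : S)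
    (hv : waveOp δ ħ (w m) (B m) = v * B m) :
    (waveMatrix δ ħ w B (m + 1)).det = (-1) ^ m * B m *
      (waveMatrix δ ħ w (fun i => w m * waveOp δ ħ (w i) (B i) - w i * (v * B i)) m).det := by
  set Y : ℕ → S := fun i => w m * waveOp δ ħ (w i) (B i) - w i * (v * B i) with hY
  have hYm : Y m = 0 := by simp only [hY, hv]; ring
  let U : Matrix (Fin (m + 1)) (Fin (m + 1)) S := Matrix.of fun l j =>
    Fin.cases (if l = 0 then 1 else 0)
      (fun j' : Fin m => (if l = j'.succ then w m else 0) - gaugeCoeff δ ħ v j' l) j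
  have hU : U.det = w m ^ m := by
    rw [Matrix.det_of_isUpperTriangular]
    · rw [Fin.prod_univ_succ]
      simp only [U, Matrix.of_apply, Fin.cases_zero, Fin.cases_succ, if_true, one_mul]
      rw [Finset.prod_congr rfl fun (j : Fin m) _ => by
        rw [gaugeCoeff_of_lt δ ħ v j (j.succ : Fin (m + 1)) (by simp), sub_zero]]
      simp
    · intro i j hij
      change j < i at hij
      induction j using Fin.cases with
      | zero => simp [U, hij.ne']
      | succ j' =>
        simp only [U, Matrix.of_apply, Fin.cases_succ]
        have h2 : (j' : ℕ) < i := by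
          have := Fin.lt_def.mp hij
          simp at this; omega
        rw [if_neg hij.ne', gaugeCoeff_of_lt _ _ _ _ _ h2, sub_zero]
  let N := waveMatrix δ ħ w B (m + 1) * U
  have hN0 : ∀ i : Fin (m + 1), N i 0 = w i ^ m * B i := by
    intro i
    simp only [N, Matrix.mul_apply]
    rw [Finset.sum_eq_single 0]
    · simp [U, waveMatrix]
    · intro l _ hl; simp [U, hl]
    · simp
  have hNs : ∀ (i : Fin (m + 1)) (j : Fin m), N i j.succ =
      w i ^ (m - 1 - (j : ℕ)) * (waveOp δ ħ (w i))^[j] (Y i) := by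
    intro i j
    have hj := j.2
    simp only [N, Matrix.mul_apply, U, Matrix.of_apply, Fin.cases_succ, mul_sub,
      Finset.sum_sub_distrib, mul_ite, mul_zero, Finset.sum_ite_eq', Finset.mem_univ, if_true]
    simp only [hY, iterate_waveOp_sub, iterate_waveOp_const_mul _ _ _ _ (hw _), mul_sub]
    congr 1
    · simp only [waveMatrix, Matrix.of_apply, Fin.val_succ, Function.iterate_succ_apply]
      have : m + 1 - 1 - ((j : ℕ) + 1) = m - 1 - j := by omega
      rw [this]
      ring
    · rw [iterate_waveOp_mul _ _ _ (hw i), Finset.mul_sum, Finset.mul_sum]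
      have h1 : ∑ x : Fin (m + 1), waveMatrix δ ħ w B (m + 1) i x * gaugeCoeff δ ħ v j x =
          ∑ l ∈ Finset.range (m + 1), w i ^ (m + 1 - 1 - l) *
          (waveOp δ ħ (w i))^[l] (B i) * gaugeCoeff δ ħ v j l := by
        rw [Finset.sum_range]; rfl
      rw [h1, ← Finset.sum_subset (Finset.range_mono (Nat.succ_le_succ hj.le)) (fun l _ hl => by
        rw [gaugeCoeff_of_lt _ _ _ _ _ (by simpa using hl), mul_zero])]
      refine Finset.sum_congr rfl fun l hl => ?_
      have hl' : l ≤ j := by simpa [Nat.lt_succ_iff] using hl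
      have : m + 1 - 1 - l = (m - 1 - j) + 1 + (j - l) := by omega
      rw [this, pow_add, pow_succ]
      ring
  have hz : ∀ j, (waveOp δ ħ (w m))^[j] (0 : S) = 0 := by
    intro j
    have := iterate_waveOp_sub δ ħ (w m) 0 0 j
    rwa [sub_self, sub_self] at this
  have hdet : N.det = (-1) ^ m * (w m ^ m * B m) * (waveMatrix δ ħ w Y m).det := by
    rw [Matrix.det_succ_row N (Fin.last m), Fin.sum_univ_succ, Finset.sum_eq_zero]
    · rw [add_zero, hN0, Fin.succAbove_last]
      simp only [Fin.val_last, Fin.val_zero, add_zero]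
      congr 2
      ext1 i j
      rw [Matrix.submatrix_apply, Fin.succAbove_zero, hNs]
      rfl
    · intro j _
      rw [hNs, Fin.val_last, hYm, hz]
      simp
  have h2 : w m ^ m * (waveMatrix δ ħ w B (m + 1)).det =
      w m ^ m * ((-1) ^ m * B m * (waveMatrix δ ħ w Y m).det) := by
    rw [mul_comm, ← hU, ← Matrix.det_mul]
    change N.det = _
    rw [hdet, hU]
    ring
  exact mul_left_cancel₀ (pow_ne_zero m hm) h2

/-- The composition of the first `m` of a family of shifts. -/
def iterShift (σ : ℕ → S →ₐ[𝕜] S) : ℕ → S →ₐ[𝕜] S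
  | 0 => AlgHom.id 𝕜 S
  | m + 1 => (σ m).comp (iterShift σ m)

/-- The two-point formula
`(w_j - w_i) σ_i σ_j T · T = w_j (1 - ħ w_i ∂) σ_i T · σ_j T - w_i σ_i T · (1 - ħ w_j ∂) σ_j T`
implies the `m`-point Wronskian formula, by iterating the Darboux step on the shifted series. -/
theorem prod_mul_iterShift [IsDomain S] (δ : Derivation 𝕜 S S) (ħ : 𝕜) (w : ℕ → S)
    (hw : ∀ i, δ (w i) = 0) (hw0 : ∀ i, w i ≠ 0) (σ : ℕ → S →ₐ[𝕜] S)
    (hσw : ∀ i j, σ i (w j) = w j) (hσδ : ∀ i F, δ (σ i F) = σ i (δ F))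
    (hσσ : ∀ i j F, σ i (σ j F) = σ j (σ i F)) (T : S) (hT : IsUnit T)
    (hfay : ∀ i j, i ≠ j → (w j - w i) * σ i (σ j T) * T =
      w j * waveOp δ ħ (w i) (σ i T) * σ j T - w i * σ i T * waveOp δ ħ (w j) (σ j T)) (m : ℕ) :
    (∏ j ∈ Finset.range m, ∏ i ∈ Finset.range j, (w i - w j)) * iterShift σ m T * T ^ m =
      T * (waveMatrix δ ħ w (fun i => σ i T) m).det := by
  induction m with
  | zero => simp [iterShift]
  | succ m ih =>
    set B : ℕ → S := fun i => σ i T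
    obtain ⟨u, hu⟩ := (hT.map (σ m)).exists_left_inv
    have hσL : ∀ i F, σ m (waveOp δ ħ (w i) F) = waveOp δ ħ (w i) (σ m F) := by
      intro i F
      simp only [waveOp, map_sub, map_smul, map_mul, hσw, hσδ]
    have hσLj : ∀ i (j : ℕ) F, σ m ((waveOp δ ħ (w i))^[j] F) =
        (waveOp δ ħ (w i))^[j] (σ m F) := by
      intro i j F
      induction j with
      | zero => rfl
      | succ j ihj => rw [Function.iterate_succ_apply', hσL, ihj, Function.iterate_succ_apply']
    have ih' := congrArg (σ m) ih
    simp only [map_mul, map_prod, map_sub, hσw, map_pow, AlgHom.map_det] at ih'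
    have hM : (σ m).mapMatrix (waveMatrix δ ħ w B m) =
        waveMatrix δ ħ w (fun i => σ i (σ m T)) m := by
      ext1 i j
      simp only [AlgHom.mapMatrix_apply, Matrix.map_apply, waveMatrix, Matrix.of_apply, map_mul,
        map_pow, hσw, hσLj, B, hσσ m]
    rw [hM] at ih'
    set v := waveOp δ ħ (w m) (B m) * u with hv
    have hD := waveMatrix_darboux δ ħ w B hw m (hw0 m) v (by
      rw [hv, mul_assoc]; change _ = _ * (u * σ m T); rw [hu, mul_one])
    have hY : waveMatrix δ ħ w (fun i => w m * waveOp δ ħ (w i) (B i) - w i * (v * B i)) m =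
        waveMatrix δ ħ w (fun i => (T * u) * ((w m - w i) * σ i (σ m T))) m := by
      ext1 i j
      simp only [waveMatrix, Matrix.of_apply]
      congr 2
      have h := hfay i m i.2.ne
      have h1 : T * u * ((w m - w i) * σ i (σ m T)) = u * ((w m - w i) * σ i (σ m T) * T) := by ring
      rw [h1, h, hv]
      calc w m * waveOp δ ħ (w i) (B i) - w i * (waveOp δ ħ (w m) (B m) * u * B i)
          = (u * σ m T) * (w m * waveOp δ ħ (w i) (B i)) -
              w i * (waveOp δ ħ (w m) (B m) * u * B i) := by rw [hu, one_mul]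
        _ = _ := by simp only [B]; ring
    rw [hY, det_waveMatrix_mul δ ħ w _ hw, det_waveMatrix_const_mul δ ħ w (fun i => σ i (σ m T))
      (fun i => w m - w i) (fun i => by rw [map_sub, hw, hw, sub_self])] at hD
    have hsign : ∏ i ∈ Finset.range m, (w i - w m) =
        (-1) ^ m * ∏ i ∈ Finset.range m, (w m - w i) := by
      rw [← Finset.card_range m, ← Finset.prod_const, Finset.card_range, ← Finset.prod_mul_distrib]
      exact Finset.prod_congr rfl fun i _ => by ring
    have hcomp : iterShift σ (m + 1) T = σ m (iterShift σ m T) := rfl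
    rw [Finset.prod_range_succ, hsign, hcomp, hD]
    have hum : u ^ m * (σ m T) ^ m = 1 := by rw [← mul_pow, hu, one_pow]
    calc _ = ((-1) ^ m * T ^ (m + 1) * ∏ i ∈ Finset.range m, (w m - w i)) *
          ((∏ j ∈ Finset.range m, ∏ i ∈ Finset.range j, (w i - w j)) * σ m (iterShift σ m T)) *
            (u ^ m * (σ m T) ^ m) := by rw [hum]; ring
      _ = ((-1) ^ m * T ^ (m + 1) * ∏ i ∈ Finset.range m, (w m - w i)) * u ^ m *
          ((∏ j ∈ Finset.range m, ∏ i ∈ Finset.range j, (w i - w j)) * σ m (iterShift σ m T) *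
            (σ m T) ^ m) := by ring
      _ = _ := by rw [ih']; simp only [B]; ring

theorem prod_sub_eq_det [IsDomain S] (w : ℕ → S) (hw0 : ∀ i, w i ≠ 0) (m : ℕ) :
    (∏ j ∈ Finset.range m, ∏ i ∈ Finset.range j, (w i - w j)) =
      Matrix.det (Matrix.of fun i j : Fin m => w i ^ (m - 1 - (j : ℕ))) := by
  -- the trivial case `∂ = 0`, `T = 1` of the Wronskian formula
  have h := prod_mul_iterShift (𝕜 := ℤ) (0 : Derivation ℤ S S) 0 w (fun _ => rfl) hw0
    (fun _ => AlgHom.id ℤ S) (fun _ _ => rfl) (fun _ _ => rfl) (fun _ _ _ => rfl) 1 isUnit_one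
    (fun i j _ => by simp [waveOp]) m
  have h1 : ∀ (j : ℕ) (v : S), (waveOp (0 : Derivation ℤ S S) 0 v)^[j] 1 = 1 := by
    intro j v
    induction j with
    | zero => rfl
    | succ j ih => rw [Function.iterate_succ_apply', ih]; simp [waveOp]
  simpa [waveMatrix, h1] using h

end Wronskian

/-! ### Series in one of the variables -/

section OneVar

open MvPowerSeries

variable {𝕜 : Type*} [Field 𝕜] {τ : Type*}

theorem hasSubst_X_comp {ι : Type*} {f : ι → τ} (hf : Function.Injective f) :
    HasSubst (fun i => (X (f i) : MvPowerSeries τ 𝕜)) := by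
  classical
  constructor
  · intro i
    rw [constantCoeff_X]
    exact IsNilpotent.zero
  · intro d
    refine Set.Subsingleton.finite fun i hi j hj => hf ?_
    by_contra hne
    have hd : ∀ i, i ∈ {s | coeff d (X (f s) : MvPowerSeries τ 𝕜) ≠ 0} →
        d = Finsupp.single (f i) 1 := by
      intro i hi
      by_contra hcon
      apply hi
      rw [coeff_X, if_neg hcon]
    have h1 := (hd i hi).symm.trans (hd j hj)
    rw [Finsupp.single_left_inj one_ne_zero] at h1
    exact hne h1

theorem hasSubst_sumElim {ι κ : Type*} {a : ι → MvPowerSeries τ 𝕜} {b : κ → MvPowerSeries τ 𝕜}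
    (ha : HasSubst a) (hb : HasSubst b) : HasSubst (Sum.elim a b) := by
  constructor
  · rintro (i | i)
    · exact ha.const_coeff i
    · exact hb.const_coeff i
  · intro d
    refine (((ha.coeff_zero d).image Sum.inl).union ((hb.coeff_zero d).image Sum.inr)).subset ?_
    rintro (i | i) hi
    · exact Or.inl ⟨i, hi, rfl⟩
    · exact Or.inr ⟨i, hi, rfl⟩

theorem hasSubst_unit (a : τ) : HasSubst (fun _ : Unit => (X a : MvPowerSeries τ 𝕜)) :=
  hasSubst_X_comp fun _ _ _ => rfl

/-- The series `∑_n c_n w ^ n` in one variable. -/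
def unitSeries (c : ℕ → 𝕜) : MvPowerSeries Unit 𝕜 := fun n => c (n ())

theorem coeff_unitSeries (c : ℕ → 𝕜) (n : Unit →₀ ℕ) : coeff n (unitSeries c) = c (n ()) := rfl

/-- The series `∑_n c_n w_a ^ n` in the single variable `w_a`. -/
def oneVar (a : τ) (c : ℕ → 𝕜) : MvPowerSeries τ 𝕜 :=
  subst (fun _ : Unit => (X a : MvPowerSeries τ 𝕜)) (unitSeries c)

open Classical in
theorem coeff_oneVar (a : τ) (c : ℕ → 𝕜) (n : τ →₀ ℕ) :
    coeff n (oneVar a c) = if n = Finsupp.single a (n a) then c (n a) else 0 := by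
  rw [oneVar, coeff_subst (hasSubst_unit a)]
  have h : ∀ d : Unit →₀ ℕ, coeff n (d.prod fun s e => (X a : MvPowerSeries τ 𝕜) ^ e) =
      if n = Finsupp.single a (d ()) then 1 else 0 := by
    intro d
    rw [Finsupp.prod_fintype _ _ (by simp), Fintype.prod_unique, coeff_X_pow]
  simp only [h, smul_eq_mul, mul_ite, mul_one, mul_zero, coeff_unitSeries]
  rw [finsum_eq_single _ (Finsupp.single () (n a))]
  · simp only [Finsupp.single_eq_same]
  · intro d hd
    rw [if_neg]
    intro hcon
    apply hd
    ext
    rw [hcon]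
    simp

theorem oneVar_smul (a : τ) (r : 𝕜) (c : ℕ → 𝕜) :
    oneVar a (fun n => r * c n) = r • oneVar a c := by
  classical
  ext n
  rw [map_smul, coeff_oneVar, coeff_oneVar]
  split_ifs <;> simp

theorem oneVar_sum (a : τ) {ι : Type*} (s : Finset ι) (c : ι → ℕ → 𝕜) :
    oneVar a (fun n => ∑ i ∈ s, c i n) = ∑ i ∈ s, oneVar a (c i) := by
  classical
  ext n
  simp only [map_sum, coeff_oneVar]
  split_ifs <;> simp

theorem X_pow_mul_oneVar (a : τ) (k : ℕ) (c : ℤ → 𝕜) (hc : ∀ n < 0, c n = 0) :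
    (X a : MvPowerSeries τ 𝕜) ^ k * oneVar a (fun n => c n) = oneVar a (fun n => c ((n : ℤ) - k)) := by
  classical
  ext n
  rw [X_pow_eq, coeff_monomial_mul, coeff_oneVar, coeff_oneVar, one_mul]
  simp only [Finsupp.coe_tsub, Pi.sub_apply, Finsupp.single_eq_same, Finsupp.single_le_iff]
  by_cases h : k ≤ n a
  · have h1 : n - Finsupp.single a k = Finsupp.single a (n a - k) ↔
        n = Finsupp.single a (n a) := by
      rw [Finsupp.single_tsub]
      constructor
      · intro h1
        have h2 : n - Finsupp.single a k + Finsupp.single a k =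
            Finsupp.single a (n a) - Finsupp.single a k + Finsupp.single a k := by rw [h1]
        rwa [tsub_add_cancel_of_le (Finsupp.single_le_iff.mpr h), tsub_add_cancel_of_le
          (Finsupp.single_le_iff.mpr (by simpa using h))] at h2
      · intro h1
        rw [← h1]
    rw [if_pos h]
    simp only [h1, Nat.cast_sub h]
  · rw [if_neg h, hc _ (by omega)]
    simp

theorem coeff_prod_oneVar {m : ℕ} (c : Fin m → ℕ → 𝕜) (n : Fin m →₀ ℕ) :
    coeff n (∏ i, oneVar i (c i)) = ∏ i, c i (n i) := by
  classical
  have h : ∀ (s : Finset (Fin m)) (n : Fin m →₀ ℕ), coeff n (∏ i ∈ s, oneVar i (c i)) =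
      if n.support ⊆ s then ∏ i ∈ s, c i (n i) else 0 := by
    intro s
    induction s using Finset.induction_on with
    | empty => 
      intro n
      simp [coeff_one]
    | insert a s ha ih =>
      intro n
      rw [Finset.prod_insert ha, Finset.prod_insert ha, coeff_mul,
        Finset.sum_eq_single (Finsupp.single a (n a), n.erase a)]
      · have h1 : (n.erase a).support ⊆ s ↔ n.support ⊆ insert a s := by
          rw [Finsupp.support_erase, Finset.subset_insert_iff]
        have h2 : ∏ i ∈ s, c i (n.erase a i) = ∏ i ∈ s, c i (n i) :=
          Finset.prod_congr rfl fun i hi => by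
            rw [Finsupp.erase_ne (ne_of_mem_of_not_mem hi ha)]
        rw [coeff_oneVar, ih]
        simp only [Finsupp.single_eq_same, if_true, h1, h2, mul_ite, mul_zero]
      · rintro ⟨x, y⟩ hx hne
        rw [coeff_oneVar, ih]
        simp only
        split_ifs with h1 h2
        · exfalso
          apply hne
          have hxy : x + y = n := Finset.HasAntidiagonal.mem_antidiagonal.mp hx
          have hya : y a = 0 := by
            by_contra hcon
            exact ha (h2 (Finsupp.mem_support_iff.mpr hcon))
          have hxa : x a = n a := by
            rw [← hxy, Finsupp.add_apply, hya, add_zero]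
          rw [hxa] at h1
          refine Prod.ext h1 ?_
          change y = n.erase a
          ext i
          by_cases hi : i = a
          · rw [hi, hya, Finsupp.erase_same]
          · rw [Finsupp.erase_ne hi, ← hxy, h1, Finsupp.add_apply, Finsupp.single_eq_of_ne hi,
              zero_add]
        all_goals simp
      · intro hcon
        exfalso
        apply hcon
        rw [Finset.HasAntidiagonal.mem_antidiagonal]
        exact Finsupp.single_add_erase a n
  rw [h, if_pos (Finset.subset_univ _)]

/-- The coefficients of a determinant whose `i`-th row involves the variable `w_i` only. -/
theorem coeff_det_oneVar {m : ℕ} (c : Fin m → Fin m → ℕ → 𝕜) (n : Fin m →₀ ℕ) :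
    coeff n (Matrix.det (Matrix.of fun i j => oneVar i (c i j))) =
      Matrix.det (Matrix.of fun i j => c i j (n i)) := by
  rw [← Matrix.det_transpose, ← Matrix.det_transpose (Matrix.of fun i j => c i j (n i)),
    Matrix.det_apply, Matrix.det_apply, map_sum]
  refine Finset.sum_congr rfl fun s _ => ?_
  have h : coeff n (∏ i, oneVar i (c i (s i))) = ∏ i, c i (s i) (n i) :=
    coeff_prod_oneVar _ n
  simp only [Matrix.transpose_apply, Matrix.of_apply]
  rcases Int.units_eq_one_or (Equiv.Perm.sign s) with hs | hs <;>
    simp only [hs, one_smul, Units.neg_smul, map_neg, h]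

/-- Restriction to a single Miwa point: `T(ħ [w])` is the generating series of the one-row Schur
coefficients of `T`. -/
theorem subst_powerSumTimes_unit [CharZero 𝕜] (ħ : 𝕜) (a : τ) (T : MvPowerSeries ℕ+ 𝕜) :
    subst (powerSumTimes ħ fun _ : Unit => (X a : MvPowerSeries τ 𝕜)) T =
      oneVar a (fun n => pairing T (opSchur ħ n)) := by
  have hs := hasSubst_powerSumTimes_X (τ := Unit) ħ
  have h1 : powerSumTimes ħ (fun _ : Unit => (X a : MvPowerSeries τ 𝕜)) = fun k =>
      subst (fun _ : Unit => (X a : MvPowerSeries τ 𝕜))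
        (powerSumTimes ħ (X : Unit → MvPowerSeries Unit 𝕜) k) := by
    funext k
    rw [subst_powerSumTimes ħ _ (hasSubst_unit a)]
    congr 1
    funext i
    rw [subst_X (hasSubst_unit a)]
  rw [h1, ← subst_comp_subst_apply hs (hasSubst_unit a), oneVar]
  congr 1
  refine MvPowerSeries.ext fun n => ?_
  rw [coeff_subst_powerSumTimes, coeff_unitSeries]
  simp

end OneVar

/-! ### From the Hirota equation to the two-point formula -/

section Fay

open MvPowerSeries

variable {𝕜 : Type*} [Field 𝕜]

/-- The times `t + ħ ∑_i [u_i]`, as formal series in the times and further variables. -/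
def addTimes (ħ : 𝕜) {κ τ : Type*} [Fintype κ] (u : κ → MvPowerSeries (ℕ+ ⊕ τ) 𝕜) (k : ℕ+) :
    MvPowerSeries (ℕ+ ⊕ τ) 𝕜 :=
  X (Sum.inl k) + powerSumTimes ħ u k

theorem hasSubst_addTimes (ħ : 𝕜) {κ τ : Type*} [Fintype κ] {u : κ → MvPowerSeries (ℕ+ ⊕ τ) 𝕜}
    (hu : ∀ i, constantCoeff (u i) = 0) : HasSubst (addTimes ħ u) :=
  (hasSubst_X_comp Sum.inl_injective).add (hasSubst_powerSumTimes ħ hu)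

/-- The formal times among the variables `t_1, t_2, …, w_0, w_1, …`. -/
def inclTimes (T : MvPowerSeries ℕ+ 𝕜) : MvPowerSeries (ℕ+ ⊕ ℕ) 𝕜 :=
  subst (fun k => X (Sum.inl k)) T

/-- The substitution `t ↦ t + ħ [w_i]`. -/
def shiftArg (ħ : 𝕜) (i : ℕ) : ℕ+ ⊕ ℕ → MvPowerSeries (ℕ+ ⊕ ℕ) 𝕜 :=
  Sum.elim (addTimes ħ fun _ : Unit => X (Sum.inr i)) fun j => X (Sum.inr j)

theorem hasSubst_shiftArg (ħ : 𝕜) (i : ℕ) : HasSubst (shiftArg ħ i) :=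
  hasSubst_sumElim (hasSubst_addTimes ħ fun _ => constantCoeff_X _)
    (hasSubst_X_comp Sum.inr_injective)

/-- The Miwa shift `t ↦ t + ħ [w_i]`. -/
def shiftHom (ħ : 𝕜) (i : ℕ) : MvPowerSeries (ℕ+ ⊕ ℕ) 𝕜 →ₐ[𝕜] MvPowerSeries (ℕ+ ⊕ ℕ) 𝕜 :=
  substAlgHom (hasSubst_shiftArg ħ i)

theorem shiftHom_apply (ħ : 𝕜) (i : ℕ) (F : MvPowerSeries (ℕ+ ⊕ ℕ) 𝕜) :
    shiftHom ħ i F = subst (shiftArg ħ i) F := by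
  rw [shiftHom, coe_substAlgHom]

theorem shiftHom_inr (ħ : 𝕜) (i j : ℕ) :
    shiftHom ħ i (X (Sum.inr j)) = X (Sum.inr j) := by
  rw [shiftHom_apply, subst_X (hasSubst_shiftArg ħ i)]; rfl

theorem shiftHom_inl (ħ : 𝕜) (i : ℕ) (k : ℕ+) :
    shiftHom ħ i (X (Sum.inl k)) =
      X (Sum.inl k) + (ħ / ((k : ℕ) : 𝕜)) • X (Sum.inr i) ^ (k : ℕ) := by
  rw [shiftHom_apply, subst_X (hasSubst_shiftArg ħ i)]
  simp [shiftArg, addTimes, powerSumTimes]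

theorem shiftHom_subst (ħ : 𝕜) (i : ℕ) {ι : Type*} {a : ι → MvPowerSeries (ℕ+ ⊕ ℕ) 𝕜}
    (ha : HasSubst a) (F : MvPowerSeries ι 𝕜) :
    shiftHom ħ i (subst a F) = subst (fun s => shiftHom ħ i (a s)) F := by
  rw [shiftHom_apply, subst_comp_subst_apply ha (hasSubst_shiftArg ħ i)]
  simp only [shiftHom_apply]

theorem shiftHom_shiftArg_comm (ħ : 𝕜) (i j : ℕ) (s : ℕ+ ⊕ ℕ) :
    shiftHom ħ i (shiftArg ħ j s) = shiftHom ħ j (shiftArg ħ i s) := by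
  have h : ∀ (a : ℕ) s, shiftArg ħ a s = shiftHom ħ a (X s) := fun a s => by
    rw [shiftHom_apply, subst_X (hasSubst_shiftArg ħ a)]
  rw [h j s, h i s]
  rcases s with k | l
  · rw [shiftHom_inl, shiftHom_inl, map_add, map_add, map_smul, map_smul, map_pow, map_pow,
      shiftHom_inr, shiftHom_inr, shiftHom_inl, shiftHom_inl, add_right_comm]
  · simp only [shiftHom_inr]

theorem shiftHom_comm (ħ : 𝕜) (i j : ℕ) (F : MvPowerSeries (ℕ+ ⊕ ℕ) 𝕜) :
    shiftHom ħ i (shiftHom ħ j F) = shiftHom ħ j (shiftHom ħ i F) := by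
  have h : ∀ a b, shiftHom ħ a (shiftHom ħ b F) =
      subst (fun s => shiftHom ħ a (shiftArg ħ b s)) F := fun a b => by
    rw [shiftHom_apply ħ b, shiftHom_subst ħ a (hasSubst_shiftArg ħ b)]
  rw [h, h, funext (shiftHom_shiftArg_comm ħ i j)]

theorem pderiv_inl_inr (i : ℕ) : pderiv 𝕜 (Sum.inl 1)
    (X (Sum.inr i) : MvPowerSeries (ℕ+ ⊕ ℕ) 𝕜) = 0 := pderiv_X_of_ne (by simp)

theorem pderiv_powerSumTimes_eq_zero {κ τ : Type*} [Fintype κ] (ħ : 𝕜) (i : τ)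
    {u : κ → MvPowerSeries τ 𝕜} (hu : ∀ j, pderiv 𝕜 i (u j) = 0) (k : ℕ+) :
    pderiv 𝕜 i (powerSumTimes ħ u k) = 0 := by
  rw [powerSumTimes, Derivation.map_smul, map_sum, Finset.sum_eq_zero, smul_zero]
  intro j _
  rw [Derivation.leibniz_pow, hu]; simp

theorem pderiv_shiftHom (ħ : 𝕜) (i : ℕ) (F : MvPowerSeries (ℕ+ ⊕ ℕ) 𝕜) :
    pderiv 𝕜 (Sum.inl 1) (shiftHom ħ i F) = shiftHom ħ i (pderiv 𝕜 (Sum.inl 1) F) := by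
  rw [shiftHom_apply, shiftHom_apply]
  refine pderiv_subst_of_single (hasSubst_shiftArg ħ i) _ (Sum.inl 1) ?_ ?_ F
  · simp only [shiftArg, Sum.elim_inl, addTimes, map_add]
    rw [pderiv_powerSumTimes_eq_zero ħ _ fun _ => pderiv_inl_inr i, pderiv_X_self, add_zero]
  · rintro (k | j) hk
    · simp only [shiftArg, Sum.elim_inl, addTimes, map_add]
      rw [pderiv_powerSumTimes_eq_zero ħ _ fun _ => pderiv_inl_inr i, pderiv_X_of_ne hk, add_zero]
    · exact pderiv_inl_inr j

/-- The specialisation `w_0 ↦ w_i`, `w_1 ↦ w_j`, `w_2 ↦ 0`. -/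
def specArg (i j : ℕ) : ℕ+ ⊕ Fin 3 → MvPowerSeries (ℕ+ ⊕ ℕ) 𝕜 :=
  Sum.elim (fun k => X (Sum.inl k)) ![X (Sum.inr i), X (Sum.inr j), 0]

theorem hasSubst_specArg (i j : ℕ) : HasSubst (specArg (𝕜 := 𝕜) i j) := by
  refine hasSubst_sumElim (hasSubst_X_comp Sum.inl_injective) ?_
  refine hasSubst_of_constantCoeff_zero fun l => ?_
  fin_cases l <;> simp

/-- Setting `w_2 = 0` only sees the coefficients of order `0` in `w_2`. -/
theorem subst_specArg_congr (i j : ℕ) {F G : MvPowerSeries (ℕ+ ⊕ Fin 3) 𝕜}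
    (h : ∀ d : ℕ+ ⊕ Fin 3 →₀ ℕ, d (Sum.inr 2) = 0 → coeff d F = coeff d G) :
    subst (specArg i j) F = subst (specArg (𝕜 := 𝕜) i j) G := by
  have hs := hasSubst_specArg (𝕜 := 𝕜) i j
  ext e
  rw [coeff_subst hs, coeff_subst hs]
  refine finsum_congr fun d => ?_
  by_cases hd : d (Sum.inr 2) = 0
  · rw [h d hd]
  · have h0 : (d.prod fun s n => specArg (𝕜 := 𝕜) i j s ^ n) = 0 := by
      refine Finset.prod_eq_zero (i := Sum.inr 2) (Finsupp.mem_support_iff.mpr hd) ?_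
      change specArg (𝕜 := 𝕜) i j (Sum.inr 2) ^ d (Sum.inr 2) = 0
      rw [show specArg (𝕜 := 𝕜) i j (Sum.inr 2) = 0 from rfl, zero_pow hd]
    rw [h0, map_zero, smul_zero, smul_zero]

theorem pderiv_shiftedTime [CharZero 𝕜] (ħ : 𝕜) (s : Finset (Fin 3)) (k : ℕ) :
    pderiv 𝕜 (Sum.inr 2) (shiftedTime ħ s k.succPNat) =
      if 2 ∈ s then ħ • X (Sum.inr 2) ^ k else 0 := by
  rw [shiftedTime, map_add, map_sum, pderiv_X_of_ne (by simp), zero_add]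
  have h : ∀ l : Fin 3, pderiv 𝕜 (Sum.inr 2) ((ħ / (((k.succPNat : ℕ+) : ℕ) : 𝕜)) •
      invZ 𝕜 l ^ ((k.succPNat : ℕ+) : ℕ)) = if l = 2 then ħ • X (Sum.inr 2) ^ k else 0 := by
    intro l
    rw [Derivation.map_smul, Derivation.leibniz_pow, invZ]
    split_ifs with hl
    · subst hl
      rw [pderiv_X_self, Nat.succPNat_coe, ← Nat.cast_smul_eq_nsmul 𝕜, smul_smul,
        Nat.succ_eq_add_one, div_mul_cancel₀ _ (Nat.cast_ne_zero.mpr (Nat.succ_ne_zero k))]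
      simp
    · rw [pderiv_X_of_ne (by simpa using hl)]; simp
  rw [Finset.sum_congr rfl fun l _ => h l, Finset.sum_ite_eq']

/-- The part of `∂_{w_2} T(t + ħ [w_2] + …)` at `w_2 = 0` is `ħ ∂_1 T(t + …)`. -/
theorem spec_pderiv_miwa [CharZero 𝕜] (ħ : 𝕜) (i j : ℕ) (s : Finset (Fin 3))
    (T : MvPowerSeries ℕ+ 𝕜) :
    subst (specArg i j) (pderiv 𝕜 (Sum.inr 2) (miwa ħ s T)) =
      if 2 ∈ s then ħ • subst (specArg (𝕜 := 𝕜) i j) (miwa ħ s (pderiv 𝕜 1 T)) else 0 := by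
  have hs := hasSubst_specArg (𝕜 := 𝕜) i j
  have key : subst (specArg i j) (pderiv 𝕜 (Sum.inr 2) (miwa ħ s T)) =
      subst (specArg (𝕜 := 𝕜) i j)
        ((if 2 ∈ s then ħ • (1 : MvPowerSeries (ℕ+ ⊕ Fin 3) 𝕜) else 0) *
          miwa ħ s (pderiv 𝕜 1 T)) := by
    refine subst_specArg_congr i j fun d hd => ?_
    have h1 : pderiv 𝕜 (Sum.inr 2) (shiftedTime ħ s 1) =
        if 2 ∈ s then ħ • (1 : MvPowerSeries (ℕ+ ⊕ Fin 3) 𝕜) else 0 := by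
      have := pderiv_shiftedTime ħ s 0
      rwa [pow_zero] at this
    rw [miwa, coeff_pderiv_subst (hasSubst_shiftedTime ħ s) _ d {1}]
    · rw [Finset.sum_singleton, h1]; rfl
    · intro k hk d' hd'
      rw [← PNat.succPNat_natPred k, pderiv_shiftedTime]
      split_ifs
      · rw [coeff_smul, X_pow_eq, coeff_monomial, if_neg, mul_zero]
        intro hcon
        have h2 := hd' (Sum.inr 2)
        rw [hd, hcon, Finsupp.single_eq_same] at h2
        apply hk
        rw [Finset.mem_singleton, ← PNat.succPNat_natPred k, Nat.le_zero.mp h2]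
        rfl
      · exact map_zero _
  rw [key, subst_mul hs]
  split_ifs
  · rw [subst_smul hs, ← coe_substAlgHom hs, map_one, smul_mul_assoc, one_mul]
  · rw [← coe_substAlgHom hs, map_zero, zero_mul]

theorem spec_miwa (ħ : 𝕜) (i j : ℕ) (s : Finset (Fin 3)) (T : MvPowerSeries ℕ+ 𝕜) :
    subst (specArg i j) (miwa ħ s T) = subst (fun k : ℕ+ => X (Sum.inl k) +
      ∑ l ∈ s, (ħ / ((k : ℕ) : 𝕜)) • (![X (Sum.inr i), X (Sum.inr j), 0] l :
        MvPowerSeries (ℕ+ ⊕ ℕ) 𝕜) ^ (k : ℕ)) T := by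
  have hs := hasSubst_specArg (𝕜 := 𝕜) i j
  rw [miwa, subst_comp_subst_apply (hasSubst_shiftedTime ħ s) hs]
  congr 1
  funext k
  rw [shiftedTime, ← coe_substAlgHom hs, map_add, map_sum, substAlgHom_X]
  congr 1
  refine Finset.sum_congr rfl fun l _ => ?_
  rw [map_smul, map_pow, invZ, substAlgHom_X]
  rfl

theorem shiftHom_inclTimes (ħ : 𝕜) (i : ℕ) (T : MvPowerSeries ℕ+ 𝕜) :
    shiftHom ħ i (inclTimes T) = subst (fun k : ℕ+ => X (Sum.inl k) +
      (ħ / ((k : ℕ) : 𝕜)) • (X (Sum.inr i) : MvPowerSeries (ℕ+ ⊕ ℕ) 𝕜) ^ (k : ℕ)) T := by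
  rw [inclTimes, shiftHom_subst ħ i (hasSubst_X_comp Sum.inl_injective)]
  simp only [shiftHom_inl]

theorem shiftHom_shiftHom_inclTimes (ħ : 𝕜) (i j : ℕ) (T : MvPowerSeries ℕ+ 𝕜) :
    shiftHom ħ i (shiftHom ħ j (inclTimes T)) = subst (fun k : ℕ+ => X (Sum.inl k) +
      ((ħ / ((k : ℕ) : 𝕜)) • (X (Sum.inr i) : MvPowerSeries (ℕ+ ⊕ ℕ) 𝕜) ^ (k : ℕ) +
      (ħ / ((k : ℕ) : 𝕜)) • (X (Sum.inr j) : MvPowerSeries (ℕ+ ⊕ ℕ) 𝕜) ^ (k : ℕ))) T := by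
  have h : HasSubst (fun k : ℕ+ => X (Sum.inl k) +
      (ħ / ((k : ℕ) : 𝕜)) • (X (Sum.inr j) : MvPowerSeries (ℕ+ ⊕ ℕ) 𝕜) ^ (k : ℕ)) := by
    have := hasSubst_addTimes ħ (u := fun _ : Unit => (X (Sum.inr j) :
      MvPowerSeries (ℕ+ ⊕ ℕ) 𝕜)) fun _ => constantCoeff_X _
    convert this using 2
    simp [addTimes, powerSumTimes]
  rw [shiftHom_inclTimes, shiftHom_subst ħ i h]
  simp only [map_add, map_smul, map_pow, shiftHom_inl, shiftHom_inr, add_assoc]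

theorem pderiv_inclTimes (T : MvPowerSeries ℕ+ 𝕜) :
    pderiv 𝕜 (Sum.inl 1) (inclTimes T) = inclTimes (pderiv 𝕜 1 T) := by
  refine pderiv_subst_of_single (hasSubst_X_comp Sum.inl_injective) _ 1 pderiv_X_self ?_ T
  intro k hk
  exact pderiv_X_of_ne (by simpa using hk)

/-- The two-point formula: the limit `z_3 → ∞` of the Hirota equation. -/
theorem IsTauFunction.fay [CharZero 𝕜] {ħ : 𝕜} {T : MvPowerSeries ℕ+ 𝕜} (h : IsTauFunction ħ T)
    (i j : ℕ) :
    (X (Sum.inr j) - X (Sum.inr i)) * shiftHom ħ i (shiftHom ħ j (inclTimes T)) * inclTimes T =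
      X (Sum.inr j) * waveOp (pderiv 𝕜 (Sum.inl 1)) ħ (X (Sum.inr i)) (shiftHom ħ i (inclTimes T)) *
        shiftHom ħ j (inclTimes T) -
      X (Sum.inr i) * shiftHom ħ i (inclTimes T) *
        waveOp (pderiv 𝕜 (Sum.inl 1)) ħ (X (Sum.inr j)) (shiftHom ħ j (inclTimes T)) := by
  have hs := hasSubst_specArg (𝕜 := 𝕜) i j
  have hz : ∀ k : ℕ+, (0 : MvPowerSeries (ℕ+ ⊕ ℕ) 𝕜) ^ (k : ℕ) = 0 := fun k => zero_pow k.ne_zero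
  have m01 : ∀ T, subst (specArg i j) (miwa ħ {0, 1} T) =
      shiftHom ħ i (shiftHom ħ j (inclTimes T)) := fun T => by
    rw [spec_miwa, shiftHom_shiftHom_inclTimes]
    congr 1; funext k
    rw [Finset.sum_pair (by decide)]; rfl
  have m2 : subst (specArg i j) (miwa ħ {2} T) = inclTimes T := by
    rw [spec_miwa, inclTimes]
    congr 1; funext k
    simp [hz]
  have m12 : ∀ T, subst (specArg i j) (miwa ħ {1, 2} T) = shiftHom ħ j (inclTimes T) := fun T => by
    rw [spec_miwa, shiftHom_inclTimes]
    congr 1; funext k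
    rw [Finset.sum_pair (by decide)]
    simp [hz]
  have m20 : ∀ T, subst (specArg i j) (miwa ħ {2, 0} T) = shiftHom ħ i (inclTimes T) := fun T => by
    rw [spec_miwa, shiftHom_inclTimes]
    congr 1; funext k
    rw [Finset.sum_pair (by decide)]
    simp [hz]
  have m0 : subst (specArg i j) (miwa ħ {0} T) = shiftHom ħ i (inclTimes T) := by
    rw [spec_miwa, shiftHom_inclTimes]
    congr 1; funext k
    simp
  have m1 : subst (specArg i j) (miwa ħ {1} T) = shiftHom ħ j (inclTimes T) := by
    rw [spec_miwa, shiftHom_inclTimes]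
    congr 1; funext k
    simp
  have d : ∀ s, substAlgHom hs (pderiv 𝕜 (Sum.inr 2) (miwa ħ s T)) =
      if 2 ∈ s then ħ • substAlgHom hs (miwa ħ s (pderiv 𝕜 1 T)) else 0 := fun s => by
    rw [coe_substAlgHom, spec_pderiv_miwa]
  have d12 := (d {1, 2}).trans (if_pos (by decide))
  have d20 := (d {2, 0}).trans (if_pos (by decide))
  have d0' := (d {0}).trans (if_neg (by decide))
  have d1' := (d {1}).trans (if_neg (by decide))
  have w0 : substAlgHom hs (invZ 𝕜 0) = X (Sum.inr i) := by rw [invZ, substAlgHom_X]; rfl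
  have w1 : substAlgHom hs (invZ 𝕜 1) = X (Sum.inr j) := by rw [invZ, substAlgHom_X]; rfl
  have w2 : substAlgHom hs (invZ 𝕜 2) = 0 := by rw [invZ, substAlgHom_X]; rfl
  have d0 : pderiv 𝕜 (Sum.inr 2) (invZ 𝕜 0) = 0 := pderiv_X_of_ne (by simp)
  have d1 : pderiv 𝕜 (Sum.inr 2) (invZ 𝕜 1) = 0 := pderiv_X_of_ne (by simp)
  have d2 : pderiv 𝕜 (Sum.inr 2) (invZ 𝕜 2) = 1 := pderiv_X_self
  have hE := congrArg (fun F => substAlgHom hs (pderiv 𝕜 (Sum.inr 2) F)) h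
  simp only [map_add, map_sub, Derivation.leibniz, smul_eq_mul, map_mul, d0, d1, d2, w0, w1, w2,
    d12, d20, d0', d1', map_zero, map_one, map_neg, mul_zero, zero_mul, add_zero, zero_add, sub_zero,
    zero_sub, mul_one] at hE
  simp only [← coe_substAlgHom hs] at m01 m2 m12 m20 m0 m1
  simp only [m01, m2, m12, m20, m0, m1] at hE
  simp only [waveOp, pderiv_shiftHom, pderiv_inclTimes]
  simp only [MvPowerSeries.smul_eq_C_mul] at hE ⊢
  linear_combination hE

end Fay

/-! ### The Plücker coordinates of a tau-function -/

section Plucker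

open MvPowerSeries

/-- Binomial expansion of `(1 - ħ w ∂) ^ j`; as `∂ w = 0`, the operators `w` and `∂` commute. -/
theorem iterate_waveOp_eq {𝕜 S : Type*} [CommRing 𝕜] [CommRing S] [Algebra 𝕜 S]
    (δ : Derivation 𝕜 S S) (ħ : 𝕜) (w : S) (hw : δ w = 0) (F : S) (j : ℕ) :
    (waveOp δ ħ w)^[j] F = ∑ k ∈ Finset.range (j + 1),
      ((-ħ) ^ k * (Nat.choose j k : 𝕜)) • (w ^ k * δ^[k] F) := by
  let B : Module.End 𝕜 S := (-ħ) • (LinearMap.mulLeft 𝕜 w * (δ : S →ₗ[𝕜] S))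
  have hB : ∀ (k : ℕ) G, (B ^ k) G = (-ħ) ^ k • (w ^ k * δ^[k] G) := by
    intro k
    induction k with
    | zero => intro G; simp
    | succ k ih =>
      intro G
      have hpow : δ (w ^ k) = 0 := by rw [Derivation.leibniz_pow, hw]; simp
      rw [pow_succ', Module.End.mul_apply, ih, map_smul]
      simp only [B, LinearMap.smul_apply, Module.End.mul_apply, LinearMap.mulLeft_apply,
        Derivation.coeFn_coe, Derivation.leibniz, hpow, mul_zero, add_zero, smul_eq_mul, smul_smul]
      rw [Function.iterate_succ_apply', ← mul_assoc, ← pow_succ', ← pow_succ]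
  have h1 : ∀ (j : ℕ) G, (waveOp δ ħ w)^[j] G = ((B + 1) ^ j) G := by
    intro j
    induction j with
    | zero => intro G; rfl
    | succ j ih =>
      intro G
      rw [Function.iterate_succ_apply, ih, pow_succ, Module.End.mul_apply]
      congr 1
      simp [B, waveOp]; ring
  rw [h1, (Commute.one_right B).add_pow, LinearMap.sum_apply]
  refine Finset.sum_congr rfl fun k _ => ?_
  rw [one_pow, mul_one, Module.End.mul_apply, Module.End.natCast_apply, map_nsmul, hB,
    ← Nat.cast_smul_eq_nsmul 𝕜, smul_smul, mul_comm]

variable {𝕜 : Type*} [Field 𝕜]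

theorem iterShift_inclTimes (ħ : 𝕜) (m : ℕ) (T : MvPowerSeries ℕ+ 𝕜) :
    iterShift (shiftHom ħ) m (inclTimes T) =
      subst (addTimes ħ fun i : Fin m => (X (Sum.inr (i : ℕ)) : MvPowerSeries (ℕ+ ⊕ ℕ) 𝕜)) T := by
  induction m with
  | zero =>
    rw [iterShift, AlgHom.id_apply, inclTimes]
    congr 1; funext k
    simp [addTimes, powerSumTimes]
  | succ m ih =>
    rw [iterShift, AlgHom.comp_apply, ih,
      shiftHom_subst ħ m (hasSubst_addTimes ħ fun _ => constantCoeff_X _)]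
    congr 1
    funext k
    simp only [addTimes, powerSumTimes, map_add, map_smul, map_sum, map_pow, shiftHom_inl,
      shiftHom_inr, Fin.sum_univ_castSucc, smul_add, Fin.val_castSucc, Fin.val_last]
    ring

/-- The point `t = 0`, `w = (w_0, …, w_{m - 1}, 0, 0, …)`. -/
def originArg (𝕜 : Type*) [Field 𝕜] (m : ℕ) : ℕ+ ⊕ ℕ → MvPowerSeries (Fin m) 𝕜 :=
  Sum.elim (fun _ => 0) fun i => if h : i < m then X ⟨i, h⟩ else 0

theorem hasSubst_originArg (m : ℕ) : HasSubst (originArg 𝕜 m) := by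
  constructor
  · rintro (k | i)
    · simp [originArg]
    · simp only [originArg, Sum.elim_inr]
      split_ifs <;> simp
  · intro d
    refine ((Set.finite_Iio m).image Sum.inr).subset ?_
    rintro (k | i) hi
    · exact absurd (map_zero _) hi
    · refine ⟨i, ?_, rfl⟩
      by_contra hcon
      apply hi
      simp only [Set.mem_Iio] at hcon
      simp [originArg, hcon]

theorem subst_zero_arg {ι τ : Type*} (T : MvPowerSeries ι 𝕜) :
    subst (fun _ => (0 : MvPowerSeries τ 𝕜)) T = C (constantCoeff T) := by
  classical
  have h : HasSubst (fun _ : ι => (0 : MvPowerSeries τ 𝕜)) := by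
    constructor
    · simp
    · intro d; simp
  ext e
  rw [coeff_subst h, finsum_eq_single _ 0]
  · simp [coeff_C, coeff_one]
  · intro d hd
    obtain ⟨i, hi⟩ := Finsupp.support_nonempty_iff.mpr hd
    rw [Finsupp.prod, Finset.prod_eq_zero hi (zero_pow (Finsupp.mem_support_iff.mp hi))]
    simp

/-- The Plücker coordinates of a tau-function in terms of the one-row ones of its `∂_1`-derivatives:
the coefficients of the Wronskian formula at `t = 0`. -/
theorem IsTauFunction.pairing_det [CharZero 𝕜] {ħ : 𝕜} {T : MvPowerSeries ℕ+ 𝕜}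
    (h : IsTauFunction ħ T) (h0 : constantCoeff T ≠ 0) {m : ℕ} (p : Fin m → ℤ)
    (hp : ∀ i, 0 ≤ p i + ((m : ℤ) - 1)) :
    pairing T (Matrix.det (Matrix.of fun i j : Fin m => opSchur ħ (p i + (j : ℕ)))) *
      constantCoeff T ^ m =
    constantCoeff T * Matrix.det (Matrix.of fun i j : Fin m => ∑ k ∈ Finset.range ((j : ℕ) + 1),
      (-ħ) ^ k * (Nat.choose j k : 𝕜) *
        pairing ((pderiv 𝕜 1)^[k] T) (opSchur ħ (p i + (j : ℕ) - (k : ℕ)))) := by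
  have : IsDomain (MvPowerSeries (ℕ+ ⊕ ℕ) 𝕜) := NoZeroDivisors.to_isDomain _
  have hs := hasSubst_originArg (𝕜 := 𝕜) m
  have hX0 : ∀ i : ℕ, (X (Sum.inr i) : MvPowerSeries (ℕ+ ⊕ ℕ) 𝕜) ≠ 0 := fun i hi => by
    have h1 := congrArg (coeff (Finsupp.single (Sum.inr i) 1)) hi
    rw [coeff_index_single_self_X, map_zero] at h1
    exact one_ne_zero h1
  have hinl : ∀ k : ℕ+, substAlgHom (R := 𝕜) hs (X (Sum.inl k)) = 0 := fun k => by
    rw [substAlgHom_X]; rfl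
  have hinr : ∀ i : Fin m, substAlgHom (R := 𝕜) hs (X (Sum.inr (i : ℕ))) = X i := fun i => by
    rw [substAlgHom_X]; simp [originArg]
  have hincl : substAlgHom (R := 𝕜) hs (inclTimes T) = C (constantCoeff T) := by
    rw [← subst_zero_arg, coe_substAlgHom, inclTimes,
      subst_comp_subst_apply (hasSubst_X_comp Sum.inl_injective) hs]
    congr 1; funext k
    rw [← coe_substAlgHom hs, hinl]
  have hT : IsUnit (inclTimes T) := by
    rw [isUnit_iff_constantCoeff]
    refine IsUnit.mk0 _ ?_
    have hc : constantCoeff (inclTimes T) = constantCoeff T := by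
      have hs0 : HasSubst (fun _ : ℕ+ ⊕ ℕ => (0 : MvPowerSeries Unit 𝕜)) := by
        constructor
        · simp
        · intro d; simp
      have h1 := subst_comp_subst_apply (hasSubst_X_comp (𝕜 := 𝕜) (τ := ℕ+ ⊕ ℕ)
        Sum.inl_injective) hs0 T
      rw [subst_zero_arg] at h1
      simp only [subst_X hs0] at h1
      rw [subst_zero_arg] at h1
      exact C_injective h1
    rwa [hc]
  have hW := prod_mul_iterShift (pderiv 𝕜 (Sum.inl 1)) ħ (fun i => X (Sum.inr i))
    pderiv_inl_inr hX0 (shiftHom ħ) (shiftHom_inr ħ) (pderiv_shiftHom ħ) (shiftHom_comm ħ)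
    (inclTimes T) hT (fun i j _ => h.fay i j) m
  rw [prod_sub_eq_det _ hX0, iterShift_inclTimes] at hW
  have hW' := congrArg (substAlgHom (R := 𝕜) hs) hW
  have hmiwa : substAlgHom (R := 𝕜) hs (subst (addTimes ħ fun i : Fin m =>
      (X (Sum.inr (i : ℕ)) : MvPowerSeries (ℕ+ ⊕ ℕ) 𝕜)) T) = miwaPoint ħ m T := by
    rw [coe_substAlgHom, subst_comp_subst_apply (hasSubst_addTimes ħ fun _ => constantCoeff_X _) hs,
      miwaPoint]
    congr 1; funext k
    rw [← coe_substAlgHom hs]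
    simp only [addTimes, powerSumTimes, map_add, map_smul, map_sum, map_pow, hinl, hinr, zero_add]
  have hvan : substAlgHom (R := 𝕜) hs (Matrix.det (Matrix.of fun i j : Fin m =>
      (X (Sum.inr (i : ℕ)) : MvPowerSeries (ℕ+ ⊕ ℕ) 𝕜) ^ (m - 1 - (j : ℕ)))) = vandet 𝕜 m := by
    rw [AlgHom.map_det, vandet]
    congr 1; ext1 i j
    simp only [AlgHom.mapMatrix_apply, Matrix.map_apply, Matrix.of_apply, map_pow, hinr]
  have hone : ∀ (i : Fin m) F, substAlgHom (R := 𝕜) hs (shiftHom ħ i (inclTimes F)) =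
      oneVar i (fun n => pairing F (opSchur ħ n)) := by
    intro i F
    have h2 : HasSubst (addTimes ħ fun _ : Unit =>
      (X (Sum.inr (i : ℕ)) : MvPowerSeries (ℕ+ ⊕ ℕ) 𝕜)) :=
      hasSubst_addTimes ħ fun _ => constantCoeff_X _
    rw [← subst_powerSumTimes_unit, shiftHom_inclTimes]
    have h3 : (fun k : ℕ+ => X (Sum.inl k) + (ħ / ((k : ℕ) : 𝕜)) •
        (X (Sum.inr (i : ℕ)) : MvPowerSeries (ℕ+ ⊕ ℕ) 𝕜) ^ (k : ℕ)) =
        addTimes ħ fun _ : Unit => (X (Sum.inr (i : ℕ)) : MvPowerSeries (ℕ+ ⊕ ℕ) 𝕜) := by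
      funext k; simp [addTimes, powerSumTimes]
    rw [h3, coe_substAlgHom, subst_comp_subst_apply h2 hs]
    congr 1; funext k
    rw [← coe_substAlgHom hs]
    simp only [addTimes, powerSumTimes, map_add, map_smul, map_sum, map_pow, hinl, hinr, zero_add]
  have hder : ∀ (i k : ℕ) F, (pderiv 𝕜 (Sum.inl 1))^[k] (shiftHom ħ i (inclTimes F)) =
      shiftHom ħ i (inclTimes ((pderiv 𝕜 1)^[k] F)) := by
    intro i k
    induction k with
    | zero => intro F; rfl
    | succ k ih =>
      intro F
      rw [Function.iterate_succ_apply, Function.iterate_succ_apply, pderiv_shiftHom,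
        pderiv_inclTimes, ih]
  have hwave : substAlgHom (R := 𝕜) hs (waveMatrix (pderiv 𝕜 (Sum.inl 1)) ħ (fun i => X (Sum.inr i))
      (fun i => shiftHom ħ i (inclTimes T)) m).det =
      Matrix.det (Matrix.of fun i j : Fin m => oneVar i fun n => ∑ k ∈ Finset.range ((j : ℕ) + 1),
        (-ħ) ^ k * (Nat.choose j k : 𝕜) * pairing ((pderiv 𝕜 1)^[k] T)
          (opSchur ħ ((n : ℤ) - (m - 1 - (j : ℕ) + k : ℕ)))) := by
    rw [AlgHom.map_det]
    congr 1; ext1 i j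
    simp only [waveMatrix, AlgHom.mapMatrix_apply, Matrix.map_apply, Matrix.of_apply]
    rw [iterate_waveOp_eq _ _ _ (pderiv_inl_inr _), oneVar_sum]
    simp only [map_mul, map_sum, map_smul, map_pow, hinr, hder, hone, Finset.mul_sum]
    refine Finset.sum_congr rfl fun k _ => ?_
    rw [mul_smul_comm, ← mul_assoc, ← pow_add, X_pow_mul_oneVar i _
      (fun n => pairing ((pderiv 𝕜 1)^[k] T) (opSchur ħ n)) fun n hn => by
        rw [opSchur_of_neg ħ hn, map_zero], ← oneVar_smul]
  rw [map_mul, map_mul, map_mul, map_pow, hmiwa, hvan, hincl, hwave, ← map_pow] at hW'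
  set n : Fin m →₀ ℕ := Finsupp.equivFunOnFinite.symm fun i => (p i + ((m : ℤ) - 1)).toNat with hn
  have hpn : ∀ i, p i = (n i : ℤ) - ((m : ℤ) - 1) := fun i => by
    rw [hn, Finsupp.equivFunOnFinite_symm_apply_apply, Int.toNat_of_nonneg (hp i)]; ring
  have hc := congrArg (coeff n) hW'
  rw [mul_comm _ (C _), coeff_C_mul, coeff_C_mul, coeff_vandet_mul_miwaPoint, coeff_det_oneVar] at hc
  have hidx : ∀ (i j : Fin m) (k : ℕ), p i + (j : ℕ) - (k : ℤ) =
      (n i : ℤ) - (m - 1 - (j : ℕ) + k : ℕ) := by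
    intro i j k
    have := j.2
    rw [hpn]
    push_cast
    omega
  simp only [hidx]
  simp only [hpn]
  rw [mul_comm]
  exact hc

end Plucker

/-! ### Multiplication by a function of `x` -/

section Gauge

variable {𝕜 : Type*} [Field 𝕜]

/-- The determinants in the statement are multiplied by `g ^ m` when all functions are multiplied by
`g`; here `γ` and `a` stand for the sequences of derivatives at a point. -/
theorem det_leibniz (ħ : 𝕜) (γ : ℕ → 𝕜) (a : ℕ → ℤ → 𝕜) {m : ℕ} (p : Fin m → ℤ) :
    Matrix.det (Matrix.of fun i j : Fin m => ∑ k ∈ Finset.range ((j : ℕ) + 1),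
      (-ħ) ^ k * (Nat.choose j k : 𝕜) * ∑ l ∈ Finset.range (k + 1),
        (Nat.choose k l : 𝕜) * γ l * a (k - l) (p i + (j : ℕ) - (k : ℕ))) =
    γ 0 ^ m * Matrix.det (Matrix.of fun i j : Fin m => ∑ k ∈ Finset.range ((j : ℕ) + 1),
      (-ħ) ^ k * (Nat.choose j k : 𝕜) * a k (p i + (j : ℕ) - (k : ℕ))) := by
  let N : ℕ → ℤ → 𝕜 := fun j q => ∑ k ∈ Finset.range (j + 1),
    (-ħ) ^ k * (Nat.choose j k : 𝕜) * a k (q + (j : ℕ) - (k : ℕ))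
  let K : Matrix (Fin m) (Fin m) 𝕜 := Matrix.of fun l j =>
    if (l : ℕ) ≤ j then (-ħ) ^ ((j : ℕ) - l) * (Nat.choose j l : 𝕜) * γ (j - l) else 0
  have hK : K.det = γ 0 ^ m := by
    rw [Matrix.det_of_isUpperTriangular]
    · simp [K]
    · intro i j hij
      have : ¬ (i : ℕ) ≤ j := by simpa using hij
      simp only [K, Matrix.of_apply, if_neg this]
  have hentry : ∀ (j : ℕ) (q : ℤ), ∑ k ∈ Finset.range (j + 1),
      (-ħ) ^ k * (Nat.choose j k : 𝕜) * ∑ l ∈ Finset.range (k + 1),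
        (Nat.choose k l : 𝕜) * γ l * a (k - l) (q + (j : ℕ) - (k : ℕ)) =
      ∑ l ∈ Finset.range (j + 1), N l q * ((-ħ) ^ (j - l) * (Nat.choose j l : 𝕜) * γ (j - l)) := by
    intro j q
    have h1 : ∑ l ∈ Finset.range (j + 1), N l q *
        ((-ħ) ^ (j - l) * (Nat.choose j l : 𝕜) * γ (j - l)) =
        ∑ l ∈ Finset.range (j + 1), ∑ k ∈ Finset.range (j - l + 1),
          (-ħ) ^ (l + k) * ((Nat.choose j (l + k) : 𝕜) * (Nat.choose (l + k) l : 𝕜)) * γ l *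
            a k (q + (j : ℕ) - ((l + k : ℕ) : ℤ)) := by
      rw [← Finset.sum_range_reflect]
      refine Finset.sum_congr rfl fun l hl => ?_
      have hl' : l ≤ j := by simpa [Nat.lt_succ_iff] using hl
      have e1 : j + 1 - 1 - l = j - l := by omega
      have e2 : j - (j - l) = l := by omega
      simp only [e1, e2, N, Finset.sum_mul]
      refine Finset.sum_congr rfl fun k hk => ?_
      have hk' : k ≤ j - l := by simpa [Nat.lt_succ_iff] using hk
      have e3 : Nat.choose j (l + k) * Nat.choose (l + k) l =
          Nat.choose j l * Nat.choose (j - l) k := by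
        rw [Nat.choose_mul (Nat.le_add_right l k), Nat.add_sub_cancel_left]
      have e4 : q + ((j - l : ℕ) : ℤ) - (k : ℤ) = q + (j : ℤ) - ((l + k : ℕ) : ℤ) := by
        push_cast [Nat.cast_sub hl']; ring
      rw [e4, ← Nat.cast_mul, e3, Nat.choose_symm hl', pow_add, Nat.cast_mul]
      ring
    rw [h1]
    simp only [Finset.mul_sum]
    rw [Finset.sum_sigma', Finset.sum_sigma']
    refine Finset.sum_bij' (fun x _ => ⟨x.2, x.1 - x.2⟩) (fun x _ => ⟨x.1 + x.2, x.1⟩) ?_ ?_ ?_ ?_ ?_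
    · rintro ⟨k, l⟩ h
      simp only [Finset.mem_sigma, Finset.mem_range] at h ⊢
      omega
    · rintro ⟨l, k⟩ h
      simp only [Finset.mem_sigma, Finset.mem_range] at h ⊢
      omega
    · rintro ⟨k, l⟩ h
      simp only [Finset.mem_sigma, Finset.mem_range] at h
      have : l + (k - l) = k := by omega
      simp only [this]
    · rintro ⟨l, k⟩ h
      have : l + k - l = k := by omega
      simp only [this]
    · rintro ⟨k, l⟩ h
      simp only [Finset.mem_sigma, Finset.mem_range] at h
      have : l + (k - l) = k := by omega
      simp only [this]
      ring
  rw [mul_comm, ← hK, ← Matrix.det_mul]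
  congr 1
  ext1 i j
  rw [Matrix.mul_apply]
  simp only [Matrix.of_apply, K]
  rw [hentry]
  have h2 := Finset.sum_range (n := m) fun l => N l (p i) *
    (if l ≤ (j : ℕ) then (-ħ) ^ ((j : ℕ) - l) * (Nat.choose j l : 𝕜) * γ (j - l) else 0)
  refine Eq.trans ?_ h2
  rw [← Finset.sum_subset (Finset.range_mono (Nat.succ_le_of_lt j.2)) fun l _ hl => by
    rw [if_neg (by simpa using hl), mul_zero]]
  refine Finset.sum_congr rfl fun l hl => ?_
  rw [if_pos (by simpa [Nat.lt_succ_iff] using hl)]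

end Gauge

/-! ### Series with smooth coefficients -/

section Smooth

open MvPowerSeries

variable {𝕜 : Type*} [RCLike 𝕜]

theorem contDiffOn_iteratedDeriv {g : ℝ → 𝕜} {U : Set ℝ} (hU : IsOpen U) (hg : ContDiffOn ℝ ∞ g U)
    (k : ℕ) : ContDiffOn ℝ ∞ (iteratedDeriv k g) U := by
  induction k with
  | zero => simpa using hg
  | succ k ih =>
    rw [iteratedDeriv_succ]
    exact ih.deriv_of_isOpen hU (by simp)

theorem coeff_taylorShift (τhat : ℝ → MvPowerSeries {k : ℕ+ // k ≠ 1} 𝕜) (x : ℝ) (d : ℕ+ →₀ ℕ) :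
    coeff d (taylorShift τhat x) = iteratedDeriv (d 1)
      (fun y => coeff (d.subtypeDomain fun k : ℕ+ => k ≠ 1) (τhat y)) x / ((d 1)! : 𝕜) := rfl

theorem SmoothCoeffsOn.taylorShift {τhat : ℝ → MvPowerSeries {k : ℕ+ // k ≠ 1} 𝕜} {U : Set ℝ}
    (hU : IsOpen U) (h : SmoothCoeffsOn τhat U) : SmoothCoeffsOn (taylorShift τhat) U := by
  intro d
  simp only [coeff_taylorShift]
  exact (contDiffOn_iteratedDeriv hU (h _) _).div_const _

/-- The dependence on `x + t_1` only: `∂_1` acts on the Taylor-expanded series as `∂_x`. -/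
theorem coeff_pderiv_taylorShift (τhat : ℝ → MvPowerSeries {k : ℕ+ // k ≠ 1} 𝕜) (x : ℝ)
    (d : ℕ+ →₀ ℕ) : coeff d (pderiv 𝕜 1 (taylorShift τhat x)) =
      deriv (fun y => coeff d (taylorShift τhat y)) x := by
  have h1 : (d + Finsupp.single (1 : ℕ+) 1 : ℕ+ →₀ ℕ) 1 = d 1 + 1 := by simp
  have h2 : (d + Finsupp.single 1 1).subtypeDomain (fun k : ℕ+ => k ≠ 1) =
      d.subtypeDomain fun k : ℕ+ => k ≠ 1 := by
    ext k
    simp [k.2.symm]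
  rw [coeff_pderiv]
  simp only [coeff_taylorShift, h1, h2]
  rw [deriv_div_const, ← iteratedDeriv_succ, Nat.factorial_succ]
  have h3 : ((d 1)! : 𝕜) ≠ 0 := Nat.cast_ne_zero.mpr (Nat.factorial_ne_zero _)
  have h4 : ((d 1 : 𝕜) + 1) ≠ 0 := by exact_mod_cast Nat.succ_ne_zero (d 1)
  push_cast
  field_simp

theorem coeff_iterate_pderiv_taylorShift (τhat : ℝ → MvPowerSeries {k : ℕ+ // k ≠ 1} 𝕜) (k : ℕ)
    (x : ℝ) (d : ℕ+ →₀ ℕ) : coeff d ((pderiv 𝕜 1)^[k] (taylorShift τhat x)) =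
      iteratedDeriv k (fun y => coeff d (taylorShift τhat y)) x := by
  induction k generalizing d with
  | zero => simp
  | succ k ih =>
    rw [Function.iterate_succ_apply', coeff_pderiv, ih, mul_comm, ← iteratedDeriv_const_mul_field,
      iteratedDeriv_succ']
    congr 1
    funext y
    rw [← coeff_pderiv_taylorShift, coeff_pderiv, mul_comm]

theorem SmoothCoeffsOn.pairing {T : ℝ → MvPowerSeries ℕ+ 𝕜} {U : Set ℝ} (h : SmoothCoeffsOn T U)
    (q : MvPolynomial ℕ+ 𝕜) : ContDiffOn ℝ ∞ (fun y => pairing (T y) q) U := by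
  simp only [pairing_eq_sum]
  exact ContDiffOn.sum fun e _ => contDiffOn_const.mul (h e)

theorem pairing_iterate_pderiv_taylorShift {τhat : ℝ → MvPowerSeries {k : ℕ+ // k ≠ 1} 𝕜}
    {U : Set ℝ} (hU : IsOpen U) (h : SmoothCoeffsOn τhat U) {x : ℝ} (hx : x ∈ U) (k : ℕ)
    (q : MvPolynomial ℕ+ 𝕜) : pairing ((pderiv 𝕜 1)^[k] (taylorShift τhat x)) q =
      iteratedDeriv k (fun y => pairing (taylorShift τhat y) q) x := by
  simp only [pairing_eq_sum]
  rw [iteratedDeriv_fun_sum]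
  · refine Finset.sum_congr rfl fun e _ => ?_
    rw [coeff_iterate_pderiv_taylorShift, iteratedDeriv_const_mul_field]
  · intro e _
    exact (contDiffAt_const.mul (((h.taylorShift hU) e).contDiffAt (hU.mem_nhds hx))).of_le
      (by exact_mod_cast le_top)

theorem extendZero_natCast (c : ℕ → ℝ → 𝕜) (n : ℕ) : extendZero c (n : ℤ) = c n := rfl

theorem extendZero_of_neg (c : ℕ → ℝ → 𝕜) {n : ℤ} (h : n < 0) : extendZero c n = 0 := by
  obtain ⟨k, rfl⟩ := Int.eq_negSucc_of_lt_zero h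
  rfl

end Smooth

/-! ### The coefficients of a tau-function -/

section DirectPart

open MvPowerSeries

variable {𝕜 : Type*} [RCLike 𝕜]

theorem opSchur_one (ħ : 𝕜) : opSchur ħ 1 = ħ • MvPolynomial.X 1 := by
  have h := natCast_mul_opSchur ħ 1
  simpa [opSchur_zero, show Nat.succPNat 0 = 1 from rfl] using h

theorem schurOp_bot (ħ : 𝕜) : schurOp ħ ⊥ = 1 := by
  rw [← rowDiagram_zero, schurOp_rowDiagram, Nat.cast_zero, opSchur_zero]

/-- A tau-function that depends on `x` through `x + t_1`, up to a factor `f x`, has the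
determinants of its one-row coefficients as Schur coefficients. As `∂_1` acts on `τ / f` as `∂_x`,
the entries in `IsTauFunction.pairing_det` are `f` times `x`-derivatives for `τ / f`; `det_leibniz`
turns them into those for `τ`. -/
theorem eq_detCoeff_of_isTauFunction {ħ : 𝕜} (hħ : ħ ≠ 0) {U : Set ℝ} (hU : IsOpen U)
    {f : ℝ → 𝕜} {τhat : ℝ → MvPowerSeries {k : ℕ+ // k ≠ 1} 𝕜} {τ : ℝ → MvPowerSeries ℕ+ 𝕜}
    (hsm : SmoothCoeffsOn τhat U) (hτ : ∀ x ∈ U, τ x = f x • taylorShift τhat x)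
    (htau : ∀ x ∈ U, IsTauFunction ħ (τ x))
    (h0 : ContDiffOn ℝ ∞ (fun x => constantCoeff (τ x)) U) {c : YoungDiagram → ℝ → 𝕜}
    (hc : ∀ x ∈ U, IsSchurExpansion ħ (fun lam => c lam x) (τ x)) {x : ℝ} (hx : x ∈ U)
    (hcx : c ⊥ x ≠ 0) :
    f x ≠ 0 ∧ DifferentiableAt ℝ f x ∧ (∀ lam, ContDiffAt ℝ ∞ (c lam) x) ∧
      ∀ lam, c lam x = detCoeff ħ (fun k => c (rowDiagram k)) lam x := by
  have hnhds := hU.mem_nhds hx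
  have hpair : ∀ y ∈ U, ∀ lam, c lam y = f y * pairing (taylorShift τhat y) (schurOp ħ lam) := by
    intro y hy lam
    rw [← pairing_smul, ← hτ y hy, (hc y hy).pairing_eq hħ]
  have hC : ∀ q, ContDiffAt ℝ ∞ (fun y => pairing (taylorShift τhat y) q) x := fun q =>
    ((hsm.taylorShift hU).pairing q).contDiffAt hnhds
  have hprod := hpair x hx ⊥
  rw [schurOp_bot] at hprod
  have hfx : f x ≠ 0 := fun h => hcx (by rw [hprod, h, zero_mul])
  have hTx : pairing (taylorShift τhat x) 1 ≠ 0 := fun h => hcx (by rw [hprod, h, mul_zero])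
  have hf : ContDiffAt ℝ ∞ f x := by
    refine ((h0.contDiffAt hnhds).mul ((hC 1).inv hTx)).congr_of_eventuallyEq ?_
    filter_upwards [hnhds, (hC 1).continuousAt.eventually_ne hTx] with y hy hy0
    rw [hτ y hy, ← pairing_one, pairing_smul, Pi.inv_apply, mul_inv_cancel_right₀ hy0]
  refine ⟨hfx, hf.differentiableAt (by simp), fun lam => ?_, fun lam => ?_⟩
  · refine (hf.mul (hC (schurOp ħ lam))).congr_of_eventuallyEq ?_
    filter_upwards [hnhds] with y hy
    exact hpair y hy lam
  · set m := numRows lam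
    set p : Fin m → ℤ := fun i => (lam.rowLen i : ℤ) - (i : ℕ)
    have hconst : constantCoeff (τ x) = c ⊥ x := by
      rw [← pairing_one, ← (hc x hx).pairing_eq hħ, schurOp_bot]
    have hA := (htau x hx).pairing_det (by rwa [hconst]) p fun i => by
      have := i.2
      simp only [p]
      omega
    rw [← schurOp_eq_det, (hc x hx).pairing_eq hħ, hconst] at hA
    have hpd : ∀ (k : ℕ) q, pairing ((pderiv 𝕜 1)^[k] (τ x)) q =
        f x * iteratedDeriv k (fun y => pairing (taylorShift τhat y) q) x := by
      intro k q
      rw [← pairing_iterate_pderiv_taylorShift hU hsm hx, ← pairing_smul, hτ x hx]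
      congr 2
      induction k with
      | zero => rfl
      | succ k ih =>
        rw [Function.iterate_succ_apply', ih, Function.iterate_succ_apply', Derivation.map_smul]
    set a : ℕ → ℤ → 𝕜 := fun k n => iteratedDeriv k
      (fun y => pairing (taylorShift τhat y) (opSchur ħ n)) x
    have hext : ∀ (k : ℕ) (n : ℤ), iteratedDeriv k (extendZero (fun k => c (rowDiagram k)) n) x =
        ∑ l ∈ Finset.range (k + 1), (Nat.choose k l : 𝕜) * iteratedDeriv l f x * a (k - l) n := by
      intro k n
      rw [← iteratedDeriv_mul (hf.of_le (by exact_mod_cast le_top))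
        ((hC (opSchur ħ n)).of_le (by exact_mod_cast le_top))]
      refine Filter.EventuallyEq.iteratedDeriv_eq k ?_
      filter_upwards [hnhds] with y hy
      rcases lt_or_ge n 0 with hn | hn
      · rw [extendZero_of_neg _ hn, Pi.mul_apply, opSchur_of_neg ħ hn, map_zero, mul_zero]
        rfl
      · lift n to ℕ using hn
        rw [extendZero_natCast, hpair y hy, schurOp_rowDiagram]
        rfl
    have hL := det_leibniz ħ (fun l => iteratedDeriv l f x) a p
    simp only [← hext] at hL
    rw [iteratedDeriv_zero] at hL
    have hdet : Matrix.det (Matrix.of fun i j : Fin m => ∑ k ∈ Finset.range ((j : ℕ) + 1),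
        (-ħ) ^ k * (Nat.choose j k : 𝕜) * pairing ((pderiv 𝕜 1)^[k] (τ x))
          (opSchur ħ (p i + (j : ℕ) - (k : ℕ)))) =
        f x ^ m * Matrix.det (Matrix.of fun i j : Fin m => ∑ k ∈ Finset.range ((j : ℕ) + 1),
          (-ħ) ^ k * (Nat.choose j k : 𝕜) * a k (p i + (j : ℕ) - (k : ℕ))) := by
      have h1 := Matrix.det_smul (Matrix.of fun i j : Fin m => ∑ k ∈ Finset.range ((j : ℕ) + 1),
          (-ħ) ^ k * (Nat.choose j k : 𝕜) * a k (p i + (j : ℕ) - (k : ℕ))) (f x)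
      rw [Fintype.card_fin] at h1
      rw [← h1]
      congr 1
      ext1 i j
      simp only [Matrix.smul_apply, Matrix.of_apply, smul_eq_mul, Finset.mul_sum, hpd, a]
      exact Finset.sum_congr rfl fun k _ => by ring
    rw [hdet, ← hL] at hA
    have hcm : c ⊥ x ^ m ≠ 0 := pow_ne_zero _ hcx
    rw [detCoeff, rowDiagram_zero, zpow_sub₀ hcx, zpow_one, zpow_natCast]
    change c lam x = c ⊥ x / c ⊥ x ^ m * _
    rw [div_mul_eq_mul_div, eq_div_iff hcm]
    exact hA

/-- The coefficient of the one-box diagram is `ħ ∂_1 τ` at `t = 0`, and `∂_1 τ = f ∂_x (τ / f)`.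
The Hirota equation plays no role. -/
theorem coeff_row_one_eq {ħ : 𝕜} (hħ : ħ ≠ 0) {U : Set ℝ} (hU : IsOpen U)
    {f : ℝ → 𝕜} {τhat : ℝ → MvPowerSeries {k : ℕ+ // k ≠ 1} 𝕜} {τ : ℝ → MvPowerSeries ℕ+ 𝕜}
    (hsm : SmoothCoeffsOn τhat U) (hτ : ∀ x ∈ U, τ x = f x • taylorShift τhat x)
    {c : YoungDiagram → ℝ → 𝕜}
    (hc : ∀ x ∈ U, IsSchurExpansion ħ (fun lam => c lam x) (τ x)) {x : ℝ} (hx : x ∈ U)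
    (hfx : f x ≠ 0) (hf : DifferentiableAt ℝ f x) :
    c (rowDiagram 1) x = ħ * (deriv (c ⊥) x - c ⊥ x * (deriv f x / f x)) := by
  have hnhds := hU.mem_nhds hx
  have hpair : ∀ y ∈ U, ∀ lam, c lam y = f y * pairing (taylorShift τhat y) (schurOp ħ lam) := by
    intro y hy lam
    rw [← pairing_smul, ← hτ y hy, (hc y hy).pairing_eq hħ]
  have hC : DifferentiableAt ℝ (fun y => pairing (taylorShift τhat y) 1) x :=
    (((hsm.taylorShift hU).pairing 1).contDiffAt hnhds).differentiableAt (by simp)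
  have hd : deriv (c ⊥) x = deriv f x * pairing (taylorShift τhat x) 1 +
      f x * deriv (fun y => pairing (taylorShift τhat y) 1) x := by
    rw [← deriv_fun_mul hf hC]
    refine Filter.EventuallyEq.deriv_eq ?_
    filter_upwards [hnhds] with y hy
    rw [hpair y hy, schurOp_bot]
  have h1 : pairing (taylorShift τhat x) (opSchur ħ 1) =
      ħ * deriv (fun y => pairing (taylorShift τhat y) 1) x := by
    have h2 := pairing_iterate_pderiv_taylorShift hU hsm hx 1 1
    rw [Function.iterate_one, iteratedDeriv_one, ← pairing_X_mul, mul_one] at h2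
    rw [opSchur_one, map_smul, smul_eq_mul, h2]
  have h3 := schurOp_rowDiagram ħ 1
  rw [Nat.cast_one] at h3
  rw [hd, hpair x hx, hpair x hx ⊥, schurOp_bot, h3, h1]
  field_simp
  ring

end DirectPart

/-! ### The three-term Plücker relation -/

section ThreeTerm

open Matrix

variable {R n : Type*} [CommRing R] [Fintype n] [DecidableEq n]

/-- Replacing the rows `i` and `j` of a fixed matrix. -/
def twoRows (M : Matrix n n R) (i j : n) (v w : n → R) : R :=
  ((M.updateRow i v).updateRow j w).det

/-- The three-term Plücker relation: apply a functional to Cramer's formula for `c`. -/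
theorem twoRows_mul_twoRows (M : Matrix n n R) {i j : n} (hij : i ≠ j) (a b c e : n → R) :
    twoRows M i j a b * twoRows M i j c e =
      twoRows M i j c b * twoRows M i j a e + twoRows M i j a c * twoRows M i j b e := by
  set A := (M.updateRow i a).updateRow j b with hA
  set B := M.updateRow j e with hB
  have hlin : ∀ v, twoRows M i j v e = cramer Bᵀ v i := by
    intro v
    rw [cramer_transpose_apply, twoRows, updateRow_comm M hij, hB]
  have hc := mulVec_cramer Aᵀ c
  rw [det_transpose, mulVec_eq_sum] at hc
  have h1 := congrArg (fun v => cramer Bᵀ v i) hc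
  simp only [map_sum, map_smul, Finset.sum_apply, Pi.smul_apply, smul_eq_mul] at h1
  rw [← Finset.add_sum_erase _ _ (Finset.mem_univ i),
    ← Finset.add_sum_erase _ _ (Finset.mem_erase.mpr ⟨hij.symm, Finset.mem_univ j⟩),
    Finset.sum_eq_zero, add_zero] at h1
  · have e1 : cramer Aᵀ c i = twoRows M i j c b := by
      rw [cramer_transpose_apply, hA, updateRow_comm _ hij.symm, updateRow_idem, twoRows]
    have e2 : cramer Aᵀ c j = twoRows M i j a c := by
      rw [cramer_transpose_apply, hA, updateRow_idem, twoRows]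
    have e3 : A i = a := by
      rw [hA, updateRow_ne hij, updateRow_self]
    have e4 : A j = b := by
      rw [hA, updateRow_self]
    simp only [op_smul_eq_smul, map_smul, Pi.smul_apply, smul_eq_mul] at h1
    simp only [transpose_transpose, e1, e2, e3, e4, ← hlin] at h1
    exact h1.symm
  · intro k hk
    simp only [Finset.mem_erase, Finset.mem_univ, and_true] at hk
    have e6 : Aᵀᵀ k = B k := by
      rw [transpose_transpose, hA, hB, updateRow_ne hk.1, updateRow_ne hk.2, updateRow_ne hk.1]
    simp only [op_smul_eq_smul, map_smul, Pi.smul_apply, smul_eq_mul]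
    rw [e6, cramer_transpose_row_self, Pi.single_eq_of_ne hk.2.symm, mul_zero]

end ThreeTerm

/-! ### Restriction of the times to Miwa points, with parameters -/

section Parameters

open MvPowerSeries

variable {𝕜 : Type*} [Field 𝕜] {ι κ ρ : Type*}

/-- The coefficient of `w ^ q` in a series in the variables `t` and `w`, as a series in `t`. -/
def coeffRight (q : ρ →₀ ℕ) (H : MvPowerSeries (ι ⊕ ρ) 𝕜) : MvPowerSeries ι 𝕜 :=
  fun d => coeff (d.sumElim q) H

theorem coeff_coeffRight (q : ρ →₀ ℕ) (H : MvPowerSeries (ι ⊕ ρ) 𝕜) (d : ι →₀ ℕ) :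
    coeff d (coeffRight q H) = coeff (d.sumElim q) H := rfl

open Classical in
theorem coeff_rename_inl_mul_monomial (F : MvPowerSeries κ 𝕜) (n : κ →₀ ℕ) (q r : ρ →₀ ℕ) :
    coeff (n.sumElim q) (rename (Function.Embedding.inl : κ ↪ κ ⊕ ρ) F *
      monomial ((0 : κ →₀ ℕ).sumElim r) 1) = if r = q then coeff n F else 0 := by
  rw [coeff_mul_monomial, mul_one]
  have hle : (0 : κ →₀ ℕ).sumElim r ≤ n.sumElim q ↔ r ≤ q := by
    constructor
    · intro h i
      exact h (Sum.inr i)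
    · rintro h (k | i)
      · simp
      · exact h i
  have hsub : n.sumElim q - (0 : κ →₀ ℕ).sumElim r = n.sumElim (q - r) := by
    ext (k | i) <;> simp
  rw [hsub]
  split_ifs with h1 h2 h2
  · rw [h2, tsub_self, ← Finsupp.embDomain_inl, coeff_embDomain_rename]
  · refine coeff_rename_eq_zero _ _ ?_
    rintro ⟨y, hy⟩
    apply h2
    refine le_antisymm (hle.mp h1) (tsub_eq_zero_iff_le.mp ?_)
    ext i
    have h4 := DFunLike.congr_fun hy (Sum.inr i)
    rw [Finsupp.sumElim_inr] at h4
    rw [← h4]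
    simp [Finsupp.mapDomain_of_notMem_range]
  · exact absurd (hle.mpr h2.le) h1
  · rfl

/-- Substituting into the left variables only commutes with taking coefficients in the right
ones. -/
theorem coeff_subst_sumElim {a : ι → MvPowerSeries κ 𝕜} (ha : HasSubst a)
    (hs : HasSubst (Sum.elim (fun k => rename (Function.Embedding.inl : κ ↪ κ ⊕ ρ) (a k))
      fun i => X (Sum.inr i))) (H : MvPowerSeries (ι ⊕ ρ) 𝕜) (n : κ →₀ ℕ) (q : ρ →₀ ℕ) :
    coeff (n.sumElim q) (subst (Sum.elim
      (fun k => rename (Function.Embedding.inl : κ ↪ κ ⊕ ρ) (a k)) fun i => X (Sum.inr i)) H) =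
      coeff n (subst a (coeffRight q H)) := by
  classical
  have hterm : ∀ (d : ι →₀ ℕ) (r : ρ →₀ ℕ), coeff (n.sumElim q) ((d.sumElim r).prod fun s e =>
      (Sum.elim (fun k => rename (Function.Embedding.inl : κ ↪ κ ⊕ ρ) (a k))
        (fun i => (X (Sum.inr i) : MvPowerSeries (κ ⊕ ρ) 𝕜)) s) ^ e) =
      if r = q then coeff n (d.prod fun s e => a s ^ e) else 0 := by
    intro d r
    rw [← coeff_rename_inl_mul_monomial (n := n), Finsupp.prod_sumElim, map_finsuppProd]
    congr 2
    · simp [Function.comp_def]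
    · rw [monomial_one_eq, Finsupp.prod_sumElim]
      simp [Function.comp_def]
  rw [coeff_subst hs, coeff_subst ha, ← finsum_mem_univ]
  have hinj : Function.Injective fun d : ι →₀ ℕ => d.sumElim q := by
    intro d d' h
    have := congrArg (fun e => Finsupp.comapDomain Sum.inl e Sum.inl_injective.injOn) h
    simpa using this
  rw [finsum_mem_inter_support_eq _ Set.univ (Set.range fun d : ι →₀ ℕ => d.sumElim q),
    finsum_mem_range hinj]
  · refine finsum_congr fun d => ?_
    rw [hterm, if_pos rfl, coeff_coeffRight]
  · rw [Set.univ_inter, eq_comm, Set.inter_eq_right]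
    intro e he
    obtain ⟨d, r, rfl⟩ : ∃ (d : ι →₀ ℕ) (r : ρ →₀ ℕ), e = d.sumElim r :=
      ⟨_, _, (Finsupp.comapDomain_sumElim_comapDomain e).symm⟩
    refine ⟨d, ?_⟩
    have h2 : r = q := by
      by_contra hne
      apply he
      simp only
      rw [hterm, if_neg hne, smul_zero]
    rw [h2]

/-- The times `t = ħ ∑_i [y_i]`, with the variables `w` left alone. -/
def miwaArg (ħ : 𝕜) (N : ℕ) : ℕ+ ⊕ ρ → MvPowerSeries (Fin N ⊕ ρ) 𝕜 :=
  Sum.elim (powerSumTimes ħ fun i : Fin N => X (Sum.inl i)) fun i => X (Sum.inr i)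

theorem hasSubst_miwaArg (ħ : 𝕜) (N : ℕ) : HasSubst (miwaArg (ρ := ρ) ħ N) :=
  hasSubst_sumElim (hasSubst_powerSumTimes ħ fun _ => constantCoeff_X _)
    (hasSubst_X_comp Sum.inr_injective)

/-- Series in the times and further variables are determined by their restrictions to Miwa points
in the times. -/
theorem eq_zero_of_subst_miwaArg [CharZero 𝕜] {ħ : 𝕜} (hħ : ħ ≠ 0)
    (H : MvPowerSeries (ℕ+ ⊕ ρ) 𝕜) (h : ∀ N, subst (miwaArg ħ N) H = 0) : H = 0 := by
  have h1 : ∀ q, coeffRight q H = 0 := by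
    intro q
    refine eq_zero_of_miwaPoint_eq_zero hħ _ fun N => ?_
    have harg : miwaArg ħ N = Sum.elim
        (fun k => rename (Function.Embedding.inl : Fin N ↪ Fin N ⊕ ρ)
          (powerSumTimes ħ (X : Fin N → MvPowerSeries (Fin N) 𝕜) k))
        fun i => X (Sum.inr i) := by
      rw [miwaArg]
      congr 1
      funext k
      simp [powerSumTimes]
    ext n
    have h2 := coeff_subst_sumElim (hasSubst_powerSumTimes_X ħ) (harg ▸ hasSubst_miwaArg ħ N) H n q
    rw [← harg, h] at h2
    rw [miwaPoint, ← h2, map_zero, map_zero]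
  ext d
  have h3 := congrArg (coeff (Finsupp.comapDomain Sum.inl d Sum.inl_injective.injOn))
    (h1 (Finsupp.comapDomain Sum.inr d Sum.inr_injective.injOn))
  rw [coeff_coeffRight, Finsupp.comapDomain_sumElim_comapDomain] at h3
  exact h3

end Parameters

/-! ### From determinants to the Hirota equation -/

section Hirota

open MvPowerSeries

variable {𝕜 : Type*} [Field 𝕜]

theorem subst_X_comp_oneVar {κ τ : Type*} [Fintype κ] (s : κ → τ) (i : κ) (c : ℕ → 𝕜) :
    subst (fun k => (X (s k) : MvPowerSeries τ 𝕜)) (oneVar i c) = oneVar (s i) c := by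
  have hs : HasSubst (fun k => (X (s k) : MvPowerSeries τ 𝕜)) :=
    hasSubst_of_constantCoeff_zero fun _ => constantCoeff_X _
  rw [oneVar, subst_comp_subst_apply (hasSubst_unit i) hs, oneVar]
  simp only [subst_X hs]

/-- If the Plücker coordinates of `T` are determinants, then so are, up to Vandermonde factors, its
values at Miwa points. -/
theorem det_mul_subst_powerSumTimes [CharZero 𝕜] {ħ : 𝕜} {T : MvPowerSeries ℕ+ 𝕜} {M : ℕ → ℤ → 𝕜}
    {γ : ℕ → 𝕜} (h : ∀ (m : ℕ) (p : Fin m → ℤ), pairing T (Matrix.det (Matrix.of fun i j : Fin m =>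
      opSchur ħ (p i + (j : ℕ)))) = γ m * Matrix.det (Matrix.of fun i j : Fin m => M j (p i)))
    {τ : Type*} {m : ℕ} (s : Fin m → τ) :
    Matrix.det (Matrix.of fun i j : Fin m => (X (s i) : MvPowerSeries τ 𝕜) ^ (m - 1 - (j : ℕ))) *
      subst (powerSumTimes ħ fun i => X (s i)) T =
    C (γ m) * Matrix.det (Matrix.of fun i j : Fin m =>
      oneVar (s i) fun n => M j ((n : ℤ) - ((m : ℤ) - 1))) := by
  have hs : HasSubst (fun k => (X (s k) : MvPowerSeries τ 𝕜)) :=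
    hasSubst_of_constantCoeff_zero fun _ => constantCoeff_X _
  have h1 : vandet 𝕜 m * miwaPoint ħ m T = C (γ m) * Matrix.det (Matrix.of fun i j : Fin m =>
      oneVar i fun n => M j ((n : ℤ) - ((m : ℤ) - 1))) := by
    refine MvPowerSeries.ext fun n => ?_
    rw [coeff_vandet_mul_miwaPoint, coeff_C_mul, coeff_det_oneVar, h]
  have h2 := congrArg (substAlgHom (R := 𝕜) hs) h1
  rw [map_mul, map_mul, vandet, AlgHom.map_det, AlgHom.map_det] at h2
  have h3 : substAlgHom (R := 𝕜) hs (miwaPoint ħ m T) =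
      subst (powerSumTimes ħ fun i => X (s i)) T := by
    rw [coe_substAlgHom, miwaPoint, subst_comp_subst_apply (hasSubst_powerSumTimes_X ħ) hs]
    congr 1; funext k
    rw [subst_powerSumTimes ħ _ hs]
    simp only [subst_X hs]
  have h4 : substAlgHom (R := 𝕜) hs (C (γ m)) = C (γ m) := by
    have h5 := (substAlgHom (R := 𝕜) hs).commutes (γ m)
    rwa [MvPowerSeries.algebraMap_apply, MvPowerSeries.algebraMap_apply,
        Algebra.algebraMap_self, RingHom.id_apply] at h5
  rw [h3, h4] at h2
  convert h2 using 3
  · ext1 i j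
    simp only [AlgHom.mapMatrix_apply, Matrix.map_apply, Matrix.of_apply, map_pow, substAlgHom_X]
  · ext1 i j
    simp [coe_substAlgHom, subst_X_comp_oneVar]

/-- The variables `y_0, …, y_{N - 1}, w_a, w_b, w_b, …`. -/
def testVar (N : ℕ) (a b : Fin 3) (k : ℕ) : Fin N ⊕ Fin 3 :=
  if h : k < N then Sum.inl ⟨k, h⟩ else if k = N then Sum.inr a else Sum.inr b

theorem testVar_of_lt {N k : ℕ} (a b : Fin 3) (h : k < N) :
    testVar N a b k = Sum.inl ⟨k, h⟩ := dif_pos h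

theorem testVar_self (N : ℕ) (a b : Fin 3) : testVar N a b N = Sum.inr a := by
  simp [testVar]

theorem testVar_succ (N : ℕ) (a b : Fin 3) : testVar N a b (N + 1) = Sum.inr b := by
  simp [testVar]

theorem det_testVar (N : ℕ) (a b : Fin 3) (m : ℕ) :
    Matrix.det (Matrix.of fun i j : Fin m =>
      (X (testVar N a b i) : MvPowerSeries (Fin N ⊕ Fin 3) 𝕜) ^ (m - 1 - (j : ℕ))) =
      ∏ j ∈ Finset.range m, ∏ i ∈ Finset.range j,
        (X (testVar N a b i) - X (testVar N a b j)) := by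
  have : IsDomain (MvPowerSeries (Fin N ⊕ Fin 3) 𝕜) := NoZeroDivisors.to_isDomain _
  refine (prod_sub_eq_det (fun k => (X (testVar N a b k) : MvPowerSeries (Fin N ⊕ Fin 3) 𝕜))
    (fun k hk => ?_) m).symm
  have h1 := congrArg (coeff (Finsupp.single (testVar N a b k) 1)) hk
  rw [coeff_index_single_self_X, map_zero] at h1
  exact one_ne_zero h1

/-- A series whose Plücker coordinates `det (h_{p_i + j})`, `i, j < m`, are of the form
`γ_m det (M_j(p_i))`, that is given by the flag of the series `∑_n M_j(n) w ^ n`, solves the Hirota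
equation. -/
theorem isTauFunction_of_pairing_det [CharZero 𝕜] {ħ : 𝕜} (hħ : ħ ≠ 0) {T : MvPowerSeries ℕ+ 𝕜}
    {M : ℕ → ℤ → 𝕜} (hM : ∀ (j : ℕ) (p : ℤ), p + (j : ℤ) < 0 → M j p = 0) {γ : ℕ → 𝕜}
    (h : ∀ (m : ℕ) (p : Fin m → ℤ), pairing T (Matrix.det (Matrix.of fun i j : Fin m =>
      opSchur ħ (p i + (j : ℕ)))) = γ m * Matrix.det (Matrix.of fun i j : Fin m => M j (p i))) :
    IsTauFunction ħ T := by
  rw [IsTauFunction]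
  refine eq_zero_of_subst_miwaArg hħ _ fun N => ?_
  have : IsDomain (MvPowerSeries (Fin N ⊕ Fin 3) 𝕜) := NoZeroDivisors.to_isDomain _
  have hs := hasSubst_miwaArg (𝕜 := 𝕜) (ρ := Fin 3) ħ N
  let y : ℕ → MvPowerSeries (Fin N ⊕ Fin 3) 𝕜 := fun k => X (testVar N 0 0 k)
  let w : Fin 3 → MvPowerSeries (Fin N ⊕ Fin 3) 𝕜 := fun a => X (Sum.inr a)
  let P : Fin 3 → Fin 3 → MvPowerSeries (Fin N ⊕ Fin 3) 𝕜 := fun a b =>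
    subst (powerSumTimes ħ fun i : Fin (N + 2) => X (testVar N a b i)) T
  let P' : Fin 3 → MvPowerSeries (Fin N ⊕ Fin 3) 𝕜 := fun a =>
    subst (powerSumTimes ħ fun i : Fin (N + 1) => X (testVar N a a i)) T
  -- the restrictions of the factors of the Hirota equation
  have hw : ∀ a, substAlgHom hs (invZ 𝕜 a) = w a := fun a => by
    rw [invZ, substAlgHom_X]; rfl
  have hmiwa : ∀ S, substAlgHom hs (miwa ħ S T) = subst (fun k : ℕ+ =>
      powerSumTimes ħ (fun i : Fin N => (X (Sum.inl i) : MvPowerSeries (Fin N ⊕ Fin 3) 𝕜)) k +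
        ∑ i ∈ S, (ħ / ((k : ℕ) : 𝕜)) • w i ^ (k : ℕ)) T := by
    intro S
    rw [coe_substAlgHom, miwa, subst_comp_subst_apply (hasSubst_shiftedTime ħ S) hs]
    congr 1; funext k
    rw [← coe_substAlgHom hs, shiftedTime, map_add, map_sum, substAlgHom_X]
    congr 1
    refine Finset.sum_congr rfl fun i _ => ?_
    rw [map_smul, map_pow, hw]
  have hlow : ∀ (a b : Fin 3) (i : Fin N), testVar N a b (i : ℕ) = Sum.inl i := fun a b i =>
    testVar_of_lt a b i.2
  have hP : ∀ a b, a ≠ b → substAlgHom hs (miwa ħ {a, b} T) = P a b := by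
    intro a b hab
    rw [hmiwa]
    congr 1; funext k
    rw [Finset.sum_pair hab, powerSumTimes, powerSumTimes, Fin.sum_univ_castSucc,
      Fin.sum_univ_castSucc]
    simp only [Fin.val_castSucc, Fin.val_last, hlow, testVar_self, testVar_succ, smul_add, w,
      add_assoc]
  have hP' : ∀ a, substAlgHom hs (miwa ħ {a} T) = P' a := by
    intro a
    rw [hmiwa]
    congr 1; funext k
    rw [Finset.sum_singleton, powerSumTimes, powerSumTimes, Fin.sum_univ_castSucc]
    simp only [Fin.val_castSucc, Fin.val_last, hlow, testVar_self, smul_add, w]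
  -- the Vandermonde factors
  let V : MvPowerSeries (Fin N ⊕ Fin 3) 𝕜 :=
    ∏ j ∈ Finset.range N, ∏ i ∈ Finset.range j, (y i - y j)
  let E : Fin 3 → MvPowerSeries (Fin N ⊕ Fin 3) 𝕜 := fun a => ∏ i ∈ Finset.range N, (y i - w a)
  have hy : ∀ a b k, k < N → (X (testVar N a b k) : MvPowerSeries (Fin N ⊕ Fin 3) 𝕜) = y k := by
    intro a b k hk
    simp only [y, testVar_of_lt _ _ hk]
  have hV : ∀ a b, ∏ j ∈ Finset.range N, ∏ i ∈ Finset.range j,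
      ((X (testVar N a b i) : MvPowerSeries (Fin N ⊕ Fin 3) 𝕜) - X (testVar N a b j)) = V := by
    intro a b
    refine Finset.prod_congr rfl fun j hj => Finset.prod_congr rfl fun i hi => ?_
    rw [Finset.mem_range] at hj hi
    rw [hy a b j hj, hy a b i (hi.trans hj)]
  have hE : ∀ a b c, ∏ i ∈ Finset.range N,
      ((X (testVar N a b i) : MvPowerSeries (Fin N ⊕ Fin 3) 𝕜) - X (Sum.inr c)) = E c := by
    intro a b c
    refine Finset.prod_congr rfl fun i hi => ?_
    rw [Finset.mem_range] at hi
    rw [hy a b i hi]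
  have hV1 : ∀ a, Matrix.det (Matrix.of fun i j : Fin (N + 1) =>
      (X (testVar N a a i) : MvPowerSeries (Fin N ⊕ Fin 3) 𝕜) ^ (N + 1 - 1 - (j : ℕ))) =
      V * E a := by
    intro a
    rw [det_testVar, Finset.prod_range_succ, hV, testVar_self, hE]
  have hV2 : ∀ a b, Matrix.det (Matrix.of fun i j : Fin (N + 2) =>
      (X (testVar N a b i) : MvPowerSeries (Fin N ⊕ Fin 3) 𝕜) ^ (N + 2 - 1 - (j : ℕ))) =
      V * E a * (E b * (w a - w b)) := by
    intro a b
    rw [det_testVar, Finset.prod_range_succ, Finset.prod_range_succ, Finset.prod_range_succ, hV,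
      testVar_self, testVar_succ, hE, hE]
  -- the determinants as minors with two variable rows
  let row : Fin N ⊕ Fin 3 → Fin (N + 2) → MvPowerSeries (Fin N ⊕ Fin 3) 𝕜 := fun s j =>
    oneVar s fun n => M j ((n : ℤ) - (((N + 2 : ℕ) : ℤ) - 1))
  let Q : Matrix (Fin (N + 2)) (Fin (N + 2)) (MvPowerSeries (Fin N ⊕ Fin 3) 𝕜) :=
    Matrix.of fun i => row (testVar N 0 0 i)
  let f := twoRows Q (Fin.last N).castSucc (Fin.last (N + 1))
  let e : Fin (N + 2) → MvPowerSeries (Fin N ⊕ Fin 3) 𝕜 := Pi.single (Fin.last (N + 1)) 1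
  let Y : MvPowerSeries (Fin N ⊕ Fin 3) 𝕜 := ∏ i : Fin N, X (Sum.inl i)
  have hf2 : ∀ a b, V * E a * (E b * (w a - w b)) * P a b =
      C (γ (N + 2)) * f (row (Sum.inr a)) (row (Sum.inr b)) := by
    intro a b
    rw [← hV2, det_mul_subst_powerSumTimes h fun i : Fin (N + 2) => testVar N a b i]
    congr 2
    ext1 i j
    rw [Matrix.of_apply]
    refine Fin.lastCases ?_ (fun i => Fin.lastCases ?_ (fun i => ?_) i) i
    · rw [Matrix.updateRow_self, Fin.val_last, testVar_succ]
    · rw [Matrix.updateRow_ne (Fin.castSucc_lt_last _).ne, Matrix.updateRow_self, Fin.val_castSucc,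
        Fin.val_last, testVar_self]
    · rw [Matrix.updateRow_ne (Fin.castSucc_lt_last _).ne, Matrix.updateRow_ne
        (by rw [Ne, Fin.castSucc_inj]; exact (Fin.castSucc_lt_last _).ne)]
      simp only [Fin.val_castSucc, hlow, Q, Matrix.of_apply, row]
  have hf1 : ∀ a, Y * w a * (V * E a * P' a) = C (γ (N + 1)) * f (row (Sum.inr a)) e := by
    intro a
    rw [← hV1, det_mul_subst_powerSumTimes h fun i : Fin (N + 1) => testVar N a a i, mul_left_comm]
    congr 1
    have hYw : Y * w a = ∏ i : Fin (N + 1),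
        (X (testVar N a a i) : MvPowerSeries (Fin N ⊕ Fin 3) 𝕜) := by
      rw [Fin.prod_univ_castSucc]
      simp only [Fin.val_castSucc, Fin.val_last, hlow, testVar_self, Y, w]
    have hrow : f (row (Sum.inr a)) e =
        (((Q.updateRow (Fin.last N).castSucc (row (Sum.inr a))).updateRow (Fin.last (N + 1))
          e).submatrix Fin.castSucc Fin.castSucc).det := by
      simp only [f, twoRows]
      rw [det_of_last_row, Matrix.updateRow_self]
      · simp only [e, Pi.single_eq_same, one_mul]
      · intro j
        rw [Matrix.updateRow_self]
        exact Pi.single_eq_of_ne (Fin.castSucc_lt_last _).ne _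
    rw [hYw, ← Matrix.det_mul_column, hrow]
    congr 1
    ext1 i j
    have hshift : (X (testVar N a a i) : MvPowerSeries (Fin N ⊕ Fin 3) 𝕜) *
        oneVar (testVar N a a i) (fun n => M j ((n : ℤ) - (((N + 1 : ℕ) : ℤ) - 1))) =
        row (testVar N a a i) j.castSucc := by
      have h1 := X_pow_mul_oneVar (testVar N a a i) 1
        (fun n : ℤ => M j (n - (((N + 1 : ℕ) : ℤ) - 1))) fun n hn => hM _ _ (by
          have := j.2
          push_cast
          omega)
      rw [pow_one] at h1
      rw [h1]
      simp only [row, Fin.val_castSucc]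
      congr 1; funext n
      congr 1
      push_cast
      ring
    simp only [Matrix.of_apply, Matrix.submatrix_apply]
    rw [hshift, Matrix.updateRow_ne (Fin.castSucc_lt_last _).ne]
    refine Fin.lastCases ?_ (fun i => ?_) i
    · rw [Matrix.updateRow_self, Fin.val_last, testVar_self]
    · rw [Matrix.updateRow_ne
        (by rw [Ne, Fin.castSucc_inj]; exact (Fin.castSucc_lt_last _).ne)]
      simp only [Fin.val_castSucc, hlow, Q, Matrix.of_apply]
  have hpl := twoRows_mul_twoRows Q (i := (Fin.last N).castSucc) (j := Fin.last (N + 1))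
    (Fin.castSucc_lt_last _).ne (row (Sum.inr 0)) (row (Sum.inr 1)) (row (Sum.inr 2)) e
  change f _ _ * f _ _ = f _ _ * f _ _ + f _ _ * f _ _ at hpl
  have hX : ∀ s : Fin N ⊕ Fin 3, (X s : MvPowerSeries (Fin N ⊕ Fin 3) 𝕜) ≠ 0 := by
    intro s hX
    have h1 := congrArg (coeff (Finsupp.single s 1)) hX
    rw [coeff_index_single_self_X, map_zero] at h1
    exact one_ne_zero h1
  have hY : Y ≠ 0 := Finset.prod_ne_zero_iff.mpr fun i _ => hX _
  have hE0 : ∀ a, E a ≠ 0 := fun a => Finset.prod_ne_zero_iff.mpr fun i hi hcon => by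
    rw [Finset.mem_range] at hi
    have h1 := X_inj.mp (sub_eq_zero.mp hcon)
    rw [testVar_of_lt _ _ hi] at h1
    cases h1
  have hV0 : V ≠ 0 := Finset.prod_ne_zero_iff.mpr fun j hj =>
    Finset.prod_ne_zero_iff.mpr fun i hi hcon => by
      rw [Finset.mem_range] at hi hj
      have h1 := X_inj.mp (sub_eq_zero.mp hcon)
      rw [testVar_of_lt _ _ hj, testVar_of_lt _ _ (hi.trans hj), Sum.inl.injEq, Fin.mk.injEq] at h1
      omega
  rw [← coe_substAlgHom hs]
  rw [Finset.pair_comm (1 : Fin 3) 2, Finset.pair_comm (2 : Fin 3) 0]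
  simp only [map_add, map_sub, map_mul, hw, hP', hP _ _ (show (0 : Fin 3) ≠ 1 by decide),
    hP _ _ (show (2 : Fin 3) ≠ 1 by decide), hP _ _ (show (0 : Fin 3) ≠ 2 by decide)]
  refine (mul_eq_zero.mp (?_ : (Y * V ^ 2 * (E 0 * E 1 * E 2)) * _ = 0)).resolve_left
    (mul_ne_zero (mul_ne_zero hY (pow_ne_zero 2 hV0))
      (mul_ne_zero (mul_ne_zero (hE0 0) (hE0 1)) (hE0 2)))
  have a01 := hf2 0 1
  have a21 := hf2 2 1
  have a02 := hf2 0 2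
  have b0 := hf1 0
  have b1 := hf1 1
  have b2 := hf1 2
  have c1 : (V * E 0 * (E 1 * (w 0 - w 1)) * P 0 1) * (Y * w 2 * (V * E 2 * P' 2)) =
      (V * E 2 * (E 1 * (w 2 - w 1)) * P 2 1) * (Y * w 0 * (V * E 0 * P' 0)) +
      (V * E 0 * (E 2 * (w 0 - w 2)) * P 0 2) * (Y * w 1 * (V * E 1 * P' 1)) := by
    rw [a01, a21, a02, b0, b1, b2]
    linear_combination (C (γ (N + 2)) * C (γ (N + 1))) * hpl
  linear_combination -c1

end Hirota

/-! ### Raising the rows of a determinant -/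

section Pieri

open Matrix

variable {A : Type*} [CommRing A]

/-- Replacing one row at a time or one column at a time by that of `C` gives the same sum; both are
the trace of `adjugate B * C`. -/
theorem sum_det_updateRow {n : Type*} [Fintype n] [DecidableEq n] (B C : Matrix n n A) :
    ∑ i, (B.updateRow i (C i)).det = ∑ j, (B.updateCol j fun i => C i j).det := by
  have h1 : ∀ i, (B.updateRow i (C i)).det = ∑ j, B.adjugate j i * C i j := by
    intro i
    rw [← cramer_transpose_apply, cramer_eq_adjugate_mulVec, ← adjugate_transpose]
    rfl
  have h2 : ∀ j, (B.updateCol j fun i => C i j).det = ∑ i, B.adjugate j i * C i j := by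
    intro j
    rw [← cramer_apply, cramer_eq_adjugate_mulVec]
    rfl
  rw [Finset.sum_congr rfl fun i _ => h1 i, Finset.sum_congr rfl fun j _ => h2 j, Finset.sum_comm]

/-- The determinant `det (N_j(p_i))` with the columns `0, 1, …, n - 1, n + 1`. -/
def raisedDet (N : ℕ → ℤ → A) {n : ℕ} (p : Fin (n + 1) → ℤ) : A :=
  Matrix.det (Matrix.of fun i j : Fin (n + 1) => N (if j = Fin.last n then n + 1 else j) (p i))

theorem sum_det_updateRow_succ (N : ℕ → ℤ → A) {n : ℕ} (p : Fin (n + 1) → ℤ) :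
    ∑ i, ((Matrix.of fun i j : Fin (n + 1) => N j (p i)).updateRow i
      fun j => N ((j : ℕ) + 1) (p i)).det = raisedDet N p := by
  refine (sum_det_updateRow (Matrix.of fun i j : Fin (n + 1) => N j (p i))
    (Matrix.of fun i j : Fin (n + 1) => N ((j : ℕ) + 1) (p i))).trans ?_
  rw [Fin.sum_univ_castSucc, Finset.sum_eq_zero, zero_add]
  · rw [raisedDet]
    congr 1
    ext i j
    rw [updateCol_apply]
    simp only [Matrix.of_apply, Fin.val_last]
    split_ifs <;> rfl
  · intro j _
    refine det_zero_of_column_eq (i := j.castSucc) (j := j.succ) (Fin.castSucc_lt_succ).ne ?_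
    intro i
    rw [updateCol_self, updateCol_ne (Fin.castSucc_lt_succ).ne']
    simp

/-- Adding the row `p = -n`, in which only the last two entries are nonzero. -/
theorem det_snoc_neg (N : ℕ → ℤ → A) (hN : ∀ (j : ℕ) (p : ℤ), p + (j : ℤ) < 0 → N j p = 0) {n : ℕ}
    (p : Fin (n + 1) → ℤ) :
    Matrix.det (Matrix.of fun i j : Fin (n + 2) =>
      N j ((Fin.snoc p (-(n : ℤ)) : Fin (n + 2) → ℤ) i)) =
      N (n + 1) (-n) * Matrix.det (Matrix.of fun i j : Fin (n + 1) => N j (p i)) -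
        N n (-n) * raisedDet N p := by
  rw [Matrix.det_succ_row _ (Fin.last (n + 1)), Fin.sum_univ_castSucc, Fin.sum_univ_castSucc,
    Finset.sum_eq_zero, zero_add]
  · simp only [Matrix.of_apply, Fin.snoc_last, Fin.val_last, Fin.val_castSucc, Fin.succAbove_last]
    have s1 : (-1 : A) ^ (n + 1 + (n + 1)) = 1 := Even.neg_one_pow ⟨n + 1, rfl⟩
    have s2 : (-1 : A) ^ (n + 1 + n) = -1 := Odd.neg_one_pow ⟨n, by ring⟩
    have m1 : (Matrix.of fun i j : Fin (n + 2) =>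
        N j ((Fin.snoc p (-(n : ℤ)) : Fin (n + 2) → ℤ) i)).submatrix Fin.castSucc Fin.castSucc =
        Matrix.of fun i j : Fin (n + 1) => N j (p i) := by
      ext i j
      simp
    have m2 : ((Matrix.of fun i j : Fin (n + 2) =>
        N j ((Fin.snoc p (-(n : ℤ)) : Fin (n + 2) → ℤ) i)).submatrix Fin.castSucc
          (Fin.last n).castSucc.succAbove).det = raisedDet N p := by
      rw [raisedDet]
      congr 1
      ext i j
      simp only [Matrix.submatrix_apply, Matrix.of_apply, Fin.snoc_castSucc]
      congr 1
      refine Fin.lastCases ?_ (fun j => ?_) j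
      · simp
      · rw [if_neg (Fin.castSucc_lt_last j).ne, Fin.succAbove_of_castSucc_lt]
        · simp
        · simp [Fin.lt_def]
    rw [s1, s2, m1, m2]
    ring
  · intro j _
    simp only [Matrix.of_apply, Fin.snoc_last, Fin.val_castSucc]
    rw [hN _ _ (by have := j.2; omega)]
    ring

/-- The Pieri rule for multiplication by `h_1`: a box is added to one of the rows, or opens a new
row. -/
theorem opSchur_mul_det {𝕜 : Type*} [Field 𝕜] (ħ : 𝕜) {n : ℕ} (p : Fin (n + 1) → ℤ) :
    opSchur ħ 1 * Matrix.det (Matrix.of fun i j : Fin (n + 1) => opSchur ħ (p i + (j : ℕ))) =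
      Matrix.det (Matrix.of fun i j : Fin (n + 2) =>
        opSchur ħ ((Fin.snoc p (-(n : ℤ)) : Fin (n + 2) → ℤ) i + (j : ℕ))) +
      ∑ l, Matrix.det (Matrix.of fun i j : Fin (n + 1) =>
        opSchur ħ (Function.update p l (p l + 1) i + (j : ℕ))) := by
  have h1 := det_snoc_neg (fun (j : ℕ) p => opSchur ħ (p + (j : ℤ)))
    (fun j p h => opSchur_of_neg ħ h) p
  have h2 := sum_det_updateRow_succ (fun (j : ℕ) p => opSchur ħ (p + (j : ℤ))) p
  have h3 : ∀ l, (Matrix.of fun i j : Fin (n + 1) =>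
      opSchur ħ (Function.update p l (p l + 1) i + (j : ℕ))) =
      (Matrix.of fun i j : Fin (n + 1) => opSchur ħ (p i + (j : ℕ))).updateRow l
        fun j => opSchur ħ (p l + ((j + 1 : ℕ) : ℤ)) := by
    intro l
    ext1 i j
    by_cases h : i = l
    · subst h
      rw [updateRow_self]
      simp only [Matrix.of_apply, Function.update_self]
      congr 1
      push_cast
      ring
    · rw [updateRow_ne h]
      simp only [Matrix.of_apply, Function.update_of_ne h]
  have h4 : -(n : ℤ) + ((n + 1 : ℕ) : ℤ) = 1 := by push_cast; ring
  rw [h1, Finset.sum_congr rfl fun l _ => congrArg Matrix.det (h3 l), h2, h4, neg_add_cancel,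
    opSchur_zero]
  ring

/-- The derivative of a determinant, row by row. -/
theorem hasDerivAt_det {𝕜 : Type*} [RCLike 𝕜] {n : Type*} [Fintype n] [DecidableEq n]
    {B : ℝ → Matrix n n 𝕜} {B' : Matrix n n 𝕜} {x : ℝ}
    (h : ∀ i j, HasDerivAt (fun y => B y i j) (B' i j) x) :
    HasDerivAt (fun y => (B y).det) (∑ i, ((B x).updateRow i (B' i)).det) x := by
  have h1 : ∀ M : Matrix n n 𝕜, M.det = ∑ s : Equiv.Perm n, Equiv.Perm.sign s • ∏ i, M i (s i) := by
    intro M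
    rw [← det_transpose, det_apply]
    rfl
  simp only [h1]
  rw [Finset.sum_comm]
  refine HasDerivAt.fun_sum fun s _ => ?_
  rw [← Finset.smul_sum]
  have h2 := HasDerivAt.fun_finsetProd (u := Finset.univ) fun i _ => h i (s i)
  have h3 : ∑ i, (∏ j ∈ Finset.univ.erase i, B x j (s j)) • B' i (s i) =
      ∑ i, ∏ j, (B x).updateRow i (B' i) j (s j) := by
    refine Finset.sum_congr rfl fun i _ => ?_
    rw [← Finset.mul_prod_erase _ _ (Finset.mem_univ i), updateRow_self, smul_eq_mul, mul_comm]
    congr 1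
    exact Finset.prod_congr rfl fun j hj => by rw [updateRow_ne (Finset.ne_of_mem_erase hj)]
  rw [h3] at h2
  rcases Int.units_eq_one_or (Equiv.Perm.sign s) with hs | hs
  · simpa only [hs, one_smul] using h2
  · simpa only [hs, Units.neg_smul, one_smul] using h2.fun_neg

end Pieri

/-! ### The determinants as functions of `x` -/

section Determinants

variable {𝕜 : Type*} [RCLike 𝕜]

/-- The entry `∑_k (-ħ) ^ k binom(j, k) ∂_x ^ k c_{p + j - k}` in column `j`, as a function of `x`. -/
def detEntry (ħ : 𝕜) (c : ℕ → ℝ → 𝕜) (j : ℕ) (p : ℤ) (x : ℝ) : 𝕜 :=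
  ∑ k ∈ Finset.range (j + 1), (-ħ) ^ k * (Nat.choose j k : 𝕜) *
    iteratedDeriv k (extendZero c (p + (j : ℕ) - (k : ℕ))) x

theorem detCoeff_eq (ħ : 𝕜) (c : ℕ → ℝ → 𝕜) (lam : YoungDiagram) (x : ℝ) :
    detCoeff ħ c lam x = c 0 x ^ (1 - (numRows lam : ℤ)) *
      Matrix.det (Matrix.of fun i j : Fin (numRows lam) =>
        detEntry ħ c j ((lam.rowLen i : ℤ) - (i : ℕ)) x) := rfl

theorem iteratedDeriv_extendZero_of_neg (c : ℕ → ℝ → 𝕜) {n : ℤ} (hn : n < 0) (k : ℕ) (x : ℝ) :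
    iteratedDeriv k (extendZero c n) x = 0 := by
  rw [extendZero_of_neg c hn]
  simp

theorem detEntry_of_neg (ħ : 𝕜) (c : ℕ → ℝ → 𝕜) {j : ℕ} {p : ℤ} (h : p + (j : ℤ) < 0) (x : ℝ) :
    detEntry ħ c j p x = 0 :=
  Finset.sum_eq_zero fun k _ => by
    rw [iteratedDeriv_extendZero_of_neg c (by omega), mul_zero]

theorem detEntry_neg_self (ħ : 𝕜) (c : ℕ → ℝ → 𝕜) (j : ℕ) (x : ℝ) :
    detEntry ħ c j (-(j : ℤ)) x = c 0 x := by
  rw [detEntry, Finset.sum_eq_single 0]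
  · simp only [pow_zero, Nat.choose_zero_right, Nat.cast_one, one_mul, iteratedDeriv_zero,
      neg_add_cancel, Nat.cast_zero, sub_zero]
    rfl
  · intro k _ hk
    rw [iteratedDeriv_extendZero_of_neg c (by omega), mul_zero]
  · simp

theorem detEntry_succ_neg (ħ : 𝕜) (c : ℕ → ℝ → 𝕜) (n : ℕ) (x : ℝ) :
    detEntry ħ c (n + 1) (-(n : ℤ)) x = c 1 x - ħ * (n + 1) * deriv (c 0) x := by
  rw [detEntry, Finset.sum_range_succ', Finset.sum_range_succ', Finset.sum_eq_zero]
  · have e1 : -(n : ℤ) + ((n + 1 : ℕ) : ℤ) - ((0 + 1 : ℕ) : ℤ) = ((0 : ℕ) : ℤ) := by push_cast; ring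
    have e2 : -(n : ℤ) + ((n + 1 : ℕ) : ℤ) - ((0 : ℕ) : ℤ) = ((1 : ℕ) : ℤ) := by push_cast; ring
    rw [e1, e2, extendZero_natCast, extendZero_natCast]
    simp
    ring
  · intro k _
    rw [iteratedDeriv_extendZero_of_neg c (by push_cast; omega), mul_zero]

variable {ħ : 𝕜} {c : ℕ → ℝ → 𝕜} {U : Set ℝ}

theorem contDiffOn_extendZero (hc : ∀ k, ContDiffOn ℝ ∞ (c k) U) (n : ℤ) :
    ContDiffOn ℝ ∞ (extendZero c n) U := by
  rcases lt_or_ge n 0 with hn | hn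
  · rw [extendZero_of_neg c hn]
    exact contDiffOn_const
  · lift n to ℕ using hn
    exact hc n

theorem contDiffOn_detEntry (hU : IsOpen U) (hc : ∀ k, ContDiffOn ℝ ∞ (c k) U) (j : ℕ) (p : ℤ) :
    ContDiffOn ℝ ∞ (detEntry ħ c j p) U :=
  ContDiffOn.sum fun k _ => contDiffOn_const.mul
    (contDiffOn_iteratedDeriv hU (contDiffOn_extendZero hc _) k)

/-- `(z - ħ ∂_x) (z - ħ ∂_x) ^ j = (z - ħ ∂_x) ^ (j + 1)`. -/
theorem detEntry_succ (hU : IsOpen U) (hc : ∀ k, ContDiffOn ℝ ∞ (c k) U) (j : ℕ) (p : ℤ) {x : ℝ}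
    (hx : x ∈ U) :
    detEntry ħ c (j + 1) p x = detEntry ħ c j (p + 1) x - ħ * deriv (detEntry ħ c j p) x := by
  have hd : deriv (detEntry ħ c j p) x = ∑ k ∈ Finset.range (j + 1),
      (-ħ) ^ k * (Nat.choose j k : 𝕜) *
        iteratedDeriv (k + 1) (extendZero c (p + (j : ℕ) - (k : ℕ))) x := by
    have h1 : ∀ k : ℕ, DifferentiableAt ℝ
        (iteratedDeriv k (extendZero c (p + (j : ℕ) - (k : ℕ)))) x := fun k =>
      ((contDiffOn_iteratedDeriv hU (contDiffOn_extendZero hc _) k).contDiffAt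
        (hU.mem_nhds hx)).differentiableAt (by simp)
    have h2 : HasDerivAt (detEntry ħ c j p) (∑ k ∈ Finset.range (j + 1),
        (-ħ) ^ k * (Nat.choose j k : 𝕜) *
          deriv (iteratedDeriv k (extendZero c (p + (j : ℕ) - (k : ℕ)))) x) x :=
      HasDerivAt.fun_sum fun k _ => (h1 k).hasDerivAt.const_mul _
    rw [h2.deriv]
    simp only [iteratedDeriv_succ]
  have e1 : ∀ k : ℕ, p + ((j + 1 : ℕ) : ℤ) - ((k + 1 : ℕ) : ℤ) = p + (j : ℤ) - (k : ℤ) := by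
    intro k; push_cast; ring
  have e2 : ∀ k : ℕ, p + 1 + (j : ℤ) - (k : ℤ) = p + ((j + 1 : ℕ) : ℤ) - (k : ℤ) := by
    intro k; push_cast; ring
  have h3 : detEntry ħ c j (p + 1) x = ∑ k ∈ Finset.range (j + 1 + 1),
      (-ħ) ^ k * (Nat.choose j k : 𝕜) *
        iteratedDeriv k (extendZero c (p + ((j + 1 : ℕ) : ℤ) - (k : ℕ))) x := by
    rw [Finset.sum_range_succ _ (j + 1), Nat.choose_succ_self]
    simp only [detEntry, e2]
    simp
  rw [hd, h3, detEntry, Finset.sum_range_succ', Finset.sum_range_succ' _ (j + 1), Finset.mul_sum]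
  simp only [e1]
  simp only [Nat.choose_succ_succ', Nat.cast_add, mul_add, add_mul, Finset.sum_add_distrib,
    Nat.choose_zero_right]
  have h4 : ∑ k ∈ Finset.range (j + 1), (-ħ) ^ (k + 1) * (Nat.choose j k : 𝕜) *
      iteratedDeriv (k + 1) (extendZero c (p + (j : ℤ) - (k : ℤ))) x =
      - ∑ k ∈ Finset.range (j + 1), ħ * ((-ħ) ^ k * (Nat.choose j k : 𝕜) *
        iteratedDeriv (k + 1) (extendZero c (p + (j : ℤ) - (k : ℤ))) x) := by
    rw [← Finset.sum_neg_distrib]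
    exact Finset.sum_congr rfl fun k _ => by ring
  rw [h4]
  ring

/-- The analogue of the Pieri formula for the determinants in `c_0, c_1, …`. -/
theorem detEntry_pieri (hU : IsOpen U) (hc : ∀ k, ContDiffOn ℝ ∞ (c k) U) {n : ℕ}
    (p : Fin (n + 1) → ℤ) {x : ℝ} (hx : x ∈ U) :
    ∃ r d : 𝕜,
      HasDerivAt (fun y => Matrix.det (Matrix.of fun i j : Fin (n + 1) =>
        detEntry ħ c j (p i) y)) d x ∧
      Matrix.det (Matrix.of fun i j : Fin (n + 2) =>
        detEntry ħ c j ((Fin.snoc p (-(n : ℤ)) : Fin (n + 2) → ℤ) i) x) =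
        (c 1 x - ħ * (n + 1) * deriv (c 0) x) * Matrix.det (Matrix.of fun i j : Fin (n + 1) =>
          detEntry ħ c j (p i) x) - c 0 x * r ∧
      ∑ l, Matrix.det (Matrix.of fun i j : Fin (n + 1) =>
        detEntry ħ c j (Function.update p l (p l + 1) i) x) = r + ħ * d := by
  have hdiff : ∀ j p, DifferentiableAt ℝ (detEntry ħ c j p) x := fun j p =>
    ((contDiffOn_detEntry hU hc j p).contDiffAt (hU.mem_nhds hx)).differentiableAt (by simp)
  refine ⟨raisedDet (fun j p => detEntry ħ c j p x) p, _,
    hasDerivAt_det (B := fun y => Matrix.of fun i j : Fin (n + 1) => detEntry ħ c j (p i) y)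
      (B' := Matrix.of fun i j : Fin (n + 1) => deriv (detEntry ħ c j (p i)) x)
      fun i j => (hdiff _ _).hasDerivAt, ?_, ?_⟩
  · have h1 := det_snoc_neg (fun j p => detEntry ħ c j p x)
      (fun j p h => detEntry_of_neg ħ c h x) p
    rwa [detEntry_succ_neg, detEntry_neg_self] at h1
  · rw [← sum_det_updateRow_succ, Finset.mul_sum, ← Finset.sum_add_distrib]
    refine Finset.sum_congr rfl fun l _ => ?_
    have h1 : (Matrix.of fun i j : Fin (n + 1) =>
        detEntry ħ c j (Function.update p l (p l + 1) i) x) =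
        (Matrix.of fun i j : Fin (n + 1) => detEntry ħ c j (p i) x).updateRow l
          ((fun j : Fin (n + 1) => detEntry ħ c ((j : ℕ) + 1) (p l) x) +
            ħ • (Matrix.of fun i j : Fin (n + 1) => deriv (detEntry ħ c j (p i)) x) l) := by
      ext1 i j
      by_cases h : i = l
      · subst h
        rw [Matrix.updateRow_self]
        simp only [Matrix.of_apply, Function.update_self, Pi.add_apply, Pi.smul_apply, smul_eq_mul]
        rw [detEntry_succ hU hc _ _ hx]
        ring
      · rw [Matrix.updateRow_ne h]
        simp only [Matrix.of_apply, Function.update_of_ne h]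
    rw [h1, Matrix.det_updateRow_add, Matrix.det_updateRow_smul]

theorem contDiffOn_detCoeff (hU : IsOpen U) (hc : ∀ k, ContDiffOn ℝ ∞ (c k) U)
    (h0 : ∀ x ∈ U, c 0 x ≠ 0) (lam : YoungDiagram) : ContDiffOn ℝ ∞ (detCoeff ħ c lam) U := by
  have hinv : ContDiffOn ℝ ∞ (fun x => (c 0 x)⁻¹) U := (hc 0).inv h0
  have hdet : ContDiffOn ℝ ∞ (fun x => Matrix.det (Matrix.of fun i j : Fin (numRows lam) =>
      detEntry ħ c j ((lam.rowLen i : ℤ) - (i : ℕ)) x)) U := by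
    simp only [Matrix.det_apply, Matrix.of_apply]
    refine ContDiffOn.sum fun s _ => ?_
    have h1 : ContDiffOn ℝ ∞ (fun x => ∏ i : Fin (numRows lam),
        detEntry ħ c i ((lam.rowLen (s i) : ℤ) - (s i : ℕ)) x) U :=
      contDiffOn_prod fun i _ => contDiffOn_detEntry hU hc _ _
    rcases Int.units_eq_one_or (Equiv.Perm.sign s) with hs | hs
    · simpa only [hs, one_smul] using h1
    · simpa only [hs, Units.neg_smul, one_smul] using h1.neg
  refine (((hc 0).mul (hinv.pow (numRows lam))).mul hdet).congr fun x hx => ?_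
  rw [detCoeff_eq, zpow_sub₀ (h0 x hx), zpow_one, zpow_natCast, div_eq_mul_inv, ← inv_pow]

end Determinants

/-! ### The dependence on `x` of the formal solution -/

section Solution

open MvPowerSeries

variable {𝕜 : Type*} [RCLike 𝕜]

/-- On every open subset of the line, a continuous function is a derivative. -/
theorem exists_hasDerivAt_of_continuousOn {V : Set ℝ} (hV : IsOpen V) {g : ℝ → 𝕜}
    (hg : ContinuousOn g V) : ∃ G : ℝ → 𝕜, ∀ x ∈ V, HasDerivAt G (g x) x := by
  classical
  -- integrate from a base point chosen in the component of `x`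
  let b : ℝ → ℝ := fun x => if hx : x ∈ V then Set.ordConnectedProj V ⟨x, hx⟩ else 0
  refine ⟨fun x => ∫ t in b x..x, g t, fun x hx => ?_⟩
  obtain ⟨ε, hε, hball⟩ := Metric.isOpen_iff.mp hV x hx
  have hb : ∀ᶠ y in nhds x, b y = b x := by
    filter_upwards [Metric.ball_mem_nhds x hε] with y hy
    have hyV := hball hy
    simp only [b, dif_pos hyV, dif_pos hx]
    rw [Set.ordConnectedProj_eq]
    refine Set.Subset.trans ?_ hball
    rw [Real.ball_eq_Ioo] at hy ⊢
    exact Set.OrdConnected.uIcc_subset Set.ordConnected_Ioo hy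
      ⟨by linarith, by linarith⟩
  have hseg : Set.uIcc (b x) x ⊆ V := by
    have h1 := Set.mem_ordConnectedComponent_ordConnectedProj V ⟨x, hx⟩
    simp only [b, dif_pos hx]
    exact h1
  have h1 : HasDerivAt (fun y => ∫ t in b x..y, g t) (g x) x := by
    refine intervalIntegral.integral_hasDerivAt_right
      (ContinuousOn.intervalIntegrable (hg.mono hseg)) ?_ (hg.continuousAt (hV.mem_nhds hx))
    exact hg.stronglyMeasurableAtFilter hV x hx
  refine h1.congr_of_eventuallyEq ?_
  filter_upwards [hb] with y hy
  rw [hy]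

/-- A smooth linear equation of first order has a solution without zeros. -/
theorem exists_deriv_eq_mul {V : Set ℝ} (hV : IsOpen V) {g : ℝ → 𝕜} (hg : ContDiffOn ℝ ∞ g V) :
    ∃ f : ℝ → 𝕜, ContDiffOn ℝ ∞ f V ∧ (∀ x, f x ≠ 0) ∧ ∀ x ∈ V, HasDerivAt f (g x * f x) x := by
  obtain ⟨G, hG⟩ := exists_hasDerivAt_of_continuousOn hV hg.continuousOn
  have hGs : ContDiffOn ℝ ∞ G V := by
    rw [contDiffOn_infty_iff_deriv_of_isOpen hV]
    exact ⟨fun x hx => (hG x hx).differentiableAt.differentiableWithinAt,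
      hg.congr fun x hx => (hG x hx).deriv⟩
  have hexp : ContDiff ℝ ∞ (NormedSpace.exp : 𝕜 → 𝕜) :=
    contDiff_iff_contDiffAt.mpr fun x => (NormedSpace.exp_analytic (𝕂 := ℝ) x).contDiffAt
  refine ⟨fun x => NormedSpace.exp (G x), hexp.comp_contDiffOn hGs, fun x => ?_, fun x hx => ?_⟩
  · exact (NormedSpace.isUnit_exp (G x)).ne_zero
  · have h1 : HasDerivAt (NormedSpace.exp : 𝕜 → 𝕜) (NormedSpace.exp (G x)) (G x) :=
      hasDerivAt_exp
    have h2 := h1.scomp x (hG x hx)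
    simpa [smul_eq_mul, Function.comp_def] using h2

/-- A family of series with `∂_1 S = ∂_x S` depends on `x + t_1` only. -/
theorem exists_eq_taylorShift {V : Set ℝ} (hV : IsOpen V) {S : ℝ → MvPowerSeries ℕ+ 𝕜}
    (hS : SmoothCoeffsOn S V)
    (h : ∀ x ∈ V, ∀ d, coeff d (pderiv 𝕜 1 (S x)) = deriv (fun y => coeff d (S y)) x) :
    ∃ τhat : ℝ → MvPowerSeries {k : ℕ+ // k ≠ 1} 𝕜, SmoothCoeffsOn τhat V ∧
      ∀ x ∈ V, S x = taylorShift τhat x := by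
  classical
  let τhat : ℝ → MvPowerSeries {k : ℕ+ // k ≠ 1} 𝕜 := fun y d => coeff d.extendDomain (S y)
  have hcoeff : ∀ y d, coeff d (τhat y) = coeff d.extendDomain (S y) := fun _ _ => rfl
  refine ⟨τhat, fun d => hS _, fun x hx => MvPowerSeries.ext fun d => ?_⟩
  have key : ∀ (n : ℕ) (e : ℕ+ →₀ ℕ), e 1 = 0 → ∀ x ∈ V,
      coeff (e + Finsupp.single 1 n) (S x) =
        iteratedDeriv n (fun y => coeff e (S y)) x / (n ! : 𝕜) := by
    intro n e he
    induction n with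
    | zero => intro x _; simp
    | succ n ih =>
      intro x hx
      have h1 := h x hx (e + Finsupp.single 1 n)
      have h2 : (e + Finsupp.single (1 : ℕ+) n : ℕ+ →₀ ℕ) 1 = n := by simp [he]
      have h3 : deriv (fun y => coeff (e + Finsupp.single 1 n) (S y)) x =
          deriv (fun y => iteratedDeriv n (fun y => coeff e (S y)) y / (n ! : 𝕜)) x := by
        refine Filter.EventuallyEq.deriv_eq ?_
        filter_upwards [hV.mem_nhds hx] with y hy
        exact ih y hy
      rw [coeff_pderiv, h2, h3, deriv_div_const, ← iteratedDeriv_succ, add_assoc,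
        ← Finsupp.single_add] at h1
      have h4 : (n ! : 𝕜) ≠ 0 := Nat.cast_ne_zero.mpr (Nat.factorial_ne_zero _)
      have h5 : ((n : 𝕜) + 1) ≠ 0 := by exact_mod_cast Nat.succ_ne_zero n
      rw [eq_div_iff h4] at h1
      rw [Nat.factorial_succ, eq_div_iff (by push_cast; exact mul_ne_zero h5 h4), ← h1]
      push_cast
      ring
  have hd : d = (d.subtypeDomain fun k : ℕ+ => k ≠ 1).extendDomain + Finsupp.single 1 (d 1) := by
    ext k
    by_cases hk : k = 1
    · subst hk
      simp [Finsupp.extendDomain]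
    · simp [Finsupp.extendDomain, hk]
  rw [coeff_taylorShift]
  simp only [hcoeff]
  rw [← key (d 1) _ (by simp [Finsupp.extendDomain]) x hx, ← hd]

end Solution

/-! ### The solution with given Cauchy-like data -/

section Cauchy

open MvPowerSeries

variable {𝕜 : Type*} [RCLike 𝕜] {ħ : 𝕜} {c : ℕ → ℝ → 𝕜}

/-- The determinantal formula extends from the strictly decreasing sequences that come from diagrams
to all integer sequences, both sides being antisymmetric and vanishing at very negative entries. -/
theorem IsSchurExpansion.pairing_det (hħ : ħ ≠ 0) {T : MvPowerSeries ℕ+ 𝕜} {x : ℝ}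
    (h0 : c 0 x ≠ 0) (hT : IsSchurExpansion ħ (fun lam => detCoeff ħ c lam x) T) (m : ℕ)
    (p : Fin m → ℤ) :
    pairing T (Matrix.det (Matrix.of fun i j : Fin m => opSchur ħ (p i + (j : ℕ)))) =
      c 0 x ^ (1 - (m : ℤ)) *
        Matrix.det (Matrix.of fun i j : Fin m => detEntry ħ c j (p i) x) := by
  refine eq_of_forall_diagram (pairing T).toAddMonoidHom (fun j p => opSchur ħ (p + (j : ℤ)))
    (fun j p => detEntry ħ c j p x) (fun j p h => opSchur_of_neg ħ h)
    (fun j p h => detEntry_of_neg ħ c h x) _ (fun lam hm => ?_) p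
  rw [det_opSchur_eq_schurOp ħ lam hm, det_rows_eq (fun j p => detEntry ħ c j p x) (c 0 x)
    (fun j p h => detEntry_of_neg ħ c h x) (fun j => detEntry_neg_self ħ c j x) lam m hm,
    ← mul_assoc, ← zpow_natCast, ← zpow_add₀ h0]
  refine (hT.pairing_eq hħ lam).trans ?_
  rw [detCoeff_eq]
  congr 2
  push_cast [Nat.cast_sub hm]
  ring

theorem detCoeff_rowDiagram (x : ℝ) (k : ℕ) :
    detCoeff ħ c (rowDiagram k) x = c k x := by
  have h1 := det_rows_eq (fun j p => detEntry ħ c j p x) (c 0 x)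
    (fun j p h => detEntry_of_neg ħ c h x) (fun j => detEntry_neg_self ħ c j x) (rowDiagram k) 1
    (numRows_rowDiagram_le k)
  have h2 : Matrix.det (Matrix.of fun i j : Fin 1 =>
      detEntry ħ c j (((rowDiagram k).rowLen i : ℤ) - (i : ℕ)) x) = c k x := by
    rw [Matrix.det_fin_one]
    simp [detEntry, rowLen_rowDiagram_zero, extendZero_natCast]
  rw [h2] at h1
  rw [detCoeff_eq, h1, ← zpow_natCast, Nat.cast_sub (numRows_rowDiagram_le k), Nat.cast_one]

/-- The coefficients of a sum of Schur functions are finite combinations of its coefficients. -/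
theorem smoothCoeffsOn_of_isSchurExpansion {T : ℝ → MvPowerSeries ℕ+ 𝕜}
    {b : YoungDiagram → ℝ → 𝕜} {V : Set ℝ} (hb : ∀ lam, ContDiffOn ℝ ∞ (b lam) V)
    (hT : ∀ x, IsSchurExpansion ħ (fun lam => b lam x) (T x)) : SmoothCoeffsOn T V := by
  intro d
  have hfin := finite_coeff_schurTimes_ne_zero ħ d
  have h1 : ∀ x, coeff d (T x) =
      ∑ lam ∈ hfin.toFinset, b lam x * coeff d (schurTimes ħ lam) := by
    intro x
    rw [(hT x d).2, finsum_eq_sum_of_support_subset]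
    intro lam h
    rw [Set.Finite.coe_toFinset]
    exact right_ne_zero_of_mul h
  simp only [h1]
  exact ContDiffOn.sum fun lam _ => (hb lam).mul contDiffOn_const

/-- In the direction of `t_1`, the series changes as in `x`, up to a gauge term. This holds for all
pairings with Schur functions, by the Pieri formula. -/
theorem coeff_pderiv_eq_of_isSchurExpansion (hħ : ħ ≠ 0) {V : Set ℝ} (hV : IsOpen V)
    (hc : ∀ k, ContDiffOn ℝ ∞ (c k) V) (h0 : ∀ x ∈ V, c 0 x ≠ 0) {T : ℝ → MvPowerSeries ℕ+ 𝕜}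
    (hT : ∀ x, IsSchurExpansion ħ (fun lam => detCoeff ħ c lam x) (T x)) {x : ℝ} (hx : x ∈ V)
    (d : ℕ+ →₀ ℕ) :
    coeff d (pderiv 𝕜 1 (T x)) = deriv (fun y => coeff d (T y)) x -
      (deriv (c 0) x - ħ⁻¹ * c 1 x) * (c 0 x)⁻¹ * coeff d (T x) := by
  have hsm : SmoothCoeffsOn T V :=
    smoothCoeffsOn_of_isSchurExpansion (contDiffOn_detCoeff hV hc h0) hT
  have hnhds := hV.mem_nhds hx
  have hdiff : ∀ d, DifferentiableAt ℝ (fun y => coeff d (T y)) x := fun d =>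
    ((hsm d).contDiffAt hnhds).differentiableAt (by simp)
  let DT : MvPowerSeries ℕ+ 𝕜 := fun d => deriv (fun y => coeff d (T y)) x
  have hDT : ∀ d, coeff d DT = deriv (fun y => coeff d (T y)) x := fun _ => rfl
  have hpDT : ∀ q, HasDerivAt (fun y => pairing (T y) q) (pairing DT q) x := by
    intro q
    simp only [pairing_eq_sum, hDT]
    exact HasDerivAt.fun_sum fun e _ => (hdiff e).hasDerivAt.const_mul _
  set g : 𝕜 := (deriv (c 0) x - ħ⁻¹ * c 1 x) * (c 0 x)⁻¹ with hg
  have hc0 := h0 x hx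
  have hmain : pderiv 𝕜 1 (T x) - (DT - g • T x) = 0 := by
    refine eq_zero_of_pairing_schurOp_eq_zero hħ _ fun lam => ?_
    rw [pairing_sub, pairing_sub, pairing_smul, ← pairing_X_mul]
    set n := numRows lam
    let p : Fin (n + 1) → ℤ := fun i => (lam.rowLen i : ℤ) - (i : ℕ)
    have hlam : schurOp ħ lam =
        Matrix.det (Matrix.of fun i j : Fin (n + 1) => opSchur ħ (p i + (j : ℕ))) :=
      (det_opSchur_eq_schurOp ħ lam (Nat.le_succ n)).symm
    obtain ⟨r, e, hE, hlast, hsum⟩ := detEntry_pieri (ħ := ħ) hV hc p hx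
    set E : ℝ → 𝕜 := fun y => Matrix.det (Matrix.of fun i j : Fin (n + 1) =>
      detEntry ħ c j (p i) y)
    set P : 𝕜 := pairing (T x) (schurOp ħ lam)
    set P' : 𝕜 := pairing DT (schurOp ħ lam)
    have hz1 : ∀ y : 𝕜, y ^ (1 - ((n + 1 : ℕ) : ℤ)) = (y ^ n)⁻¹ := by
      intro y
      rw [← zpow_natCast, ← zpow_neg]
      congr 1
      omega
    have hz2 : c 0 x ^ (1 - ((n + 2 : ℕ) : ℤ)) = (c 0 x ^ (n + 1))⁻¹ := by
      rw [← zpow_natCast, ← zpow_neg]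
      congr 1
    have hPE : ∀ y ∈ V, c 0 y ^ n * pairing (T y) (schurOp ħ lam) = E y := by
      intro y hy
      rw [hlam, (hT y).pairing_det hħ (h0 y hy), hz1,
        mul_inv_cancel_left₀ (pow_ne_zero _ (h0 y hy))]
    have hder : (n : 𝕜) * c 0 x ^ (n - 1) * deriv (c 0) x * P + c 0 x ^ n * P' = e := by
      have h1 : HasDerivAt (c 0) (deriv (c 0) x) x :=
        (((hc 0).contDiffAt hnhds).differentiableAt (by simp)).hasDerivAt
      have h2 := (h1.fun_pow n).fun_mul (hpDT (schurOp ħ lam))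
      refine h2.unique (hE.congr_of_eventuallyEq ?_)
      filter_upwards [hnhds] with y hy
      exact hPE y hy
    have hpow : (n : 𝕜) * c 0 x ^ (n - 1) * c 0 x = n * c 0 x ^ n := by
      cases n with
      | zero => simp
      | succ n => rw [Nat.add_sub_cancel, pow_succ]; ring
    have hP1 : ħ * pairing (T x) (MvPolynomial.X 1 * schurOp ħ lam) =
        (c 0 x ^ (n + 1))⁻¹ *
          ((c 1 x - ħ * (n + 1) * deriv (c 0) x) * E x - c 0 x * r) +
        (c 0 x ^ n)⁻¹ * (r + ħ * e) := by
      have h1 : ħ * pairing (T x) (MvPolynomial.X 1 * schurOp ħ lam) =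
          pairing (T x) (opSchur ħ 1 * schurOp ħ lam) := by
        rw [opSchur_one, smul_mul_assoc, map_smul, smul_eq_mul]
      rw [h1, hlam, opSchur_mul_det, map_add, map_sum, (hT x).pairing_det hħ hc0, hlast, hz2,
        ← hsum, Finset.mul_sum]
      congr 1
      refine Finset.sum_congr rfl fun l _ => ?_
      rw [(hT x).pairing_det hħ hc0, hz1]
    have hgx : g * c 0 x * ħ = ħ * deriv (c 0) x - c 1 x := by
      rw [hg]
      field_simp
    have hP1' : c 0 x ^ (n + 1) * (ħ * pairing (T x) (MvPolynomial.X 1 * schurOp ħ lam)) =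
        (c 1 x - ħ * (n + 1) * deriv (c 0) x) * E x + ħ * c 0 x * e := by
      rw [hP1, pow_succ]
      field_simp
      ring
    have hne : c 0 x ^ (n + 1) * ħ ≠ 0 := mul_ne_zero (pow_ne_zero _ hc0) hħ
    refine (mul_eq_zero.mp (?_ : c 0 x ^ (n + 1) * ħ * _ = 0)).resolve_left hne
    have hPEx : c 0 x ^ n * P = E x := hPE x hx
    rw [← hPEx, ← hder] at hP1'
    linear_combination hP1' + c 0 x ^ n * P * hgx + ħ * deriv (c 0) x * P * hpow
  have h1 := congrArg (coeff d) (sub_eq_zero.mp hmain)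
  rw [h1, map_sub, hDT, map_smul, smul_eq_mul]

/-- The series with prescribed one-row coefficients and the determinants as its remaining ones is a
tau-function, with a factor `f` that solves `f' = ((c_0' - c_1 / ħ) / c_0) f`. -/
theorem exists_formal_solution (hħ : ħ ≠ 0) {U : Set ℝ} (hU : IsOpen U)
    (hc : ∀ k, ContDiffOn ℝ ∞ (c k) U) :
    ∃ τ : ℝ → MvPowerSeries ℕ+ 𝕜,
      (∀ x ∈ U, c 0 x ≠ 0 →
        IsSchurExpansion ħ (fun lam => detCoeff ħ c lam x) (τ x) ∧
        IsTauFunction ħ (τ x) ∧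
        constantCoeff (τ x) = c 0 x ∧
        ∀ k : ℕ, 1 ≤ k → constantCoeff (hbarDeriv ħ k (τ x)) = (k : 𝕜) / ħ * c k x) ∧
      ∃ (f : ℝ → 𝕜) (τhat : ℝ → MvPowerSeries {k : ℕ+ // k ≠ 1} 𝕜),
        ContDiffOn ℝ ∞ f {x ∈ U | c 0 x ≠ 0} ∧
        SmoothCoeffsOn τhat {x ∈ U | c 0 x ≠ 0} ∧
        ∀ x ∈ U, c 0 x ≠ 0 → f x ≠ 0 ∧ τ x = f x • taylorShift τhat x := by
  choose T hT using fun x => exists_isSchurExpansion ħ fun lam => detCoeff ħ c lam x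
  set V : Set ℝ := {x ∈ U | c 0 x ≠ 0} with hVdef
  have hV : IsOpen V := (hc 0).continuousOn.isOpen_inter_preimage hU isOpen_compl_singleton
  have hcV : ∀ k, ContDiffOn ℝ ∞ (c k) V := fun k => (hc k).mono fun x hx => hx.1
  have h0V : ∀ x ∈ V, c 0 x ≠ 0 := fun x hx => hx.2
  have hrow : ∀ x ∈ V, ∀ k : ℕ, pairing (T x) (opSchur ħ k) = c k x := by
    intro x hx k
    rw [← schurOp_rowDiagram, (hT x).pairing_eq hħ, detCoeff_rowDiagram]
  refine ⟨T, fun x hx hx0 => ⟨hT x, ?_, ?_, fun k _ => ?_⟩, ?_⟩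
  · exact isTauFunction_of_pairing_det hħ (M := fun j p => detEntry ħ c j p x)
      (fun j p h => detEntry_of_neg ħ c h x) (γ := fun m => c 0 x ^ (1 - (m : ℤ)))
      ((hT x).pairing_det hħ hx0)
  · have h1 := hrow x ⟨hx, hx0⟩ 0
    rwa [Nat.cast_zero, opSchur_zero, pairing_one] at h1
  · rw [hbarDeriv, LinearMap.smul_apply, constantCoeff_smul, constantCoeff_elemSchur_pderiv,
      hrow x ⟨hx, hx0⟩]
    rfl
  · have hg : ContDiffOn ℝ ∞
        (fun x => (deriv (c 0) x - ħ⁻¹ * c 1 x) * (c 0 x)⁻¹) V :=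
      (((hcV 0).deriv_of_isOpen hV (by simp)).sub (contDiffOn_const.mul (hcV 1))).mul
        ((hcV 0).inv h0V)
    obtain ⟨f, hf, hf0, hfd⟩ := exists_deriv_eq_mul hV hg
    have hsm : SmoothCoeffsOn T V :=
      smoothCoeffsOn_of_isSchurExpansion (contDiffOn_detCoeff hV hcV h0V) hT
    have hS : SmoothCoeffsOn (fun x => (f x)⁻¹ • T x) V := by
      intro d
      simp only [coeff_smul]
      exact (hf.inv fun x _ => hf0 x).mul (hsm d)
    obtain ⟨τhat, hτs, hτ⟩ := exists_eq_taylorShift hV hS fun x hx d => by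
      have h1 : HasDerivAt (fun y => coeff d (T y)) (deriv (fun y => coeff d (T y)) x) x :=
        (((hsm d).contDiffAt (hV.mem_nhds hx)).differentiableAt (by simp)).hasDerivAt
      have h2 := ((hfd x hx).fun_inv (hf0 x)).fun_mul h1
      simp only [coeff_smul]
      rw [h2.deriv, Derivation.map_smul, coeff_smul,
        coeff_pderiv_eq_of_isSchurExpansion hħ hV hcV h0V hT hx]
      have := hf0 x
      field_simp
      ring
    refine ⟨f, τhat, hf, hτs, fun x hx hx0 => ⟨hf0 x, ?_⟩⟩
    rw [← hτ x ⟨hx, hx0⟩, smul_smul, mul_inv_cancel₀ (hf0 x), one_smul]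

end Cauchy

end

end HbarKP

theorem theorem1 {𝕜 : Type*} [RCLike 𝕜] (ħ : 𝕜) (hħ : ħ ≠ 0) (U : Set ℝ) (hU : IsOpen U) :
    -- the coefficients of a tau-function `f(x) τhat(x + t_1, t_2, …)`
    (∀ (f : ℝ → 𝕜) (τhat : ℝ → MvPowerSeries {k : ℕ+ // k ≠ 1} 𝕜)
        (τ : ℝ → MvPowerSeries ℕ+ 𝕜),
      SmoothCoeffsOn τhat U →
      (∀ x ∈ U, τ x = f x • taylorShift τhat x) →
      (∀ x ∈ U, IsTauFunction ħ (τ x)) →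
      ContDiffOn ℝ ∞ (fun x => MvPowerSeries.constantCoeff (τ x)) U →
      (∀ x ∈ U, ∃! b : YoungDiagram → 𝕜, IsSchurExpansion ħ b (τ x)) ∧
      ∀ c : YoungDiagram → ℝ → 𝕜,
        (∀ x ∈ U, IsSchurExpansion ħ (fun lam => c lam x) (τ x)) →
        (∀ x ∈ U, c ⊥ x ≠ 0 →
          f x ≠ 0 ∧ DifferentiableAt ℝ f x ∧
          (∀ lam : YoungDiagram, ContDiffAt ℝ ∞ (c lam) x) ∧
          ∀ lam : YoungDiagram, c lam x = detCoeff ħ (fun k => c (rowDiagram k)) lam x) ∧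
        (∀ x ∈ U, f x ≠ 0 → DifferentiableAt ℝ f x →
          c (rowDiagram 1) x = ħ * (deriv (c ⊥) x - c ⊥ x * (deriv f x / f x)))) ∧
    -- the formal solution with arbitrary Cauchy-like data
    (∀ c : ℕ → ℝ → 𝕜, (∀ k, ContDiffOn ℝ ∞ (c k) U) → (∃ x ∈ U, c 0 x ≠ 0) →
      ∃ τ : ℝ → MvPowerSeries ℕ+ 𝕜,
        (∀ x ∈ U, c 0 x ≠ 0 →
          IsSchurExpansion ħ (fun lam => detCoeff ħ c lam x) (τ x) ∧
          IsTauFunction ħ (τ x) ∧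
          MvPowerSeries.constantCoeff (τ x) = c 0 x ∧
          ∀ k : ℕ, 1 ≤ k →
            MvPowerSeries.constantCoeff (hbarDeriv ħ k (τ x)) = (k : 𝕜) / ħ * c k x) ∧
        ∃ (f : ℝ → 𝕜) (τhat : ℝ → MvPowerSeries {k : ℕ+ // k ≠ 1} 𝕜),
          ContDiffOn ℝ ∞ f {x ∈ U | c 0 x ≠ 0} ∧
          SmoothCoeffsOn τhat {x ∈ U | c 0 x ≠ 0} ∧
          ∀ x ∈ U, c 0 x ≠ 0 → f x ≠ 0 ∧ τ x = f x • taylorShift τhat x) := by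
  refine ⟨fun f τhat τ hsm hτ htau h0 => ⟨fun x _ => ?_, fun c hc => ⟨fun x hx hcx => ?_,
    fun x hx hfx hf => ?_⟩⟩, fun c hc _ => ?_⟩
  · exact ⟨fun lam => pairing (τ x) (schurOp ħ lam), (isSchurExpansion_iff hħ _ _).mpr fun _ => rfl,
      fun b hb => funext fun lam => (hb.pairing_eq hħ lam).symm⟩
  · exact eq_detCoeff_of_isTauFunction hħ hU hsm hτ htau h0 hc hx hcx
  · exact coeff_row_one_eq hħ hU hsm hτ hc hx hfx hf
  · exact exists_formal_solution hħ hU hc
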